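/- Let $\alpha<\beta$, $T>0$, $a>0$, $a_0>a/2$, $\rho>0$ and let $k\ge 0$ be an integer; put $\Omega=(\alpha,\beta)$ and let $\|\cdot\|$ and $(\cdot,\cdot)$ be the norm and inner product of $L^2(\Omega)$. Let $U$ be the (continuous on $[0,T]\times[\alpha,\beta]$) exact solution of $$U_t=(a-a_0)U_{xx}+a_0U_{xx}\quad(\text{that is, }U_t=aU_{xx})\quad\text{on }\Omega\times(0,T]$$ with periodic boundary conditions $U(\alpha,t)=U(\beta,t)$, $U_x(\alpha,t)=U_x(\beta,t)$, and assume $$U\in L^\infty(0,T;H^{k+2}(\Omega)),\qquad D_tU\in L^\infty(0,T;H^{k+1}(\Omega)),\qquad D_t^3U\in L^\infty(0,T;L^2(\Omega)).$$ Let $\alpha=x_{1/2}<x_{3/2}<\dots<x_{N+1/2}=\beta$ be a partition of $\Omega$ into $N\ge1$ cells $I_j=(x_{j-1/2},x_{j+1/2})$ of lengths $h_j$, with $h=\max_j h_j$, that is quasi-uniform: $h_j\ge\rho h$ for all $j$. Let $V_h$ be the space of functions whose restriction to each $I_j$ is a polynomial of degree at most $k$; $v^\pm$ are the right and left traces at the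 interfaces, where $v^-_{1/2}=v^-_{N+1/2}$ and $v^+_{N+1/2}=v^+_{1/2}$. For $q,v,u,r\in V_h$ let $$\mathcal L(q,v)=-\sum_{j=1}^N\Big[\int_{I_j}q\,v_x\,dx-q^+_{j+1/2}v^-_{j+1/2}+q^+_{j-1/2}v^+_{j-1/2}\Big],$$ $$\mathcal K(u,r)=-\sum_{j=1}^N\Big[\int_{I_j}u\,r_x\,dx-u^-_{j+1/2}r^-_{j+1/2}+u^-_{j-1/2}r^+_{j-1/2}\Big].$$ The second order EIN-LDG scheme with time step $\Delta t>0$ and $t^n=n\Delta t$ is: for all $n\ge 0$ and all $v,r\in V_h$, the functions $u^n,q^n,u^{n,1},q^{n,1}\in V_h$ satisfy $$(u^{n,1},v)=(u^n,v)+\tfrac12(a-a_0)\Delta t\,\mathcal L(q^n,v)+\tfrac12a_0\Delta t\,\mathcal L(q^{n,1},v),$$ $$(u^{n+1},v)=(u^n,v)+(a-a_0)\Delta t\,\mathcal L(q^{n,1},v)+\tfrac12a_0\Delta t\,[\mathcal L(q^n,v)+\mathcal L(q^{n+1},v)],$$ $$(q^{n},r)=\mathcal K(u^{n},r),\qquad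 (q^{n,1},r)=\mathcal K(u^{n,1},r),$$ with initial value $u^0=\pi_h^-U(\cdot,0)$. Here the Gauss–Radau projection $\pi_h^-p\in V_h$ of a continuous function $p$ is defined by $\int_{I_j}(\pi_h^-p-p)\,v\,dx=0$ for every polynomial $v$ of degree at most $k-1$ (no condition if $k=0$) and $(\pi_h^-p)^-_{j+1/2}=p(x_{j+1/2})$, $j=1,\dots,N$. Then there is a constant $C>0$ such that, for every such mesh and every $\Delta t>0$, $$\max_{n\Delta t\le T}\|U(\cdot,t^n)-u^n\|\le C\,(h^{k+1}+\Delta t^2).$$ The constant $C$ is independent of $n$, $h$, $\Delta t$ and of the mesh (it may depend on $U,T,\alpha,\beta,a,a_0,k,\rho$). -/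

import Mathlib

open Set MeasureTheory
open scoped Polynomial ContDiff NNReal

noncomputable section

namespace EINLDG

/-! ### Weak derivatives, Sobolev regularity and the exact solution -/

/-- Smooth test functions with compact support inside the open set `O`. -/
def IsTestFunction {E : Type*} [NormedAddCommGroup E] [NormedSpace ℝ E]
    (O : Set E) (φ : E → ℝ) : Prop :=
  ContDiff ℝ ∞ φ ∧ HasCompactSupport φ ∧ tsupport φ ⊆ O

/-- `g` is the weak derivative of order `i` of `f` on the open interval `(α, β)`. -/
def IsWeakDeriv (α β : ℝ) (i : ℕ) (f g : ℝ → ℝ) : Prop :=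
  ∀ φ : ℝ → ℝ, IsTestFunction (Ioo α β) φ →
    ∫ x in Ioo α β, f x * iteratedDeriv i φ x = (-1) ^ i * ∫ x in Ioo α β, g x * φ x

/-- `V` is the weak time derivative of order `l` of `F` on `(0, T) × (α, β)`; the first argument
of `F` and `V` is time, the second one is space. -/
def IsWeakTimeDeriv (α β T : ℝ) (l : ℕ) (F V : ℝ → ℝ → ℝ) : Prop :=
  ∀ φ : ℝ × ℝ → ℝ, IsTestFunction (Ioo 0 T ×ˢ Ioo α β) φ →
    ∫ z in Ioo 0 T ×ˢ Ioo α β, F z.1 z.2 * iteratedDeriv l (fun s => φ (s, z.2)) z.1 =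
      (-1) ^ l * ∫ z in Ioo 0 T ×ˢ Ioo α β, V z.1 z.2 * φ z

/-- `F ∈ L^∞(0, T; H^m(α, β))`: here `G i` is the `i`-th weak derivative of `F` in space. For
functions with values in `L²(α, β)`, Bochner measurability in time is joint measurability. -/
def MemLinftySobolev (α β T : ℝ) (m : ℕ) (F : ℝ → ℝ → ℝ) : Prop :=
  ∃ G : ℕ → ℝ → ℝ → ℝ, G 0 = F ∧ ∀ i ≤ m,
    AEStronglyMeasurable (fun z : ℝ × ℝ => G i z.1 z.2)
      (volume.restrict (Ioo 0 T ×ˢ Ioo α β)) ∧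
    (∃ M : ℝ≥0, ∀ᵐ t ∂(volume.restrict (Ioo 0 T)),
      MemLp (G i t) 2 (volume.restrict (Ioo α β)) ∧
      eLpNorm (G i t) 2 (volume.restrict (Ioo α β)) ≤ M) ∧
    ∀ᵐ t ∂(volume.restrict (Ioo 0 T)), IsWeakDeriv α β i (F t) (G i t)

/-- The smoothness assumption: `U ∈ L^∞(0, T; H^(k+2))`, `D_t U ∈ L^∞(0, T; H^(k+1))` and
`D_t^3 U ∈ L^∞(0, T; L^2)`. -/
structure SmoothnessAssumption (α β T : ℝ) (k : ℕ) (U : ℝ → ℝ → ℝ) : Prop where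
  space : MemLinftySobolev α β T (k + 2) U
  time_one : ∃ V, IsWeakTimeDeriv α β T 1 U V ∧ MemLinftySobolev α β T (k + 1) V
  time_three : ∃ V, IsWeakTimeDeriv α β T 3 U V ∧ MemLinftySobolev α β T 0 V

/-- `U` (first argument time, second argument space) is a solution on `[0, T] × [α, β]` of
`U_t = (a - a₀) U_xx + a₀ U_xx` with periodic boundary conditions for `U` and `U_x`. The equation
is understood in the sense of distributions. `U` is the continuous
representative, so that its values at fixed times and at single points make sense. -/
structure IsPeriodicSolution (α β T a a₀ : ℝ) (U : ℝ → ℝ → ℝ) : Prop where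
  continuousOn : ContinuousOn (fun z : ℝ × ℝ => U z.1 z.2) (Icc 0 T ×ˢ Icc α β)
  equation : ∀ φ : ℝ × ℝ → ℝ, IsTestFunction (Ioo 0 T ×ˢ Ioo α β) φ →
    -(∫ z in Ioo 0 T ×ˢ Ioo α β, U z.1 z.2 * deriv (fun s => φ (s, z.2)) z.1) =
      (a - a₀) * (∫ z in Ioo 0 T ×ˢ Ioo α β,
        U z.1 z.2 * iteratedDeriv 2 (fun y => φ (z.1, y)) z.2) +
      a₀ * (∫ z in Ioo 0 T ×ˢ Ioo α β,
        U z.1 z.2 * iteratedDeriv 2 (fun y => φ (z.1, y)) z.2)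
  periodic : ∀ t ∈ Ioc 0 T, U t α = U t β
  periodic_deriv : ∀ t ∈ Ioc 0 T, ∃ d : ℝ,
    HasDerivWithinAt (U t) d (Icc α β) α ∧ HasDerivWithinAt (U t) d (Icc α β) β

/-! ### Meshes and the discontinuous finite element space -/

/-- A partition `α = x_{1/2} < x_{3/2} < ⋯ < x_{N+1/2} = β` of `[α, β]` into `N ≥ 1` cells. -/
structure Mesh (α β : ℝ) where
  N : ℕ
  N_pos : 0 < N
  node : Fin (N + 1) → ℝ
  node_strictMono : StrictMono node
  node_zero : node 0 = α
  node_last : node (Fin.last N) = β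

namespace Mesh

variable {α β : ℝ} (M : Mesh α β)

/-- Left end point `x_{j-1/2}` of the cell `I_j`. -/
def left (j : Fin M.N) : ℝ := M.node j.castSucc

/-- Right end point `x_{j+1/2}` of the cell `I_j`. -/
def right (j : Fin M.N) : ℝ := M.node j.succ

/-- The mesh size `h`, the largest cell length. -/
def size : ℝ := ⨆ j : Fin M.N, (M.right j - M.left j)

/-- Quasi-uniformity with parameter `ρ`: `h_j / h ≥ ρ` for all `j`. -/
def QuasiUniform (ρ : ℝ) : Prop := ∀ j, ρ * M.size ≤ M.right j - M.left j

/-- The space `V_h` of piecewise polynomials of degree at most `k`: one polynomial on each cell,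
with no continuity across the cell interfaces. -/
abbrev DGSpace (k : ℕ) : Type := Fin M.N → Polynomial.degreeLT ℝ (k + 1)

variable {M} {k : ℕ}

/-- The value at `x` of the polynomial that represents `v` on the cell `I_j`. -/
def val (v : M.DGSpace k) (j : Fin M.N) (x : ℝ) : ℝ := (v j : ℝ[X]).eval x

/-- The `x`-derivative of `v` on the cell `I_j`. -/
def dval (v : M.DGSpace k) (j : Fin M.N) (x : ℝ) : ℝ :=
  (Polynomial.derivative (v j : ℝ[X])).eval x

/-- The trace `v^-_{j+1/2}`, from inside `I_j` at its right end point. -/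
def traceMinus (v : M.DGSpace k) (j : Fin M.N) : ℝ := val v j (M.right j)

/-- The trace `v^+_{j-1/2}`, from inside `I_j` at its left end point. -/
def tracePlus (v : M.DGSpace k) (j : Fin M.N) : ℝ := val v j (M.left j)

/-- The `L²(Ω)` inner product `(u, v)` of two elements of `V_h`. -/
def ip (u v : M.DGSpace k) : ℝ :=
  ∑ j, ∫ x in (M.left j)..(M.right j), val u j x * val v j x

/-- The form `ℒ(q, v)` with flux `q^+`. The `+` trace at `x_{j+1/2}` is taken from the next cell;
the cell after the last one is the first one (periodicity). -/
def formL (q v : M.DGSpace k) : ℝ :=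
  -∑ j, ((∫ x in (M.left j)..(M.right j), val q j x * dval v j x)
    - tracePlus q (finRotate M.N j) * traceMinus v j
    + tracePlus q j * tracePlus v j)

/-- The form `𝒦(u, r)` with flux `u^-`. The `-` trace at `x_{j-1/2}` is taken from the previous
cell; the cell before the first one is the last one (periodicity). -/
def formK (u r : M.DGSpace k) : ℝ :=
  -∑ j, ((∫ x in (M.left j)..(M.right j), val u j x * dval r j x)
    - traceMinus u j * traceMinus r j
    + traceMinus u ((finRotate M.N).symm j) * tracePlus r j)

/-- `w = π_h^- p`, the Gauss–Radau projection of the continuous function `p`. -/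
def IsGaussRadauMinus (p : ℝ → ℝ) (w : M.DGSpace k) : Prop :=
  ∀ j, (∀ v ∈ Polynomial.degreeLT ℝ k,
      ∫ x in (M.left j)..(M.right j), (val w j x - p x) * v.eval x = 0) ∧
    traceMinus w j = p (M.right j)

/-- The norm `‖p - v‖` in `L²(Ω)` of the difference of a function `p` and `v ∈ V_h`. -/
def errorNorm (p : ℝ → ℝ) (v : M.DGSpace k) : ℝ :=
  Real.sqrt (∑ j, ∫ x in (M.left j)..(M.right j), (p x - val v j x) ^ 2)

end Mesh

open Mesh

/-- The second order EIN-LDG scheme with time step `dt`: `u n`, `q n` stand for `u^n`, `q^n`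
and `u₁ n`, `q₁ n` for the intermediate stage `u^{n,1}`, `q^{n,1}`. -/
structure IsSecondOrderEINLDG {α β : ℝ} {M : Mesh α β} {k : ℕ} (a a₀ dt : ℝ)
    (u q u₁ q₁ : ℕ → M.DGSpace k) : Prop where
  stage_one : ∀ n, ∀ v : M.DGSpace k,
    ip (u₁ n) v = ip (u n) v + 1 / 2 * (a - a₀) * dt * formL (q n) v
      + 1 / 2 * a₀ * dt * formL (q₁ n) v
  stage_two : ∀ n, ∀ v : M.DGSpace k,
    ip (u (n + 1)) v = ip (u n) v + (a - a₀) * dt * formL (q₁ n) v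
      + 1 / 2 * a₀ * dt * (formL (q n) v + formL (q (n + 1)) v)
  aux : ∀ n, ∀ r : M.DGSpace k, ip (q n) r = formK (u n) r
  aux_one : ∀ n, ∀ r : M.DGSpace k, ip (q₁ n) r = formK (u₁ n) r

end EINLDG

end

/-!
The equation and the scheme are linear and have constant coefficients, so the exact solution and
the numerical solution can both be analysed spectrally.

On the discrete side, `V_h` is a finite dimensional Hilbert space. The forms `ℒ` and `𝒦` are
negative adjoints of each other, so that with the Riesz representation `D = dgDeriv` of `𝒦` the
scheme is the iteration `u^{n+1} = R(Δt A) u^n` with the positive semidefinite operator `A = D† D`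
and an explicit rational function `R = stab` (`IsSecondOrderEINLDG.eq_stepOp`). The condition
`a₀ > a / 2` gives `|R| ≤ 1` on `[0, ∞)`, and `R(z) = e^{-az} + O(z³)` near zero. This yields
unconditional stability and, for an approximate eigenvector of `A` with eigenvalue close to `κ²`,
an estimate of `R(Δt A)^n w - e^{-a n Δt κ²} w` that is uniform in `n`.

For a single Fourier mode of wave number `κ` the Gauss–Radau projection is such an approximate
eigenvector up to a correction of size `|κ|^{k+1} h^{k+1}`. The correction is obtained from
the resolvent of `A` at `-κ²`. The result is an error bound `C (|κ|^{k+1} h^{k+1} + κ⁴ Δt²)` times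
the amplitude of the mode (`exists_mode_error_le`). Superposition
(`exists_error_le_of_hasFourierSeries`) gives the theorem as soon as the Fourier coefficients `c_m`
of `U(·, 0)` satisfy `∑ ‖c_m‖ (|κ_m|^{k+1} + κ_m⁴) < ∞`.

This summability comes from the regularity assumptions (`exists_hasFourierSeries`). The weak
formulation and the boundary conditions show that the `m`-th coefficient of `U(·, t)` is
`e^{-a κ_m² t} c_m` (`IsPeriodicSolution.moment_eq`). For positive times the Fourier series is
smooth, so the weak space derivative of order `k + 2` has coefficients
`(i κ_m)^{k+2} e^{-a κ_m² t} c_m`; the third weak time derivative has coefficients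
`-(a κ_m²)³ e^{-a κ_m² t} c_m`. Bessel's inequality, uniformly for `t → 0`, makes
`κ_m^{k+2} c_m` and `κ_m⁶ c_m` square summable, and one spare power of `κ_m` turns this into the
absolute summability that is needed.
-/


noncomputable section

namespace EINLDG

section

/-! ### The stability function of the scheme -/

/-- The stability function of the second order EIN scheme: a solution component on which the
discrete operator `-∂ₓ²` acts as multiplication by `μ` is multiplied by `stab a a₀ (dt * μ)` in
each time step. -/
def stab (a a₀ z : ℝ) : ℝ :=
  (1 - (a - a₀) * z + ((a - a₀) ^ 2 / 2 - a₀ ^ 2 / 4) * z ^ 2) / (1 + a₀ / 2 * z) ^ 2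

lemma abs_stab_le_one {a a₀ z : ℝ} (ha : 0 < a) (ha₀ : a / 2 < a₀) (hz : 0 ≤ z) :
    |stab a a₀ z| ≤ 1 := by
  have h1 : 0 < 1 + a₀ / 2 * z := by have : 0 < a₀ := by linarith
                                     positivity
  have hz2 : 0 ≤ z ^ 2 := sq_nonneg z
  unfold stab
  rw [abs_le, le_div_iff₀ (by positivity), div_le_one (by positivity)]
  constructor
  · nlinarith [mul_nonneg (by linarith : 0 ≤ 2 * a₀ - a) hz, mul_nonneg (sq_nonneg (a - a₀)) hz2]
  · nlinarith [mul_nonneg ha.le hz,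
      mul_nonneg (mul_nonneg ha.le (by linarith : 0 ≤ 2 * a₀ - a)) hz2]

lemma stab_zero (a a₀ : ℝ) : stab a a₀ 0 = 1 := by simp [stab]

lemma exists_abs_stab_sub_le {a a₀ : ℝ} (ha₀ : 0 < a₀) :
    ∃ C : ℝ, 0 ≤ C ∧ ∀ z z₀ : ℝ, 0 ≤ z → 0 ≤ z₀ →
      |stab a a₀ z - stab a a₀ z₀| ≤ C * |z - z₀| / (1 + z₀) := by
  set b := a₀ / 2 with hb
  have hb0 : 0 < b := by positivity
  set p := a - a₀ with hp
  set c := (a - a₀) ^ 2 / 2 - a₀ ^ 2 / 4 with hc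
  set K := |p + 2 * b| + |c - b ^ 2| + |2 * b * c + p * b ^ 2| with hK
  have hK0 : 0 ≤ K := by positivity
  set m := min 1 b with hm
  have hm0 : 0 < m := lt_min one_pos hb0
  have hm1 : m ≤ 1 := min_le_left _ _
  have hmb : m ≤ b := min_le_right _ _
  refine ⟨K / m ^ 3, by positivity, fun z z₀ hz hz₀ => ?_⟩
  have h1 : 0 < 1 + b * z := by positivity
  have h2 : 0 < 1 + b * z₀ := by positivity
  -- The divided difference of `stab` at `z`, `z₀` is a bilinear polynomial over the denominators.
  have key : stab a a₀ z - stab a a₀ z₀ = (z - z₀) *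
      (-(p + 2 * b) + (c - b ^ 2) * (z + z₀) + (2 * b * c + p * b ^ 2) * (z * z₀)) /
        ((1 + b * z) ^ 2 * (1 + b * z₀) ^ 2) := by
    unfold stab
    rw [← hb, ← hp, ← hc]
    field_simp
    ring
  have hq1 : m * (1 + z) ≤ 1 + b * z := by nlinarith
  have hq2 : m * (1 + z₀) ≤ 1 + b * z₀ := by nlinarith
  have hnum : |-(p + 2 * b) + (c - b ^ 2) * (z + z₀) + (2 * b * c + p * b ^ 2) * (z * z₀)|
      ≤ K * ((1 + z) * (1 + z₀)) := by
    calc _ ≤ |-(p + 2 * b)| + |(c - b ^ 2) * (z + z₀)| + |(2 * b * c + p * b ^ 2) * (z * z₀)| :=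
          abs_add_three _ _ _
      _ = |p + 2 * b| * 1 + |c - b ^ 2| * (z + z₀) + |2 * b * c + p * b ^ 2| * (z * z₀) := by
          rw [abs_neg, abs_mul, abs_mul, abs_of_nonneg (by positivity : 0 ≤ z + z₀),
            abs_of_nonneg (by positivity : 0 ≤ z * z₀), mul_one]
      _ ≤ |p + 2 * b| * ((1 + z) * (1 + z₀)) + |c - b ^ 2| * ((1 + z) * (1 + z₀))
          + |2 * b * c + p * b ^ 2| * ((1 + z) * (1 + z₀)) := by
          have := mul_nonneg hz hz₀
          gcongr <;> nlinarith
      _ = _ := by rw [hK]; ring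
  rw [key, abs_div, abs_mul, abs_of_pos (by positivity : 0 < (1 + b * z) ^ 2 * (1 + b * z₀) ^ 2),
    div_le_div_iff₀ (by positivity) (by positivity)]
  have hden : m ^ 3 * ((1 + z) * (1 + z₀) * (1 + z₀)) ≤ (1 + b * z) ^ 2 * (1 + b * z₀) ^ 2 := by
    have e1 : m * (1 + z) ≤ (1 + b * z) ^ 2 := by nlinarith [mul_nonneg hb0.le hz]
    have e2 : (m * (1 + z₀)) ^ 2 ≤ (1 + b * z₀) ^ 2 := by gcongr
    calc _ = (m * (1 + z)) * (m * (1 + z₀)) ^ 2 := by ring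
      _ ≤ _ := by gcongr
  calc _ ≤ |z - z₀| * (K * ((1 + z) * (1 + z₀))) * (1 + z₀) := by gcongr
    _ = (K / m ^ 3 * |z - z₀|) * (m ^ 3 * ((1 + z) * (1 + z₀) * (1 + z₀))) := by
        field_simp
    _ ≤ _ := by gcongr

lemma abs_exp_neg_sub_quadratic_le {x : ℝ} (hx : 0 ≤ x) :
    |Real.exp (-x) - (1 - x + x ^ 2 / 2)| ≤ x ^ 3 := by
  by_cases h : x ≤ 1
  · have := Real.exp_bound (x := -x) (by rwa [abs_neg, abs_of_nonneg hx]) (n := 3) (by norm_num)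
    simp only [Finset.sum_range_succ, Finset.sum_range_zero, abs_neg, abs_of_nonneg hx] at this
    norm_num [Nat.factorial] at this
    have hx3 : 0 ≤ x ^ 3 := by positivity
    rw [show Real.exp (-x) - (1 - x + x ^ 2 / 2) = Real.exp (-x) - (1 + -x + x ^ 2 / 2) by ring]
    nlinarith
  · push Not at h
    have h0 := Real.exp_pos (-x)
    have h1 : Real.exp (-x) ≤ 1 := Real.exp_le_one_iff.2 (by linarith)
    rw [abs_le]
    constructor <;> nlinarith [mul_pos (by linarith : 0 < x) (by linarith : 0 < x)]

/-- The scheme is of second order: `stab` agrees with the exponential to third order at `0`. -/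
lemma exists_abs_stab_sub_exp_le {a a₀ : ℝ} (ha : 0 < a) (ha₀ : a / 2 < a₀) :
    ∃ C : ℝ, 0 ≤ C ∧ ∀ z : ℝ, 0 ≤ z →
      |stab a a₀ z - Real.exp (-(a * z))| ≤ C * min 1 (z ^ 3) := by
  have ha₀' : 0 < a₀ := by linarith
  set A := |a * a₀ ^ 2 / 4 - a ^ 2 * a₀ / 2| + a ^ 2 * a₀ ^ 2 / 8 + a ^ 3 with hA
  refine ⟨A + 2, by positivity, fun z hz => ?_⟩
  by_cases h : z ≤ 1
  · rw [min_eq_right (pow_le_one₀ hz h)]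
    have h1 : 1 ≤ (1 + a₀ / 2 * z) ^ 2 := by nlinarith [mul_nonneg ha₀'.le hz, sq_nonneg (a₀ * z)]
    have key : stab a a₀ z - (1 - a * z + (a * z) ^ 2 / 2) =
        ((a * a₀ ^ 2 / 4 - a ^ 2 * a₀ / 2) - a ^ 2 * a₀ ^ 2 / 8 * z) * z ^ 3
          / (1 + a₀ / 2 * z) ^ 2 := by
      have : (1 + a₀ / 2 * z) ≠ 0 := by positivity
      unfold stab
      rw [eq_div_iff (by positivity), sub_mul, div_mul_cancel₀ _ (by positivity)]
      ring
    have e1 : |stab a a₀ z - (1 - a * z + (a * z) ^ 2 / 2)| ≤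
        (|a * a₀ ^ 2 / 4 - a ^ 2 * a₀ / 2| + a ^ 2 * a₀ ^ 2 / 8) * z ^ 3 := by
      rw [key, abs_div, abs_mul, abs_of_nonneg (by positivity : 0 ≤ z ^ 3),
        abs_of_nonneg (by positivity : 0 ≤ (1 + a₀ / 2 * z) ^ 2)]
      refine (div_le_self (by positivity) h1).trans ?_
      gcongr
      refine (abs_sub _ _).trans ?_
      gcongr
      rw [abs_of_nonneg (by positivity)]
      exact mul_le_of_le_one_right (by positivity) h
    have e2 := abs_exp_neg_sub_quadratic_le (mul_nonneg ha.le hz)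
    have e3 : |stab a a₀ z - Real.exp (-(a * z))| ≤
        |stab a a₀ z - (1 - a * z + (a * z) ^ 2 / 2)| +
          |Real.exp (-(a * z)) - (1 - a * z + (a * z) ^ 2 / 2)| := by
      rw [abs_sub_comm (Real.exp _)]
      exact abs_sub_le _ _ _
    have hz3 : 0 ≤ z ^ 3 := by positivity
    have e4 : (a * z) ^ 3 = a ^ 3 * z ^ 3 := mul_pow _ _ _
    rw [hA]
    nlinarith
  · push Not at h
    rw [min_eq_left (one_le_pow₀ h.le)]
    have h0 := Real.exp_pos (-(a * z))
    have h1 : Real.exp (-(a * z)) ≤ 1 := Real.exp_le_one_iff.2 (by nlinarith)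
    have h2 := abs_le.1 (abs_stab_le_one ha ha₀ hz)
    have h3 : 0 ≤ A := by positivity
    rw [abs_le]
    constructor <;> linarith [h2.1, h2.2]

lemma abs_pow_sub_pow_le_div {x y : ℝ} (hx : |x| ≤ 1) (hy0 : 0 ≤ y) (hy : y < 1) (n : ℕ) :
    |x ^ n - y ^ n| ≤ |x - y| / (1 - y) := by
  have h1 : 0 < 1 - y := by linarith
  have key : ∀ n : ℕ, |x ^ n - y ^ n| ≤ |x - y| * ((1 - y ^ n) / (1 - y)) := by
    intro n
    induction n with
    | zero => simp
    | succ n ih =>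
      have e : x ^ (n + 1) - y ^ (n + 1) = x * (x ^ n - y ^ n) + (x - y) * y ^ n := by ring
      rw [e]
      refine (abs_add_le _ _).trans ?_
      rw [abs_mul, abs_mul, abs_of_nonneg (by positivity : 0 ≤ y ^ n)]
      calc _ ≤ 1 * (|x - y| * ((1 - y ^ n) / (1 - y))) + |x - y| * y ^ n := by gcongr
        _ = _ := by field_simp; ring
  refine (key n).trans ?_
  rw [mul_div_assoc']
  gcongr
  have : 0 ≤ y ^ n := by positivity
  nlinarith [abs_nonneg (x - y)]

/-- Comparison of `n` steps of the scheme for the eigenvalue `z` with the exact evolution for `z₀`.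
The bound does not grow with `n`, since the exact evolution is damped. -/
lemma exists_abs_stab_pow_sub_exp_pow_le {a a₀ : ℝ} (ha : 0 < a) (ha₀ : a / 2 < a₀) :
    ∃ C : ℝ, 0 ≤ C ∧ ∀ (n : ℕ) (z z₀ : ℝ), 0 ≤ z → 0 < z₀ →
      |stab a a₀ z ^ n - Real.exp (-(a * z₀)) ^ n| ≤ C * (|z - z₀| / z₀ + min 1 (z₀ ^ 2)) := by
  obtain ⟨C₁, hC₁, h₁⟩ := exists_abs_stab_sub_le (a := a) (a₀ := a₀) (by linarith)
  obtain ⟨C₂, hC₂, h₂⟩ := exists_abs_stab_sub_exp_le ha ha₀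
  have hK : 0 < 1 + 1 / a := by positivity
  refine ⟨(1 + 1 / a) * (C₁ + 2 * C₂), by positivity, fun n z z₀ hz hz₀ => ?_⟩
  have haz : 0 < a * z₀ := by positivity
  have hs1 : Real.exp (-(a * z₀)) < 1 := Real.exp_lt_one_iff.2 (by linarith)
  -- `1 / (1 - exp (-x)) ≤ 1 + 1 / x`
  have hinv : 1 / (1 - Real.exp (-(a * z₀))) ≤ (1 + 1 / a) * ((1 + z₀) / z₀) := by
    have e1 : Real.exp (-(a * z₀)) ≤ 1 / (1 + a * z₀) := by
      rw [Real.exp_neg, ← one_div]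
      have := Real.add_one_le_exp (a * z₀)
      gcongr
      linarith
    have e2 : a * z₀ / (1 + a * z₀) ≤ 1 - Real.exp (-(a * z₀)) := by
      have : a * z₀ / (1 + a * z₀) = 1 - 1 / (1 + a * z₀) := by field_simp; ring
      linarith
    calc _ ≤ 1 / (a * z₀ / (1 + a * z₀)) := by gcongr
      _ = (1 + a * z₀) / (a * z₀) := one_div_div _ _
      _ ≤ _ := by
        rw [show (1 + 1 / a) * ((1 + z₀) / z₀) = ((a + 1) * (1 + z₀)) / (a * z₀) by field_simp]
        gcongr
        nlinarith
  refine (abs_pow_sub_pow_le_div (abs_stab_le_one ha ha₀ hz) (Real.exp_pos _).le hs1 n).trans ?_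
  have hd : |stab a a₀ z - Real.exp (-(a * z₀))| ≤
      C₁ * |z - z₀| / (1 + z₀) + C₂ * min 1 (z₀ ^ 3) :=
    (abs_sub_le _ (stab a a₀ z₀) _).trans (add_le_add (h₁ z z₀ hz hz₀.le) (h₂ z₀ hz₀.le))
  have hm : min 1 (z₀ ^ 3) * ((1 + z₀) / z₀) ≤ 2 * min 1 (z₀ ^ 2) := by
    rw [mul_div_assoc', div_le_iff₀ hz₀]
    by_cases h : z₀ ≤ 1
    · rw [min_eq_right (pow_le_one₀ hz₀.le h), min_eq_right (pow_le_one₀ hz₀.le h)]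
      nlinarith [pow_pos hz₀ 3]
    · push Not at h
      rw [min_eq_left (one_le_pow₀ h.le), min_eq_left (one_le_pow₀ h.le)]
      linarith
  calc _ = |stab a a₀ z - Real.exp (-(a * z₀))| * (1 / (1 - Real.exp (-(a * z₀)))) := by ring
    _ ≤ (C₁ * |z - z₀| / (1 + z₀) + C₂ * min 1 (z₀ ^ 3)) * ((1 + 1 / a) * ((1 + z₀) / z₀)) := by
        gcongr
    _ = (1 + 1 / a) * (C₁ * (|z - z₀| / z₀) + C₂ * (min 1 (z₀ ^ 3) * ((1 + z₀) / z₀))) := by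
        field_simp
    _ ≤ (1 + 1 / a) * (C₁ * (|z - z₀| / z₀) + C₂ * (2 * min 1 (z₀ ^ 2))) := by gcongr
    _ ≤ _ := by
        have x1 : 0 ≤ |z - z₀| / z₀ := by positivity
        have x2 : 0 ≤ min 1 (z₀ ^ 2) := le_min zero_le_one (by positivity)
        rw [mul_assoc]
        gcongr
        nlinarith

end

section

/-! ### Spectral analysis of the time stepping in an abstract Hilbert space -/

section Hilbert

open scoped InnerProductSpace

variable {V : Type*} [NormedAddCommGroup V] [InnerProductSpace ℝ V] [FiniteDimensional ℝ V]
  (D : V →ₗ[ℝ] V)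

/-- The operator `D† D`, the discrete analogue of `-∂ₓ²` when `D` is a discrete `∂ₓ`. -/
def lapOp : V →ₗ[ℝ] V := LinearMap.adjoint D ∘ₗ D

lemma lapOp_isSymmetric : (lapOp D).IsSymmetric :=
  (LinearMap.isPositive_adjoint_comp_self D).isSymmetric

/-- An orthonormal basis of eigenvectors of `lapOp D`. -/
def lapBasis : OrthonormalBasis (Fin (Module.finrank ℝ V)) ℝ V :=
  (lapOp_isSymmetric D).eigenvectorBasis rfl

/-- The eigenvalues of `lapOp D`. -/
def lapEigenvalue (i : Fin (Module.finrank ℝ V)) : ℝ := (lapOp_isSymmetric D).eigenvalues rfl i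

lemma lapBasis_repr_lapOp (v : V) (i : Fin (Module.finrank ℝ V)) :
    (lapBasis D).repr (lapOp D v) i = lapEigenvalue D i * (lapBasis D).repr v i :=
  (lapOp_isSymmetric D).eigenvectorBasis_apply_self_apply rfl v i

lemma lapEigenvalue_nonneg (i : Fin (Module.finrank ℝ V)) : 0 ≤ lapEigenvalue D i :=
  (LinearMap.isPositive_adjoint_comp_self D).nonneg_eigenvalues rfl i

lemma norm_sq_eq_sum_lapBasis_repr (v : V) : ‖v‖ ^ 2 = ∑ i, (lapBasis D).repr v i ^ 2 := by
  rw [← (lapBasis D).repr.norm_map v, EuclideanSpace.norm_sq_eq]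
  simp

/-- The functional calculus of `lapOp D`: `g` applied to the eigenvalues. -/
def lapCalc (g : ℝ → ℝ) : V →ₗ[ℝ] V :=
  (lapBasis D).toBasis.constr ℝ fun i => g (lapEigenvalue D i) • lapBasis D i

lemma lapBasis_repr_lapCalc (g : ℝ → ℝ) (v : V) (i : Fin (Module.finrank ℝ V)) :
    (lapBasis D).repr (lapCalc D g v) i = g (lapEigenvalue D i) * (lapBasis D).repr v i := by
  rw [lapCalc, Module.Basis.constr_apply_fintype]
  simp [OrthonormalBasis.repr_self, Pi.single_apply, mul_comm]

lemma lapBasis_repr_lapCalc_pow (g : ℝ → ℝ) (n : ℕ) (v : V) (i : Fin (Module.finrank ℝ V)) :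
    (lapBasis D).repr ((lapCalc D g ^ n) v) i =
      g (lapEigenvalue D i) ^ n * (lapBasis D).repr v i := by
  induction n with
  | zero => simp
  | succ n ih => rw [pow_succ', Module.End.mul_apply, lapBasis_repr_lapCalc, ih]; ring

lemma inner_lapOp_self (v : V) : ⟪lapOp D v, v⟫_ℝ = ‖D v‖ ^ 2 := by
  rw [lapOp, LinearMap.comp_apply, LinearMap.adjoint_inner_left, real_inner_self_eq_norm_sq]

/-- The one-step operator `u^n ↦ u^{n+1}` of the scheme. -/
def stepOp (a a₀ dt : ℝ) : V →ₗ[ℝ] V := lapCalc D fun z => stab a a₀ (dt * z)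

variable {D}

lemma norm_stepOp_pow_le {a a₀ dt : ℝ} (ha : 0 < a) (ha₀ : a / 2 < a₀) (hdt : 0 ≤ dt) (n : ℕ)
    (v : V) : ‖(stepOp D a a₀ dt ^ n) v‖ ≤ ‖v‖ := by
  rw [← sq_le_sq₀ (norm_nonneg _) (norm_nonneg _), norm_sq_eq_sum_lapBasis_repr D,
    norm_sq_eq_sum_lapBasis_repr D v]
  refine Finset.sum_le_sum fun i _ => ?_
  rw [stepOp, lapBasis_repr_lapCalc_pow, mul_pow, ← sq_abs (_ ^ n), abs_pow]
  refine mul_le_of_le_one_left (sq_nonneg _) (pow_le_one₀ (by positivity) ?_)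
  exact pow_le_one₀ (abs_nonneg _)
    (abs_stab_le_one ha ha₀ (mul_nonneg hdt (lapEigenvalue_nonneg D i)))

lemma eq_stepOp_of_stages {a a₀ dt : ℝ} (ha₀ : 0 < a₀) (hdt : 0 ≤ dt) {u u₁ u' : V}
    (h₁ : u₁ = u - (1 / 2 * (a - a₀) * dt) • lapOp D u - (1 / 2 * a₀ * dt) • lapOp D u₁)
    (h₂ : u' = u - ((a - a₀) * dt) • lapOp D u₁
      - (1 / 2 * a₀ * dt) • (lapOp D u + lapOp D u')) :
    u' = stepOp D a a₀ dt u := by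
  apply (lapBasis D).repr.injective
  ext i
  have e₁ := congrArg (fun v => (lapBasis D).repr v i) h₁
  have e₂ := congrArg (fun v => (lapBasis D).repr v i) h₂
  have hμ := lapEigenvalue_nonneg D i
  simp only [map_sub, map_smul, map_add, PiLp.sub_apply, PiLp.smul_apply, PiLp.add_apply,
    smul_eq_mul, lapBasis_repr_lapOp] at e₁ e₂
  rw [stepOp, lapBasis_repr_lapCalc, stab]
  set μ := lapEigenvalue D i
  set x := (lapBasis D).repr u i
  set y := (lapBasis D).repr u₁ i
  set w := (lapBasis D).repr u' i
  have hd : 0 < 1 + a₀ / 2 * (dt * μ) := by positivity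
  have f₁ : (1 + a₀ / 2 * (dt * μ)) * y = (1 - (a - a₀) / 2 * (dt * μ)) * x := by
    linear_combination e₁
  have f₂ : (1 + a₀ / 2 * (dt * μ)) * w =
      (1 - a₀ / 2 * (dt * μ)) * x - (a - a₀) * (dt * μ) * y := by linear_combination e₂
  rw [div_mul_eq_mul_div, eq_div_iff (by positivity)]
  linear_combination (1 + a₀ / 2 * (dt * μ)) * f₂ - (a - a₀) * (dt * μ) * f₁

lemma stepOp_pow_apply_of_eq_zero {a a₀ dt : ℝ} {w : V} (hw : D w = 0) (n : ℕ) :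
    (stepOp D a a₀ dt ^ n) w = w := by
  apply (lapBasis D).repr.injective
  ext i
  have h := lapBasis_repr_lapOp D w i
  rw [lapOp, LinearMap.comp_apply, hw, map_zero, map_zero] at h
  rw [stepOp, lapBasis_repr_lapCalc_pow]
  rcases mul_eq_zero.1 (show lapEigenvalue D i * (lapBasis D).repr w i = 0 from h.symm) with h | h
  · simp [h, stab_zero]
  · simp [h]

/-- If `w` is an approximate eigenvector of `lapOp D` for the eigenvalue `κ²`, then the scheme
started at `w` follows the exact decay `exp (-a κ² t)` up to the relative residual of `w` and the
second order error in time. -/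
lemma exists_norm_stepOp_pow_sub_le {a a₀ : ℝ} (ha : 0 < a) (ha₀ : a / 2 < a₀) :
    ∃ C : ℝ, 0 ≤ C ∧ ∀ {V : Type} [NormedAddCommGroup V] [InnerProductSpace ℝ V]
      [FiniteDimensional ℝ V] (D : V →ₗ[ℝ] V) (n : ℕ) (dt κ : ℝ) (w δ : V), 0 < dt → 0 < κ →
      lapOp D w = κ ^ 2 • w + κ ^ 2 • δ →
      ‖(stepOp D a a₀ dt ^ n) w - Real.exp (-(a * (dt * κ ^ 2))) ^ n • w‖ ≤
        C * (‖δ‖ + min 1 ((dt * κ ^ 2) ^ 2) * ‖w‖) := by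
  obtain ⟨C, hC, h⟩ := exists_abs_stab_pow_sub_exp_pow_le ha ha₀
  refine ⟨2 * C, by positivity, ?_⟩
  intro V _ _ _ D n dt κ w δ hdt hκ hw
  set m := min 1 ((dt * κ ^ 2) ^ 2) with hm
  have hm0 : 0 ≤ m := le_min zero_le_one (by positivity)
  rw [← sq_le_sq₀ (norm_nonneg _) (by positivity)]
  have hsum : ‖(stepOp D a a₀ dt ^ n) w - Real.exp (-(a * (dt * κ ^ 2))) ^ n • w‖ ^ 2 ≤
      2 * C ^ 2 * ‖δ‖ ^ 2 + 2 * C ^ 2 * m ^ 2 * ‖w‖ ^ 2 := by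
    rw [norm_sq_eq_sum_lapBasis_repr D, norm_sq_eq_sum_lapBasis_repr D δ,
      norm_sq_eq_sum_lapBasis_repr D w, Finset.mul_sum, Finset.mul_sum, ← Finset.sum_add_distrib]
    refine Finset.sum_le_sum fun i _ => ?_
    have hδ := congrArg (fun v => (lapBasis D).repr v i) hw
    have hμ := lapEigenvalue_nonneg D i
    simp only [map_sub, map_smul, map_add, PiLp.sub_apply, PiLp.smul_apply, PiLp.add_apply,
      smul_eq_mul, lapBasis_repr_lapOp, stepOp, lapBasis_repr_lapCalc_pow] at hδ ⊢
    set μ := lapEigenvalue D i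
    set x := (lapBasis D).repr w i
    set d := (lapBasis D).repr δ i
    have h1 := h n (dt * μ) (dt * κ ^ 2) (by positivity) (by positivity)
    rw [← hm] at h1
    have h2 : |dt * μ - dt * κ ^ 2| / (dt * κ ^ 2) * |x| = |d| := by
      rw [← mul_sub, abs_mul, abs_of_pos hdt, mul_div_mul_left _ _ hdt.ne', div_mul_eq_mul_div,
        ← abs_mul, show (μ - κ ^ 2) * x = κ ^ 2 * d by linear_combination hδ, abs_mul,
        abs_of_pos (by positivity : 0 < κ ^ 2)]
      field_simp
    rw [← sub_mul, ← sq_abs, abs_mul]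
    calc _ ≤ (C * (|dt * μ - dt * κ ^ 2| / (dt * κ ^ 2) + m) * |x|) ^ 2 := by gcongr
      _ = C ^ 2 * (|d| + m * |x|) ^ 2 := by rw [← h2]; ring
      _ ≤ C ^ 2 * (2 * (|d| ^ 2 + (m * |x|) ^ 2)) := by
          gcongr
          exact add_sq_le
      _ = _ := by rw [mul_pow m, sq_abs, sq_abs]; ring
  refine hsum.trans ?_
  have h3 : 0 ≤ ‖δ‖ * (m * ‖w‖) := by positivity
  have h4 : 0 ≤ ‖δ‖ ^ 2 + (m * ‖w‖) ^ 2 := by positivity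
  nlinarith [sq_nonneg C, mul_nonneg (sq_nonneg C) h3, mul_nonneg (sq_nonneg C) h4]

/-- Variant of `exists_norm_stepOp_pow_sub_le` in which a part `D† η` of the residual is only
controlled through `η`. It is removed by the corrector `ξ` with `(D† D + κ²) ξ = -D† η`, whose
norm is at most `‖η‖ / (2 κ)`. -/
lemma exists_norm_stepOp_pow_sub_le_of_adjoint {a a₀ : ℝ} (ha : 0 < a) (ha₀ : a / 2 < a₀) :
    ∃ C : ℝ, 0 ≤ C ∧ ∀ {V : Type} [NormedAddCommGroup V] [InnerProductSpace ℝ V]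
      [FiniteDimensional ℝ V] (D : V →ₗ[ℝ] V) (n : ℕ) (dt κ : ℝ) (w δ η : V), 0 < dt → 0 < κ →
      lapOp D w = κ ^ 2 • w + κ ^ 2 • δ + LinearMap.adjoint D η →
      ‖(stepOp D a a₀ dt ^ n) w - Real.exp (-(a * (dt * κ ^ 2))) ^ n • w‖ ≤
        C * (‖δ‖ + ‖η‖ / κ + (dt * κ ^ 2) ^ 2 * ‖w‖) := by
  obtain ⟨C, hC, h⟩ := exists_norm_stepOp_pow_sub_le ha ha₀
  refine ⟨2 * C + 1, by positivity, ?_⟩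
  intro V _ _ _ D n dt κ w δ η hdt hκ hw
  set ξ : V := -lapCalc D (fun z => (z + κ ^ 2)⁻¹) (LinearMap.adjoint D η) with hξ
  have hξ1 : lapOp D ξ = -LinearMap.adjoint D η - κ ^ 2 • ξ := by
    apply (lapBasis D).repr.injective
    ext i
    have hμ := lapEigenvalue_nonneg D i
    simp only [map_sub, map_neg, map_smul, PiLp.sub_apply, PiLp.smul_apply, PiLp.neg_apply,
      smul_eq_mul, lapBasis_repr_lapOp, hξ, lapBasis_repr_lapCalc]
    have : lapEigenvalue D i + κ ^ 2 ≠ 0 := by positivity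
    field_simp
    ring
  have hξ2 : κ * ‖ξ‖ ≤ ‖η‖ / 2 := by
    have e := inner_lapOp_self D ξ
    rw [hξ1, inner_sub_left, inner_neg_left, LinearMap.adjoint_inner_left, inner_smul_left,
      real_inner_self_eq_norm_sq] at e
    simp only [conj_trivial] at e
    have e2 : -⟪η, D ξ⟫_ℝ ≤ ‖η‖ * ‖D ξ‖ := by
      rw [← inner_neg_left, ← norm_neg η]
      exact real_inner_le_norm _ _
    rw [← sq_le_sq₀ (by positivity) (by positivity)]
    nlinarith [sq_nonneg (‖η‖ / 2 - ‖D ξ‖)]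
  have hξ3 : ‖ξ‖ ≤ ‖η‖ / κ / 2 := by
    rw [div_div, mul_comm κ, ← div_div, le_div_iff₀ hκ]
    linarith
  have hw' : lapOp D (w + ξ) = κ ^ 2 • (w + ξ) + κ ^ 2 • (δ - (2 : ℝ) • ξ) := by
    rw [map_add, hw, hξ1]
    module
  have h1 := h D n dt κ (w + ξ) _ hdt hκ hw'
  set s := Real.exp (-(a * (dt * κ ^ 2))) with hs
  have hs0 : 0 ≤ s := (Real.exp_pos _).le
  have hs1 : s ≤ 1 := Real.exp_le_one_iff.2 (by
    have : 0 < a * (dt * κ ^ 2) := by positivity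
    linarith)
  set m := min 1 ((dt * κ ^ 2) ^ 2)
  have hm0 : 0 ≤ m := le_min zero_le_one (by positivity)
  have hm1 : m ≤ 1 := min_le_left _ _
  have hm2 : m ≤ (dt * κ ^ 2) ^ 2 := min_le_right _ _
  have split : (stepOp D a a₀ dt ^ n) w - s ^ n • w =
      ((stepOp D a a₀ dt ^ n) (w + ξ) - s ^ n • (w + ξ))
        - (stepOp D a a₀ dt ^ n) ξ + s ^ n • ξ := by
    rw [map_add]; module
  have h2 : ‖s ^ n • ξ‖ ≤ ‖ξ‖ := by
    rw [norm_smul, Real.norm_of_nonneg (by positivity)]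
    exact mul_le_of_le_one_left (norm_nonneg _) (pow_le_one₀ hs0 hs1)
  have h3 : ‖δ - (2 : ℝ) • ξ‖ ≤ ‖δ‖ + 2 * ‖ξ‖ := by
    refine (norm_sub_le _ _).trans ?_
    rw [norm_smul]; simp
  have h4 := norm_add_le w ξ
  rw [split]
  calc _ ≤ ‖(stepOp D a a₀ dt ^ n) (w + ξ) - s ^ n • (w + ξ)‖
        + ‖(stepOp D a a₀ dt ^ n) ξ‖ + ‖s ^ n • ξ‖ :=
        (norm_add_le _ _).trans (add_le_add_left (norm_sub_le _ _) _)
    _ ≤ C * ((‖δ‖ + 2 * ‖ξ‖) + m * (‖w‖ + ‖ξ‖)) + ‖ξ‖ + ‖ξ‖ := by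
        gcongr
        · exact h1.trans (by gcongr)
        · exact norm_stepOp_pow_le ha ha₀ hdt.le n ξ
    _ ≤ C * (‖δ‖ + 3 * ‖ξ‖ + (dt * κ ^ 2) ^ 2 * ‖w‖) + 2 * ‖ξ‖ := by
        have e1 : m * ‖w‖ ≤ (dt * κ ^ 2) ^ 2 * ‖w‖ := by gcongr
        have e2 : m * ‖ξ‖ ≤ ‖ξ‖ := mul_le_of_le_one_left (norm_nonneg _) hm1
        nlinarith
    _ ≤ _ := by
        have e1 : 0 ≤ (dt * κ ^ 2) ^ 2 * ‖w‖ := by positivity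
        have e2 : 0 ≤ ‖η‖ / κ := by positivity
        nlinarith [norm_nonneg δ, norm_nonneg ξ, mul_le_mul_of_nonneg_left hξ3 hC,
          mul_nonneg hC e2]

end Hilbert

end

section

/-! ### The finite element space as a Hilbert space -/

open Mesh
open scoped InnerProductSpace

namespace Mesh

variable {α β : ℝ} {M : Mesh α β} {k : ℕ}

lemma left_lt_right (j : Fin M.N) : M.left j < M.right j :=
  M.node_strictMono (Fin.castSucc_lt_succ)

lemma le_left (j : Fin M.N) : α ≤ M.left j := by
  exact M.node_zero.symm.trans_le (M.node_strictMono.monotone (Fin.zero_le _))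

lemma right_le (j : Fin M.N) : M.right j ≤ β := by
  exact (M.node_strictMono.monotone (Fin.le_last _)).trans_eq M.node_last

lemma Icc_cell_subset (j : Fin M.N) : Icc (M.left j) (M.right j) ⊆ Icc α β :=
  Icc_subset_Icc (le_left j) (right_le j)

lemma sum_cell_length : ∑ j, (M.right j - M.left j) = β - α := by
  have key : ∀ (n : ℕ) (x : Fin (n + 1) → ℝ),
      ∑ j : Fin n, (x j.succ - x j.castSucc) = x (Fin.last n) - x 0 := by
    intro n
    induction n with
    | zero => intro x; simp
    | succ n ih =>
      intro x
      rw [Fin.sum_univ_castSucc]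
      have := ih fun i => x i.castSucc
      simp only [Fin.succ_castSucc] at this ⊢
      rw [this, Fin.succ_last, Fin.castSucc_zero]
      ring
  refine (key M.N M.node).trans ?_
  rw [M.node_zero, M.node_last]

lemma cell_length_le_size (j : Fin M.N) : M.right j - M.left j ≤ M.size :=
  le_ciSup (f := fun j : Fin M.N => M.right j - M.left j) (Set.finite_range _).bddAbove j

lemma size_pos : 0 < M.size :=
  (sub_pos.2 (left_lt_right ⟨0, M.N_pos⟩)).trans_le (cell_length_le_size _)

lemma apply_left_finRotate {f : ℝ → ℝ} (hf : f α = f β) (j : Fin M.N) :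
    f (M.left (finRotate M.N j)) = f (M.right j) := by
  obtain ⟨N, hN, x, hx, h0, h1⟩ := M
  obtain ⟨n, rfl⟩ : ∃ n, N = n + 1 := ⟨N - 1, by omega⟩
  simp only [left, right] at *
  rcases Fin.eq_castSucc_or_eq_last j with ⟨i, rfl⟩ | rfl
  · congr 2
    rw [finRotate_apply]
    ext
    simp
  · rw [finRotate_last, Fin.castSucc_zero, h0, Fin.succ_last, h1, hf]

lemma apply_right_finRotate_symm {f : ℝ → ℝ} (hf : f α = f β) (j : Fin M.N) :
    f (M.right ((finRotate M.N).symm j)) = f (M.left j) := by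
  rw [← apply_left_finRotate hf, Equiv.apply_symm_apply]

@[simp] lemma val_add (u v : M.DGSpace k) (j : Fin M.N) (x : ℝ) :
    val (u + v) j x = val u j x + val v j x := by simp [val]

@[simp] lemma val_sub (u v : M.DGSpace k) (j : Fin M.N) (x : ℝ) :
    val (u - v) j x = val u j x - val v j x := by simp [val]

@[simp] lemma val_smul (c : ℝ) (v : M.DGSpace k) (j : Fin M.N) (x : ℝ) :
    val (c • v) j x = c * val v j x := by simp [val]

@[simp] lemma dval_add (u v : M.DGSpace k) (j : Fin M.N) (x : ℝ) :
    dval (u + v) j x = dval u j x + dval v j x := by simp [dval]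

@[simp] lemma dval_smul (c : ℝ) (v : M.DGSpace k) (j : Fin M.N) (x : ℝ) :
    dval (c • v) j x = c * dval v j x := by simp [dval]

@[fun_prop] lemma continuous_val (v : M.DGSpace k) (j : Fin M.N) : Continuous (val v j) :=
  Polynomial.continuous _

@[fun_prop] lemma continuous_dval (v : M.DGSpace k) (j : Fin M.N) : Continuous (dval v j) :=
  Polynomial.continuous _

lemma hasDerivAt_val (v : M.DGSpace k) (j : Fin M.N) (x : ℝ) :
    HasDerivAt (val v j) (dval v j x) x := Polynomial.hasDerivAt _ _

lemma derivative_mem_degreeLT (v : M.DGSpace k) (j : Fin M.N) :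
    Polynomial.derivative (v j : ℝ[X]) ∈ Polynomial.degreeLT ℝ k := by
  have h := (v j).2
  by_cases h0 : (v j : ℝ[X]) = 0
  · simp [h0]
  · rw [Polynomial.mem_degreeLT] at h ⊢
    have h1 := Polynomial.degree_derivative_lt h0
    refine h1.trans_le ?_
    rw [Polynomial.degree_eq_natDegree h0] at h ⊢
    have : (v j : ℝ[X]).natDegree < k + 1 := by exact_mod_cast h
    exact_mod_cast Nat.lt_succ_iff.1 this

end Mesh

open Mesh

variable {α β : ℝ}

lemma integral_add_of_continuous {f g : ℝ → ℝ} (hf : Continuous f) (hg : Continuous g) (a b : ℝ) :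
    ∫ x in a..b, (f x + g x) = (∫ x in a..b, f x) + ∫ x in a..b, g x :=
  intervalIntegral.integral_add (hf.intervalIntegrable _ _) (hg.intervalIntegrable _ _)

lemma ip_add_left {M : Mesh α β} {k : ℕ} (u v w : M.DGSpace k) :
    ip (u + v) w = ip u w + ip v w := by
  simp only [ip, val_add, add_mul, ← Finset.sum_add_distrib]
  refine Finset.sum_congr rfl fun j _ => integral_add_of_continuous (by fun_prop) (by fun_prop) _ _

lemma ip_smul_left {M : Mesh α β} {k : ℕ} (c : ℝ) (u w : M.DGSpace k) :
    ip (c • u) w = c * ip u w := by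
  simp only [ip, val_smul, mul_assoc, Finset.mul_sum, intervalIntegral.integral_const_mul]

lemma ip_comm {M : Mesh α β} {k : ℕ} (u v : M.DGSpace k) : ip u v = ip v u := by
  simp only [ip, mul_comm]

lemma ip_self_nonneg {M : Mesh α β} {k : ℕ} (u : M.DGSpace k) : 0 ≤ ip u u :=
  Finset.sum_nonneg fun j _ =>
    intervalIntegral.integral_nonneg (left_lt_right j).le fun _ _ => mul_self_nonneg _

/-- A polynomial whose square has zero integral over a nontrivial interval vanishes. -/
lemma eq_zero_of_integral_mul_self_eq_zero {l r : ℝ} (hlr : l < r) {p : ℝ[X]} {f : ℝ → ℝ}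
    (hf : Continuous f) (hpos : ∀ x ∈ Ioo l r, 0 < f x) (hnn : ∀ x ∈ Icc l r, 0 ≤ f x)
    (h : ∫ x in l..r, f x * (p.eval x * p.eval x) = 0) : p = 0 := by
  by_contra hp
  have hex : ∃ c ∈ Ioo l r, p.eval c ≠ 0 := by
    by_contra hcon
    push Not at hcon
    exact hp (Polynomial.eq_zero_of_infinite_isRoot p
      ((Ioo_infinite hlr).mono fun x hx => hcon x hx))
  obtain ⟨c, hc, hpc⟩ := hex
  refine absurd h (intervalIntegral.integral_pos hlr ?_ ?_ ⟨c, Ioo_subset_Icc_self hc, ?_⟩).ne'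
  · have := p.continuous
    fun_prop
  · intro x hx
    exact mul_nonneg (hnn x (Ioc_subset_Icc_self hx)) (mul_self_nonneg _)
  · exact mul_pos (hpos c hc) (mul_self_pos.2 hpc)

lemma eq_zero_of_ip_self {M : Mesh α β} {k : ℕ} {u : M.DGSpace k} (h : ip u u = 0) : u = 0 := by
  rw [ip, Finset.sum_eq_zero_iff_of_nonneg fun j _ =>
    intervalIntegral.integral_nonneg (left_lt_right j).le fun _ _ => mul_self_nonneg _] at h
  funext j
  refine Subtype.ext (eq_zero_of_integral_mul_self_eq_zero (left_lt_right j) continuous_const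
    (f := fun _ => 1) (by simp) (by simp) ?_)
  simpa [val] using h j (Finset.mem_univ j)

section Hilbert

variable {M : Mesh α β} {k : ℕ}

instance : Module.Finite ℝ (M.DGSpace k) :=
  have : Module.Finite ℝ (Polynomial.degreeLT ℝ (k + 1)) :=
    Module.Finite.equiv (Polynomial.degreeLTEquiv ℝ (k + 1)).symm
  inferInstanceAs (Module.Finite ℝ (M.DGSpace k))

/-- The `L²(α, β)` inner product on `V_h`. -/
@[reducible] def ipCore (M : Mesh α β) (k : ℕ) : InnerProductSpace.Core ℝ (M.DGSpace k) where
  inner u v := ip u v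
  conj_inner_symm u v := by simpa using ip_comm v u
  re_inner_nonneg u := by simpa using ip_self_nonneg u
  add_left u v w := ip_add_left u v w
  smul_left u v c := by exact ip_smul_left c u v
  definite u h := eq_zero_of_ip_self h

instance : NormedAddCommGroup (M.DGSpace k) := (ipCore M k).toNormedAddCommGroup

instance : InnerProductSpace ℝ (M.DGSpace k) := InnerProductSpace.ofCore (ipCore M k).toCore

lemma inner_eq_ip (u v : M.DGSpace k) : ⟪u, v⟫_ℝ = ip u v := rfl

lemma norm_sq_eq_sum (u : M.DGSpace k) :
    ‖u‖ ^ 2 = ∑ j, ∫ x in (M.left j)..(M.right j), val u j x ^ 2 := by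
  rw [← real_inner_self_eq_norm_sq, inner_eq_ip, ip]
  simp only [pow_two]

lemma sum_integral_sq_le {g : Fin M.N → ℝ → ℝ} {ε : ℝ} (hg : ∀ j, Continuous (g j))
    (h : ∀ j, ∀ x ∈ Icc (M.left j) (M.right j), |g j x| ≤ ε) :
    ∑ j, ∫ x in (M.left j)..(M.right j), g j x ^ 2 ≤ ε ^ 2 * (β - α) := by
  rw [← sum_cell_length (M := M), Finset.mul_sum]
  refine Finset.sum_le_sum fun j _ => ?_
  calc _ ≤ ∫ _ in (M.left j)..(M.right j), ε ^ 2 := by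
        refine intervalIntegral.integral_mono_on (left_lt_right j).le
          (((hg j).pow 2).intervalIntegrable _ _) (by simp) fun x hx => ?_
        rw [← sq_abs]
        have := h j x hx
        gcongr
    _ = _ := by rw [intervalIntegral.integral_const, smul_eq_mul, mul_comm]

lemma norm_le_of_abs_val_le {u : M.DGSpace k} {B : ℝ} (hB : 0 ≤ B)
    (h : ∀ j, ∀ x ∈ Icc (M.left j) (M.right j), |val u j x| ≤ B) :
    ‖u‖ ≤ B * √(β - α) := by
  have hαβ : 0 ≤ β - α := by
    rw [← sum_cell_length (M := M)]
    exact Finset.sum_nonneg fun j _ => (sub_pos.2 (left_lt_right j)).le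
  rw [← sq_le_sq₀ (norm_nonneg _) (by positivity), mul_pow, Real.sq_sqrt hαβ, norm_sq_eq_sum]
  exact sum_integral_sq_le (fun j => continuous_val _ j) h

/-- The `L²` projection onto `V_h` of a cellwise continuous function. -/
lemma exists_riesz {g : Fin M.N → ℝ → ℝ} {ε : ℝ} (hε : 0 ≤ ε) (hg : ∀ j, Continuous (g j))
    (h : ∀ j, ∀ x ∈ Icc (M.left j) (M.right j), |g j x| ≤ ε) :
    ∃ ρ : M.DGSpace k, ‖ρ‖ ≤ ε * √(β - α) ∧ ∀ v : M.DGSpace k,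
      ⟪ρ, v⟫_ℝ = ∑ j, ∫ x in (M.left j)..(M.right j), g j x * val v j x := by
  let F : M.DGSpace k →ₗ[ℝ] ℝ :=
    { toFun := fun v => ∑ j, ∫ x in (M.left j)..(M.right j), g j x * val v j x
      map_add' := fun u v => by
        rw [← Finset.sum_add_distrib]
        refine Finset.sum_congr rfl fun j _ => ?_
        have := hg j
        rw [← integral_add_of_continuous (by fun_prop) (by fun_prop)]
        congr 1
        funext x
        rw [← mul_add]
        congr 1
        exact val_add u v j x
      map_smul' := fun c v => by
        rw [RingHom.id_apply, smul_eq_mul, Finset.mul_sum]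
        refine Finset.sum_congr rfl fun j _ => ?_
        rw [← intervalIntegral.integral_const_mul]
        congr 1
        funext x
        rw [mul_left_comm]
        congr 1
        exact val_smul c v j x }
  have hFin : FiniteDimensional ℝ (M.DGSpace k) := inferInstance
  have : CompleteSpace (M.DGSpace k) := FiniteDimensional.complete ℝ _
  set ρ : M.DGSpace k := (InnerProductSpace.toDual ℝ _).symm (LinearMap.toContinuousLinearMap F)
    with hρ
  have hin : ∀ v : M.DGSpace k, ⟪ρ, v⟫_ℝ =
      ∑ j, ∫ x in (M.left j)..(M.right j), g j x * val v j x := fun v => by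
    rw [hρ, InnerProductSpace.toDual_symm_apply]; rfl
  refine ⟨ρ, ?_, hin⟩
  have hαβ : 0 ≤ β - α := by
    rw [← sum_cell_length (M := M)]
    exact Finset.sum_nonneg fun j _ => (sub_pos.2 (left_lt_right j)).le
  rw [← sq_le_sq₀ (norm_nonneg _) (by positivity), mul_pow, Real.sq_sqrt hαβ]
  refine le_trans ?_ (sum_integral_sq_le hg h)
  -- `2 ‖ρ‖² = 2 ∫ g ρ ≤ ∫ g² + ∫ ρ²`
  have h2 : 2 * ‖ρ‖ ^ 2 ≤ (∑ j, ∫ x in (M.left j)..(M.right j), g j x ^ 2) + ‖ρ‖ ^ 2 := by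
    nth_rw 1 [← real_inner_self_eq_norm_sq]
    rw [hin ρ, norm_sq_eq_sum, ← Finset.sum_add_distrib]
    rw [Finset.mul_sum]
    refine Finset.sum_le_sum fun j _ => ?_
    have := hg j
    rw [← intervalIntegral.integral_const_mul,
      ← integral_add_of_continuous (by fun_prop) (by fun_prop)]
    refine intervalIntegral.integral_mono_on (left_lt_right j).le
      (Continuous.intervalIntegrable (by fun_prop) _ _)
      (Continuous.intervalIntegrable (by fun_prop) _ _) fun x _ => ?_
    have := two_mul_le_add_sq (g j x) (val ρ j x)
    linarith
  linarith

/-! ### The discrete derivative -/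

lemma formK_add_left (u v r : M.DGSpace k) : formK (u + v) r = formK u r + formK v r := by
  simp only [formK, traceMinus, tracePlus, val_add, add_mul]
  rw [← neg_add, ← Finset.sum_add_distrib]
  congr 1
  refine Finset.sum_congr rfl fun j _ => ?_
  rw [integral_add_of_continuous (by fun_prop) (by fun_prop)]
  ring

lemma formK_smul_left (c : ℝ) (u r : M.DGSpace k) : formK (c • u) r = c * formK u r := by
  simp only [formK, traceMinus, tracePlus, val_smul, mul_assoc,
    intervalIntegral.integral_const_mul]
  rw [mul_neg, Finset.mul_sum]
  congr 1
  refine Finset.sum_congr rfl fun j _ => ?_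
  ring

lemma formK_add_right (u r s : M.DGSpace k) : formK u (r + s) = formK u r + formK u s := by
  simp only [formK, traceMinus, tracePlus, val_add, dval_add, mul_add]
  rw [← neg_add, ← Finset.sum_add_distrib]
  congr 1
  refine Finset.sum_congr rfl fun j _ => ?_
  rw [integral_add_of_continuous (by fun_prop) (by fun_prop)]
  ring

lemma formK_smul_right (c : ℝ) (u r : M.DGSpace k) : formK u (c • r) = c * formK u r := by
  simp only [formK, traceMinus, tracePlus, val_smul, dval_smul, mul_left_comm _ c,
    intervalIntegral.integral_const_mul]
  rw [mul_neg, Finset.mul_sum]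
  congr 1
  refine Finset.sum_congr rfl fun j _ => ?_
  ring

/-- Integration by parts on one cell. -/
lemma integral_val_mul_deriv {f f' : ℝ → ℝ} (hf : ∀ x, HasDerivAt f (f' x) x) (hf' : Continuous f')
    (r : M.DGSpace k) (j : Fin M.N) :
    ∫ x in (M.left j)..(M.right j), f x * dval r j x =
      f (M.right j) * traceMinus r j - f (M.left j) * tracePlus r j
        - ∫ x in (M.left j)..(M.right j), f' x * val r j x :=
  intervalIntegral.integral_mul_deriv_eq_deriv_mul (fun x _ => hf x)
    (fun x _ => hasDerivAt_val r j x) (hf'.intervalIntegrable _ _)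
    ((continuous_dval r j).intervalIntegrable _ _)

/-- The two discrete derivatives are adjoint to each other up to sign. -/
lemma formL_eq_neg_formK (q v : M.DGSpace k) : formL q v = -formK v q := by
  simp only [formL, formK]
  rw [← sub_eq_zero, neg_neg, sub_eq_add_neg, ← neg_add, neg_eq_zero, ← Finset.sum_add_distrib]
  have h1 : ∀ j, ∫ x in (M.left j)..(M.right j), val v j x * dval q j x =
      traceMinus v j * traceMinus q j - tracePlus v j * tracePlus q j
        - ∫ x in (M.left j)..(M.right j), val q j x * dval v j x := fun j => by
    rw [integral_val_mul_deriv (hasDerivAt_val v j) (continuous_dval v j)]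
    simp only [mul_comm]
    rfl
  have h2 : ∑ j, traceMinus v ((finRotate M.N).symm j) * tracePlus q j =
      ∑ j, tracePlus q (finRotate M.N j) * traceMinus v j := by
    rw [← Equiv.sum_comp (finRotate M.N)]
    refine Finset.sum_congr rfl fun j _ => ?_
    rw [Equiv.symm_apply_apply, mul_comm]
  rw [← sub_eq_zero.2 h2, ← Finset.sum_sub_distrib]
  refine Finset.sum_congr rfl fun j _ => ?_
  rw [h1]
  ring

/-- The form `𝒦` as a bilinear map. -/
def formKHom (M : Mesh α β) (k : ℕ) : M.DGSpace k →ₗ[ℝ] M.DGSpace k →ₗ[ℝ] ℝ :=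
  LinearMap.mk₂ ℝ (fun u r => formK u r)
    (fun u v r => formK_add_left u v r)
    (fun c u r => formK_smul_left c u r)
    (fun u r s => formK_add_right u r s)
    (fun c u r => formK_smul_right c u r)

instance : FiniteDimensional ℝ (M.DGSpace k) := inferInstance

instance : CompleteSpace (M.DGSpace k) := FiniteDimensional.complete ℝ _

/-- The discrete derivative `u ↦ q` with `(q, r) = 𝒦(u, r)` for all `r ∈ V_h`. -/
def dgDeriv (M : Mesh α β) (k : ℕ) : M.DGSpace k →ₗ[ℝ] M.DGSpace k :=
  ((InnerProductSpace.toDual ℝ (M.DGSpace k)).symm.toLinearEquiv.toLinearMap ∘ₗ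
    LinearMap.toContinuousLinearMap.toLinearMap) ∘ₗ formKHom M k

lemma inner_dgDeriv (u r : M.DGSpace k) :
    ⟪dgDeriv M k u, r⟫_ℝ = formK u r := by
  simp only [dgDeriv, LinearMap.comp_apply]
  exact InnerProductSpace.toDual_symm_apply

/-- One step of the scheme is one application of the step operator. -/
lemma IsSecondOrderEINLDG.eq_stepOp {a a₀ dt : ℝ} {u q u₁ q₁ : ℕ → M.DGSpace k} (ha₀ : 0 < a₀)
    (hdt : 0 ≤ dt) (h : IsSecondOrderEINLDG a a₀ dt u q u₁ q₁) (n : ℕ) :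
    u (n + 1) = stepOp (dgDeriv M k) a a₀ dt (u n) := by
  have hq : ∀ n, q n = dgDeriv M k (u n) := fun n =>
    ext_inner_right ℝ fun r => by rw [inner_dgDeriv]; exact h.aux n r
  have hq₁ : ∀ n, q₁ n = dgDeriv M k (u₁ n) := fun n =>
    ext_inner_right ℝ fun r => by rw [inner_dgDeriv]; exact h.aux_one n r
  have hL : ∀ w v : M.DGSpace k, formL (dgDeriv M k w) v =
      -⟪lapOp (dgDeriv M k) w, v⟫_ℝ := fun w v => by
    rw [formL_eq_neg_formK, lapOp, LinearMap.comp_apply, LinearMap.adjoint_inner_left,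
      real_inner_comm, inner_dgDeriv]
  refine eq_stepOp_of_stages ha₀ hdt (u₁ := u₁ n)
    (ext_inner_right ℝ fun v => ?_) (ext_inner_right ℝ fun v => ?_)
  · have e := h.stage_one n v
    rw [hq, hq₁, hL, hL, ← inner_eq_ip, ← inner_eq_ip] at e
    simp only [inner_sub_left, inner_smul_left, conj_trivial]
    linarith
  · have e := h.stage_two n v
    rw [hq, hq, hq₁, hL, hL, hL, ← inner_eq_ip, ← inner_eq_ip] at e
    simp only [inner_sub_left, inner_smul_left, inner_add_left, conj_trivial]
    linarith

end Hilbert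

end

section

/-! ### The Gauss–Radau projection on one cell -/

/-- `w` is the Gauss–Radau projection of `f` on `[l, r]` that matches `f` at the end point `e`. -/
structure IsRadau (k : ℕ) (l r e : ℝ) (f : ℝ → ℝ) (w : ℝ[X]) : Prop where
  mem : w ∈ Polynomial.degreeLT ℝ (k + 1)
  orth : ∀ v ∈ Polynomial.degreeLT ℝ k, ∫ x in l..r, (w.eval x - f x) * v.eval x = 0
  eval_eq : w.eval e = f e

lemma mem_degreeLT_succ {k : ℕ} {p : ℝ[X]} :
    p ∈ Polynomial.degreeLT ℝ (k + 1) ↔ p.natDegree ≤ k := by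
  rw [Polynomial.mem_degreeLT]
  by_cases h : p = 0
  · simp [h]
  · rw [Polynomial.degree_eq_natDegree h]
    norm_cast
    exact Nat.lt_succ_iff

lemma comp_mem_degreeLT {k : ℕ} {p q : ℝ[X]} (hp : p ∈ Polynomial.degreeLT ℝ k)
    (hq : q.natDegree ≤ 1) : p.comp q ∈ Polynomial.degreeLT ℝ k := by
  cases k with
  | zero =>
    have : p = 0 := by simpa [Polynomial.mem_degreeLT] using hp
    simp [this]
  | succ k =>
    rw [mem_degreeLT_succ] at hp ⊢
    rw [Polynomial.natDegree_comp]
    calc _ ≤ k * 1 := Nat.mul_le_mul hp hq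
      _ = k := mul_one k

lemma integral_mul_eq_zero_of_moments {k : ℕ} {h : ℝ → ℝ} (hh : Continuous h) {l r : ℝ}
    (hm : ∀ i < k, ∫ x in l..r, h x * x ^ i = 0) {v : ℝ[X]} (hv : v ∈ Polynomial.degreeLT ℝ k) :
    ∫ x in l..r, h x * v.eval x = 0 := by
  rw [Polynomial.degreeLT_eq_span_X_pow] at hv
  induction hv using Submodule.span_induction with
  | mem p hp =>
    simp only [Finset.coe_image, Set.mem_image, Finset.coe_range, Set.mem_Iio] at hp
    obtain ⟨i, hi, rfl⟩ := hp
    simpa using hm i hi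
  | zero => simp
  | add p q _ _ h1 h2 =>
    have hp := p.continuous
    have hq := q.continuous
    simp only [Polynomial.eval_add, mul_add]
    rw [integral_add_of_continuous (by fun_prop) (by fun_prop), h1, h2, add_zero]
  | smul c p _ h1 =>
    simp only [Polynomial.eval_smul, smul_eq_mul, mul_left_comm _ c]
    rw [intervalIntegral.integral_const_mul, h1, mul_zero]

/-- Uniqueness of the Gauss–Radau projection: if `w = (X - e) s` is orthogonal to `s`, then the
one-signed function `(x - e) s²` has zero integral. -/
lemma IsRadau.eq_zero {k : ℕ} {l r e : ℝ} (hlr : l < r) (he : e = l ∨ e = r) {w : ℝ[X]}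
    (hw : IsRadau k l r e (fun _ => 0) w) : w = 0 := by
  obtain ⟨s, rfl⟩ := Polynomial.dvd_iff_isRoot.2 hw.eval_eq
  by_cases hs : s = 0
  · simp [hs]
  have hs' : s ∈ Polynomial.degreeLT ℝ k := by
    have h1 := mem_degreeLT_succ.1 hw.mem
    rw [Polynomial.natDegree_mul (Polynomial.X_sub_C_ne_zero e) hs,
      Polynomial.natDegree_X_sub_C] at h1
    rw [Polynomial.mem_degreeLT, Polynomial.degree_eq_natDegree hs]
    exact_mod_cast (by omega : s.natDegree < k)
  have h0 := hw.orth s hs'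
  have hint : ∫ x in l..r, (x - e) * (s.eval x * s.eval x) = 0 := by
    rw [← h0]
    congr 1
    funext x
    simp only [Polynomial.eval_mul, Polynomial.eval_sub, Polynomial.eval_X, Polynomial.eval_C]
    ring
  suffices s = 0 by simp [this]
  rcases he with rfl | rfl
  · exact eq_zero_of_integral_mul_self_eq_zero hlr (by fun_prop) (fun x hx => sub_pos.2 hx.1)
      (fun x hx => sub_nonneg.2 hx.1) hint
  · refine eq_zero_of_integral_mul_self_eq_zero hlr (f := fun x => e - x) (by fun_prop)
      (fun x hx => sub_pos.2 hx.2) (fun x hx => sub_nonneg.2 hx.2) ?_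
    rw [← neg_eq_zero, ← intervalIntegral.integral_neg, ← hint]
    congr 1
    funext x
    ring

lemma IsRadau.sub {k : ℕ} {l r e : ℝ} {f g : ℝ → ℝ} {w z : ℝ[X]} (hf : Continuous f)
    (hg : Continuous g) (hw : IsRadau k l r e f w) (hz : IsRadau k l r e g z) :
    IsRadau k l r e (fun x => f x - g x) (w - z) where
  mem := Submodule.sub_mem _ hw.mem hz.mem
  orth v hv := by
    have h1 := w.continuous
    have h2 := z.continuous
    have h3 := v.continuous
    have e : ∀ x, ((w - z).eval x - (f x - g x)) * v.eval x =
        (w.eval x - f x) * v.eval x + (-1) * ((z.eval x - g x) * v.eval x) := fun x => by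
      simp only [Polynomial.eval_sub]; ring
    simp only [e]
    rw [integral_add_of_continuous (by fun_prop) (by fun_prop), intervalIntegral.integral_const_mul,
      hw.orth v hv, hz.orth v hv]
    simp
  eval_eq := by simp [hw.eval_eq, hz.eval_eq]

lemma IsRadau.unique {k : ℕ} {l r e : ℝ} (hlr : l < r) (he : e = l ∨ e = r) {f : ℝ → ℝ}
    (hf : Continuous f) {w z : ℝ[X]} (hw : IsRadau k l r e f w) (hz : IsRadau k l r e f z) :
    w = z := by
  have := hw.sub hf hf hz
  simp only [sub_self] at this
  exact sub_eq_zero.1 (this.eq_zero hlr he)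

lemma isRadau_self {k : ℕ} {l r e : ℝ} {p : ℝ[X]} (hp : p ∈ Polynomial.degreeLT ℝ (k + 1)) :
    IsRadau k l r e (fun x => p.eval x) p := ⟨hp, by simp, rfl⟩

/-- The linear map whose inverse is the Gauss–Radau projection on the reference cell `[0, 1]`: the
first `k` moments and the value at `1`. -/
def radauData (k : ℕ) : Polynomial.degreeLT ℝ (k + 1) →ₗ[ℝ] (Fin (k + 1) → ℝ) where
  toFun w i := if (i : ℕ) < k then ∫ y in (0 : ℝ)..1, (w : ℝ[X]).eval y * y ^ (i : ℕ)
    else (w : ℝ[X]).eval 1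
  map_add' w z := by
    funext i
    have h1 := (w : ℝ[X]).continuous
    have h2 := (z : ℝ[X]).continuous
    by_cases h : (i : ℕ) < k
    · simp only [h, if_true, Pi.add_apply, Submodule.coe_add, Polynomial.eval_add, add_mul]
      exact integral_add_of_continuous (by fun_prop) (by fun_prop) _ _
    · simp [h]
  map_smul' c w := by
    funext i
    by_cases h : (i : ℕ) < k
    · simp [h, mul_assoc]
    · simp [h]

lemma radauData_injective (k : ℕ) : Function.Injective (radauData k) := by
  rw [injective_iff_map_eq_zero]
  intro w hw
  have h1 : ∀ i < k, ∫ y in (0 : ℝ)..1, (w : ℝ[X]).eval y * y ^ i = 0 := fun i hi => by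
    simpa [radauData, hi] using congrFun hw ⟨i, by omega⟩
  have h2 : (w : ℝ[X]).eval 1 = 0 := by
    simpa [radauData] using congrFun hw (Fin.last k)
  have : IsRadau k 0 1 1 (fun _ => 0) (w : ℝ[X]) := by
    refine ⟨w.2, fun v hv => ?_, h2⟩
    simpa using integral_mul_eq_zero_of_moments (Polynomial.continuous _) h1 hv
  exact Subtype.ext (this.eq_zero one_pos (Or.inr rfl))

/-- Existence of the Gauss–Radau projection on the reference cell, with a bound. -/
lemma exists_isRadau_reference (k : ℕ) : ∃ C : ℝ, 0 ≤ C ∧ ∀ (g : ℝ → ℝ) (B : ℝ), Continuous g →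
    (∀ y ∈ Icc (0 : ℝ) 1, |g y| ≤ B) →
    ∃ w : ℝ[X], IsRadau k 0 1 1 g w ∧ ∀ y ∈ Icc (0 : ℝ) 1, |w.eval y| ≤ C * B := by
  have hfin : Module.Finite ℝ (Polynomial.degreeLT ℝ (k + 1)) :=
    Module.Finite.equiv (Polynomial.degreeLTEquiv ℝ (k + 1)).symm
  have hsurj : Function.Surjective (radauData k) :=
    (LinearMap.injective_iff_surjective_of_finrank_eq_finrank
      (LinearEquiv.finrank_eq (Polynomial.degreeLTEquiv ℝ (k + 1)))).1 (radauData_injective k)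
  choose p hp using fun i => hsurj (Pi.single i 1)
  have hbd : ∀ i, ∃ K, ∀ y ∈ Icc (0 : ℝ) 1, ‖(p i : ℝ[X]).eval y‖ ≤ K := fun i =>
    isCompact_Icc.exists_bound_of_continuousOn (Polynomial.continuous _).continuousOn
  choose K hK using hbd
  have hK0 : ∀ i, 0 ≤ K i := fun i => (norm_nonneg _).trans (hK i 0 (by simp))
  refine ⟨∑ i, K i, Finset.sum_nonneg fun i _ => hK0 i, fun g B hg hB => ?_⟩
  set d : Fin (k + 1) → ℝ := fun i =>
    if (i : ℕ) < k then ∫ y in (0 : ℝ)..1, g y * y ^ (i : ℕ) else g 1 with hd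
  have hdB : ∀ i, |d i| ≤ B := fun i => by
    by_cases h : (i : ℕ) < k
    · simp only [hd, h, if_true]
      have := intervalIntegral.norm_integral_le_of_norm_le_const (a := 0) (b := 1) (C := B)
        (f := fun y : ℝ => g y * y ^ (i : ℕ)) fun y hy => by
          rw [uIoc_of_le zero_le_one] at hy
          rw [norm_mul, norm_pow, Real.norm_of_nonneg hy.1.le]
          exact (mul_le_of_le_one_right (norm_nonneg _) (pow_le_one₀ hy.1.le hy.2)).trans
            (hB y ⟨hy.1.le, hy.2⟩)
      simpa using this
    · simp only [hd, h, if_false]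
      exact hB 1 (by simp)
  set w := ∑ i, d i • p i with hw
  have hTw : radauData k w = d := by
    rw [hw, map_sum]
    simp only [map_smul, hp]
    funext i
    simp [Finset.sum_apply, Pi.single_apply]
  refine ⟨w, ⟨w.2, fun v hv => ?_, ?_⟩, fun y hy => ?_⟩
  · have hc := (w : ℝ[X]).continuous
    refine integral_mul_eq_zero_of_moments (by fun_prop) (fun i hi => ?_) hv
    have h1 := congrFun hTw ⟨i, by omega⟩
    simp only [radauData, LinearMap.coe_mk, AddHom.coe_mk, hd, hi, if_true] at h1
    have e : ∀ y, ((w : ℝ[X]).eval y - g y) * y ^ i =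
        (w : ℝ[X]).eval y * y ^ i + (-1) * (g y * y ^ i) := fun y => by ring
    simp only [e]
    rw [integral_add_of_continuous (by fun_prop) (by fun_prop),
      intervalIntegral.integral_const_mul, h1]
    ring
  · simpa [radauData, hd] using congrFun hTw (Fin.last k)
  · have : (w : ℝ[X]).eval y = ∑ i, d i * (p i : ℝ[X]).eval y := by
      simp [hw, Polynomial.eval_finsetSum]
    rw [this, Finset.sum_mul]
    refine (Finset.abs_sum_le_sum_abs _ _).trans (Finset.sum_le_sum fun i _ => ?_)
    rw [abs_mul, mul_comm]
    exact mul_le_mul (hK i y hy) (hdB i) (abs_nonneg _) (hK0 i)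

/-- Existence of the Gauss–Radau projection on any cell, with a bound that does not depend on the
cell: it is transported from the reference cell by the affine map that sends `1` to `e`. -/
lemma exists_isRadau (k : ℕ) : ∃ C : ℝ, 0 ≤ C ∧ ∀ (l r e : ℝ), l < r → (e = l ∨ e = r) →
    ∀ (f : ℝ → ℝ) (B : ℝ), Continuous f → (∀ x ∈ Icc l r, |f x| ≤ B) →
    ∃ w : ℝ[X], IsRadau k l r e f w ∧ ∀ x ∈ Icc l r, |w.eval x| ≤ C * B := by
  obtain ⟨C, hC, h⟩ := exists_isRadau_reference k
  refine ⟨C, hC, fun l r e hlr he f B hf hB => ?_⟩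
  obtain ⟨c, s, hs, hcs, hint, hmem, hmem'⟩ : ∃ c s : ℝ, s ≠ 0 ∧ c + s = e ∧
      (∀ F : ℝ → ℝ, (∫ y in (0 : ℝ)..1, F (c + s * y)) = 0 → ∫ x in l..r, F x = 0) ∧
      (∀ y ∈ Icc (0 : ℝ) 1, c + s * y ∈ Icc l r) ∧
      (∀ x ∈ Icc l r, s⁻¹ * (x - c) ∈ Icc (0 : ℝ) 1) := by
    have hd : 0 < r - l := sub_pos.2 hlr
    rcases he with rfl | rfl
    · refine ⟨r, e - r, by linarith, by ring, fun F hF => ?_, fun y hy => ?_, fun x hx => ?_⟩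
      · have := intervalIntegral.mul_integral_comp_add_mul (a := 0) (b := 1) (f := F) (e - r) r
        rw [hF, mul_zero, intervalIntegral.integral_symm] at this
        simpa using this.symm
      · constructor <;> nlinarith [hy.1, hy.2]
      · rw [show (e - r)⁻¹ * (x - r) = (r - x) / (r - e) by
          rw [← neg_sub r e, ← neg_sub r x, inv_neg]; field_simp]
        exact ⟨div_nonneg (by linarith [hx.2]) hd.le, (div_le_one hd).2 (by linarith [hx.1])⟩
    · refine ⟨l, e - l, hd.ne', by ring, fun F hF => ?_, fun y hy => ?_, fun x hx => ?_⟩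
      · have := intervalIntegral.mul_integral_comp_add_mul (a := 0) (b := 1) (f := F) (e - l) l
        rw [hF, mul_zero] at this
        simpa using this.symm
      · constructor <;> nlinarith [hy.1, hy.2]
      · rw [inv_mul_eq_div]
        exact ⟨div_nonneg (by linarith [hx.1]) hd.le, (div_le_one hd).2 (by linarith [hx.2])⟩
  obtain ⟨w, hw, hwB⟩ := h (fun y => f (c + s * y)) B (by fun_prop) fun y hy => hB _ (hmem y hy)
  refine ⟨w.comp (Polynomial.C s⁻¹ * (Polynomial.X - Polynomial.C c)), ⟨?_, fun v hv => ?_, ?_⟩,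
    fun x hx => ?_⟩
  · refine comp_mem_degreeLT hw.mem ((Polynomial.natDegree_C_mul_le _ _).trans ?_)
    simp
  · refine hint _ ?_
    have hv' : v.comp (Polynomial.C c + Polynomial.C s * Polynomial.X) ∈
        Polynomial.degreeLT ℝ k := by
      refine comp_mem_degreeLT hv ?_
      compute_degree
    refine Eq.trans ?_ (hw.orth _ hv')
    congr 1
    funext y
    simp [hs]
  · have := hw.eval_eq
    simp only [mul_one, hcs] at this
    rw [← this, ← hcs]
    simp [hs]
  · have := hwB _ (hmem' x hx)
    simpa using this

/-- Quasi-optimality of the Gauss–Radau projection in the maximum norm. -/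
lemma exists_abs_sub_radau_le (k : ℕ) : ∃ C : ℝ, 0 ≤ C ∧ ∀ (l r e : ℝ), l < r → (e = l ∨ e = r) →
    ∀ (f : ℝ → ℝ) (w p : ℝ[X]) (ε : ℝ), Continuous f → IsRadau k l r e f w →
    p ∈ Polynomial.degreeLT ℝ (k + 1) → (∀ x ∈ Icc l r, |f x - p.eval x| ≤ ε) →
    ∀ x ∈ Icc l r, |f x - w.eval x| ≤ C * ε := by
  obtain ⟨C, hC, h⟩ := exists_isRadau k
  refine ⟨1 + C, by positivity, fun l r e hlr he f w p ε hf hw hp hε x hx => ?_⟩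
  have hpc := p.continuous
  obtain ⟨z, hz, hzB⟩ := h l r e hlr he (fun x => f x - p.eval x) ε (by fun_prop) hε
  have : w - p = z := (hw.sub hf hpc (isRadau_self hp)).unique hlr he (by fun_prop) hz
  have h1 := hzB x hx
  rw [← this, Polynomial.eval_sub] at h1
  calc |f x - w.eval x| = |(f x - p.eval x) - (w.eval x - p.eval x)| := by ring_nf
    _ ≤ |f x - p.eval x| + |w.eval x - p.eval x| := abs_sub _ _
    _ ≤ ε + C * ε := add_le_add (hε x hx) h1
    _ = _ := by ring

/-- Taylor approximation on a cell. -/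
lemma exists_taylor_approx {k : ℕ} {l r B : ℝ} (hlr : l < r) {f : ℝ → ℝ} (hf : ContDiff ℝ ∞ f)
    (hB : ∀ x, |iteratedDeriv (k + 1) f x| ≤ B) :
    ∃ p ∈ Polynomial.degreeLT ℝ (k + 1), ∀ x ∈ Icc l r,
      |f x - p.eval x| ≤ B * (r - l) ^ (k + 1) := by
  have hB0 : 0 ≤ B := (abs_nonneg _).trans (hB 0)
  refine ⟨∑ i ∈ Finset.range (k + 1), Polynomial.C ((i.factorial : ℝ)⁻¹ *
    iteratedDerivWithin i f (Icc l r) l) * (Polynomial.X - Polynomial.C l) ^ i, ?_, fun x hx => ?_⟩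
  · refine Submodule.sum_mem _ fun i hi => ?_
    rw [mem_degreeLT_succ]
    refine (Polynomial.natDegree_C_mul_le _ _).trans ?_
    rw [Polynomial.natDegree_pow, Polynomial.natDegree_X_sub_C, mul_one]
    exact Nat.lt_succ_iff.1 (Finset.mem_range.1 hi)
  · have h1 := taylor_mean_remainder_bound (C := B) (n := k) hlr.le
      (hf.contDiffOn.of_le (by exact_mod_cast le_top)) hx fun y hy => by
        rw [iteratedDerivWithin_eq_iteratedDeriv (uniqueDiffOn_Icc hlr)
          (hf.contDiffAt.of_le (by exact_mod_cast le_top)) hy]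
        exact hB y
    rw [taylor_within_apply, Real.norm_eq_abs] at h1
    have e : (∑ i ∈ Finset.range (k + 1), Polynomial.C ((i.factorial : ℝ)⁻¹ *
        iteratedDerivWithin i f (Icc l r) l) * (Polynomial.X - Polynomial.C l) ^ i).eval x =
        ∑ i ∈ Finset.range (k + 1),
          ((i.factorial : ℝ)⁻¹ * (x - l) ^ i) • iteratedDerivWithin i f (Icc l r) l := by
      rw [Polynomial.eval_finsetSum]
      refine Finset.sum_congr rfl fun i _ => ?_
      simp only [Polynomial.eval_mul, Polynomial.eval_C, Polynomial.eval_pow, Polynomial.eval_sub,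
        Polynomial.eval_X, smul_eq_mul]
      ring
    rw [e]
    refine h1.trans ((div_le_self ?_ ?_).trans ?_)
    · exact mul_nonneg hB0 (pow_nonneg (sub_nonneg.2 hx.1) _)
    · exact_mod_cast Nat.factorial_pos k
    · have := sub_nonneg.2 hx.1
      gcongr
      exact hx.2

end

section

/-! ### Fourier modes -/

/-- The real Fourier mode `x ↦ Re (c e^{iκx})`. -/
def mode (c : ℂ) (κ x : ℝ) : ℝ := (c * Complex.exp (κ * x * Complex.I)).re

lemma abs_mode_le (c : ℂ) (κ x : ℝ) : |mode c κ x| ≤ ‖c‖ := by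
  refine (Complex.abs_re_le_norm _).trans ?_
  rw [norm_mul, ← Complex.ofReal_mul, Complex.norm_exp_ofReal_mul_I, mul_one]

lemma hasDerivAt_mode (c : ℂ) (κ x : ℝ) :
    HasDerivAt (mode c κ) (mode (κ * Complex.I * c) κ x) x := by
  have h1 : HasDerivAt (fun y : ℝ => (κ * y * Complex.I : ℂ)) (κ * 1 * Complex.I) x :=
    ((Complex.ofRealCLM.hasDerivAt (x := x)).const_mul (κ : ℂ)).mul_const Complex.I
  have h2 := (h1.cexp.const_mul c)
  have h3 := Complex.reCLM.hasFDerivAt.comp_hasDerivAt x h2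
  refine h3.congr_deriv ?_
  simp only [mode, Complex.reCLM_apply]
  congr 1
  ring

lemma contDiff_mode (c : ℂ) (κ : ℝ) : ContDiff ℝ ∞ (mode c κ) := by
  unfold mode
  have h : ContDiff ℝ ∞ fun x : ℝ => c * Complex.exp (κ * x * Complex.I) := by
    have : ContDiff ℝ ∞ fun x : ℝ => (x : ℂ) := Complex.ofRealCLM.contDiff
    fun_prop
  exact Complex.reCLM.contDiff.comp h

@[fun_prop] lemma continuous_mode (c : ℂ) (κ : ℝ) : Continuous (mode c κ) :=
  (contDiff_mode c κ).continuous

lemma iteratedDeriv_mode (c : ℂ) (κ : ℝ) (m : ℕ) :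
    iteratedDeriv m (mode c κ) = mode ((κ * Complex.I) ^ m * c) κ := by
  induction m with
  | zero => simp
  | succ m ih =>
    rw [iteratedDeriv_succ, ih]
    funext x
    rw [(hasDerivAt_mode _ _ _).deriv, pow_succ']
    ring_nf

lemma mode_second (c : ℂ) (κ x : ℝ) :
    mode (κ * Complex.I * (κ * Complex.I * c)) κ x = -κ ^ 2 * mode c κ x := by
  have : (κ * Complex.I * (κ * Complex.I * c) : ℂ) = ((-κ ^ 2 : ℝ) : ℂ) * c := by
    push_cast
    linear_combination (κ : ℂ) ^ 2 * c * Complex.I_sq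
  rw [mode, this, mul_assoc, Complex.re_ofReal_mul, mode]

lemma mode_periodic {α β κ : ℝ} (hκ : Complex.exp (κ * (β - α) * Complex.I) = 1) (c : ℂ) :
    mode c κ α = mode c κ β := by
  have : Complex.exp (κ * β * Complex.I) = Complex.exp (κ * α * Complex.I) := by
    rw [← mul_one (Complex.exp (κ * α * Complex.I)), ← hκ, ← Complex.exp_add]
    ring_nf
  rw [mode, mode, this]

lemma norm_mul_I_mul (c : ℂ) (κ : ℝ) : ‖κ * Complex.I * c‖ = |κ| * ‖c‖ := by
  simp

lemma norm_mul_I_pow_mul (c : ℂ) (κ : ℝ) (m : ℕ) :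
    ‖(κ * Complex.I) ^ m * c‖ = |κ| ^ m * ‖c‖ := by
  simp

/-! ### Consistency of the discrete derivative with the Gauss–Radau projections -/

open Mesh
open scoped InnerProductSpace

variable {α β : ℝ} {M : Mesh α β} {k : ℕ}

lemma isGaussRadauMinus_iff {p : ℝ → ℝ} {w : M.DGSpace k} :
    IsGaussRadauMinus p w ↔ ∀ j, IsRadau k (M.left j) (M.right j) (M.right j) p (w j : ℝ[X]) :=
  ⟨fun h j => ⟨(w j).2, (h j).1, (h j).2⟩, fun h j => ⟨(h j).orth, (h j).eval_eq⟩⟩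

lemma exists_isGaussRadauMinus {f : ℝ → ℝ} (hf : Continuous f) :
    ∃ w : M.DGSpace k, IsGaussRadauMinus f w := by
  obtain ⟨C, -, h⟩ := exists_isRadau k
  have hex : ∀ j, ∃ w : ℝ[X], IsRadau k (M.left j) (M.right j) (M.right j) f w := fun j => by
    obtain ⟨B, hB⟩ := isCompact_Icc.exists_bound_of_continuousOn
      (hf.continuousOn (s := Icc (M.left j) (M.right j)))
    obtain ⟨w, hw, -⟩ := h _ _ _ (left_lt_right j) (Or.inr rfl) f B hf hB
    exact ⟨w, hw⟩
  choose w hw using hex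
  exact ⟨fun j => ⟨w j, (hw j).mem⟩, isGaussRadauMinus_iff.2 hw⟩

lemma integral_radau_mul_dval {e : ℝ} {j : Fin M.N} {f : ℝ → ℝ} (hf : Continuous f)
    {w : M.DGSpace k} (hw : IsRadau k (M.left j) (M.right j) e f (w j : ℝ[X])) (r : M.DGSpace k) :
    ∫ x in (M.left j)..(M.right j), val w j x * dval r j x =
      ∫ x in (M.left j)..(M.right j), f x * dval r j x := by
  have h := hw.orth _ (derivative_mem_degreeLT r j)
  have e : ∀ x, val w j x * dval r j x = ((w j : ℝ[X]).eval x - f x) *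
      (Polynomial.derivative (r j : ℝ[X])).eval x + f x * dval r j x := fun x => by
    simp only [val, dval]; ring
  simp only [e]
  rw [integral_add_of_continuous _ (by fun_prop), h, zero_add]
  have h1 := (w j : ℝ[X]).continuous
  have h2 := (Polynomial.derivative (r j : ℝ[X])).continuous
  fun_prop

lemma formK_radauMinus {f f' : ℝ → ℝ} (hf : ∀ x, HasDerivAt f (f' x) x) (hf' : Continuous f')
    (hper : f α = f β) {w : M.DGSpace k} (hw : IsGaussRadauMinus f w) (r : M.DGSpace k) :
    formK w r = ∑ j, ∫ x in (M.left j)..(M.right j), f' x * val r j x := by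
  have hc : Continuous f := continuous_iff_continuousAt.2 fun x => (hf x).continuousAt
  rw [formK, ← Finset.sum_neg_distrib]
  refine Finset.sum_congr rfl fun j _ => ?_
  have ht : ∀ i, traceMinus w i = f (M.right i) := fun i => (hw i).2
  rw [integral_radau_mul_dval hc (isGaussRadauMinus_iff.1 hw j), integral_val_mul_deriv hf hf',
    ht, ht, apply_right_finRotate_symm hper]
  ring

lemma formK_radauPlus {g g' : ℝ → ℝ} (hg : ∀ x, HasDerivAt g (g' x) x) (hg' : Continuous g')
    (hper : g α = g β) {z : M.DGSpace k}
    (hz : ∀ j, IsRadau k (M.left j) (M.right j) (M.left j) g (z j : ℝ[X])) (v : M.DGSpace k) :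
    formK v z = -∑ j, ∫ x in (M.left j)..(M.right j), g' x * val v j x := by
  have hc : Continuous g := continuous_iff_continuousAt.2 fun x => (hg x).continuousAt
  rw [← neg_eq_iff_eq_neg, ← formL_eq_neg_formK, formL, ← Finset.sum_neg_distrib]
  refine Finset.sum_congr rfl fun j _ => ?_
  have ht : ∀ i, tracePlus z i = g (M.left i) := fun i => (hz i).eval_eq
  rw [integral_radau_mul_dval hc (hz j), integral_val_mul_deriv hg hg', ht, ht,
    apply_left_finRotate hper]
  ring

/-- The Gauss–Radau projection `w` of a function with `f'' = -κ² f` is an approximate eigenvector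
of the discrete operator `-∂ₓ²`. The residual splits into a small part `κ² δ` and the discrete
derivative of a small part `η`, which measures the projection error of `f'`. -/
lemma exists_lapOp_radau_eq {f f' : ℝ → ℝ} {κ ε : ℝ} (hκ : 0 ≤ κ) (hε : 0 ≤ ε)
    (hf : ∀ x, HasDerivAt f (f' x) x) (hf' : ∀ x, HasDerivAt f' (-κ ^ 2 * f x) x)
    (hper : f α = f β) (hper' : f' α = f' β) {w : M.DGSpace k} (hw : IsGaussRadauMinus f w)
    (hwε : ∀ j, ∀ x ∈ Icc (M.left j) (M.right j), |f x - val w j x| ≤ ε) {z : M.DGSpace k}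
    (hz : ∀ j, IsRadau k (M.left j) (M.right j) (M.left j) f' (z j : ℝ[X]))
    (hzε : ∀ j, ∀ x ∈ Icc (M.left j) (M.right j), |f' x - val z j x| ≤ κ * ε) :
    ∃ δ η : M.DGSpace k, ‖δ‖ ≤ ε * √(β - α) ∧ ‖η‖ ≤ κ * ε * √(β - α) ∧
      lapOp (dgDeriv M k) w = κ ^ 2 • w + κ ^ 2 • δ + LinearMap.adjoint (dgDeriv M k) η := by
  have hfc : Continuous f := continuous_iff_continuousAt.2 fun x => (hf x).continuousAt
  have hfc' : Continuous f' := continuous_iff_continuousAt.2 fun x => (hf' x).continuousAt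
  obtain ⟨δ, hδ, hδv⟩ := exists_riesz (M := M) (k := k) (g := fun j x => f x - val w j x) hε
    (fun j => by fun_prop) hwε
  obtain ⟨η, hη, hηv⟩ := exists_riesz (M := M) (k := k) (g := fun j x => f' x - val z j x)
    (by positivity) (fun j => by fun_prop) hzε
  refine ⟨δ, η, hδ, hη, ext_inner_right ℝ fun v => ?_⟩
  have hsplit : ∀ (g : ℝ → ℝ) (y r : M.DGSpace k), Continuous g →
      ∑ j, ∫ x in (M.left j)..(M.right j), (g x - val y j x) * val r j x =
        (∑ j, ∫ x in (M.left j)..(M.right j), g x * val r j x) - ⟪y, r⟫_ℝ := fun g y r hg => by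
    rw [inner_eq_ip, ip, ← Finset.sum_sub_distrib]
    refine Finset.sum_congr rfl fun j _ => ?_
    rw [← intervalIntegral.integral_sub (Continuous.intervalIntegrable (by fun_prop) _ _)
      (Continuous.intervalIntegrable (by fun_prop) _ _)]
    simp only [sub_mul]
  have h1 : ⟪lapOp (dgDeriv M k) w, v⟫_ℝ =
      ∑ j, ∫ x in (M.left j)..(M.right j), f' x * val (dgDeriv M k v) j x := by
    rw [lapOp, LinearMap.comp_apply, LinearMap.adjoint_inner_left, inner_dgDeriv,
      formK_radauMinus hf hfc' hper hw]
  have h2 : ⟪z, dgDeriv M k v⟫_ℝ =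
      κ ^ 2 * ∑ j, ∫ x in (M.left j)..(M.right j), f x * val v j x := by
    rw [real_inner_comm, inner_dgDeriv, formK_radauPlus hf' (by fun_prop) hper' hz]
    simp only [mul_assoc, intervalIntegral.integral_const_mul]
    rw [← Finset.mul_sum]
    ring
  have h3 := hηv (dgDeriv M k v)
  rw [hsplit _ _ _ hfc', h2] at h3
  have h4 := hδv v
  rw [hsplit _ _ _ hfc] at h4
  rw [inner_add_left, inner_add_left, LinearMap.adjoint_inner_left, inner_smul_left,
    inner_smul_left, h1, h3, h4]
  simp only [conj_trivial]
  ring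

/-- Maximum norm bound for the Gauss–Radau projection. -/
lemma exists_radauMinus_le (k : ℕ) : ∃ C : ℝ, 0 ≤ C ∧ ∀ {α β : ℝ} {M : Mesh α β} {f : ℝ → ℝ}
    {w : M.DGSpace k} {B : ℝ}, Continuous f → IsGaussRadauMinus f w →
    (∀ x ∈ Icc α β, |f x| ≤ B) →
    (∀ j, ∀ x ∈ Icc (M.left j) (M.right j), |f x - val w j x| ≤ C * B) ∧
      ‖w‖ ≤ C * B * √(β - α) := by
  obtain ⟨C, hC, h⟩ := exists_abs_sub_radau_le k
  refine ⟨1 + C, by positivity, fun {α β M f w B} hf hw hB => ?_⟩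
  have h0 : ∀ j, ∀ x ∈ Icc (M.left j) (M.right j), |f x| ≤ B := fun j x hx =>
    hB x (Icc_cell_subset j hx)
  have hB0 : 0 ≤ B := by
    have j : Fin M.N := ⟨0, M.N_pos⟩
    exact (abs_nonneg _).trans (h0 j _ (left_mem_Icc.2 (left_lt_right j).le))
  have h1 : ∀ j, ∀ x ∈ Icc (M.left j) (M.right j), |f x - val w j x| ≤ C * B := fun j x hx =>
    h _ _ _ (left_lt_right j) (Or.inr rfl) f _ 0 B hf (isGaussRadauMinus_iff.1 hw j)
      (Submodule.zero_mem _) (fun y hy => by simpa using h0 j y hy) x hx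
  refine ⟨fun j x hx => (h1 j x hx).trans (by gcongr; linarith), ?_⟩
  refine norm_le_of_abs_val_le (by positivity) fun j x hx => ?_
  calc |val w j x| = |f x - (f x - val w j x)| := by ring_nf
    _ ≤ |f x| + |f x - val w j x| := abs_sub _ _
    _ ≤ B + C * B := add_le_add (h0 j x hx) (h1 j x hx)
    _ = _ := by ring

/-- Approximation of a Fourier mode by either Gauss–Radau projection. -/
lemma exists_abs_mode_sub_radau_le (k : ℕ) : ∃ C : ℝ, 0 ≤ C ∧ ∀ {α β : ℝ} {M : Mesh α β}
    {j : Fin M.N} {e : ℝ} {c : ℂ} {κ : ℝ} {w : ℝ[X]}, (e = M.left j ∨ e = M.right j) →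
    IsRadau k (M.left j) (M.right j) e (mode c κ) w →
    ∀ x ∈ Icc (M.left j) (M.right j),
      |mode c κ x - w.eval x| ≤ C * (‖c‖ * (|κ| ^ (k + 1) * M.size ^ (k + 1))) := by
  obtain ⟨C, hC, h⟩ := exists_abs_sub_radau_le k
  refine ⟨C, hC, fun {α β M j e c κ w} he hw x hx => ?_⟩
  obtain ⟨p, hp, hpB⟩ := exists_taylor_approx (k := k) (left_lt_right j) (contDiff_mode c κ)
    (B := |κ| ^ (k + 1) * ‖c‖) fun x => by
      rw [iteratedDeriv_mode, ← norm_mul_I_pow_mul]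
      exact abs_mode_le _ _ _
  refine h _ _ _ (left_lt_right j) he _ w p _ (continuous_mode c κ) hw hp (fun y hy => ?_) x hx
  refine (hpB y hy).trans ?_
  have h1 := cell_length_le_size j
  have h2 := (sub_pos.2 (left_lt_right j)).le
  calc _ ≤ |κ| ^ (k + 1) * ‖c‖ * M.size ^ (k + 1) := by gcongr
    _ = _ := by ring

/-- The error of the fully discrete scheme for a single Fourier mode. -/
lemma exists_mode_error_le {a a₀ : ℝ} (k : ℕ) (ha : 0 < a) (ha₀ : a / 2 < a₀) :
    ∃ C : ℝ, 0 ≤ C ∧ ∀ {α β : ℝ} {M : Mesh α β} {c : ℂ} {κ dt : ℝ} {w : M.DGSpace k} (n : ℕ),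
    0 < dt → Complex.exp (κ * (β - α) * Complex.I) = 1 → IsGaussRadauMinus (mode c κ) w →
    (∀ j, ∀ x ∈ Icc (M.left j) (M.right j), |mode c κ x - val w j x| ≤
      C * (‖c‖ * (|κ| ^ (k + 1) * M.size ^ (k + 1)))) ∧
    ‖(stepOp (dgDeriv M k) a a₀ dt ^ n) w - Real.exp (-(a * (dt * κ ^ 2))) ^ n • w‖ ≤
      C * (‖c‖ * (|κ| ^ (k + 1) * M.size ^ (k + 1) + κ ^ 4 * dt ^ 2)) * √(β - α) := by
  obtain ⟨C₁, hC₁, h₁⟩ := exists_abs_mode_sub_radau_le k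
  obtain ⟨C₂, hC₂, h₂⟩ := exists_radauMinus_le k
  obtain ⟨C₃, hC₃, h₃⟩ := exists_norm_stepOp_pow_sub_le_of_adjoint ha ha₀
  refine ⟨C₁ + C₃ * (2 * C₁ + C₂), by positivity, ?_⟩
  intro α β M c κ dt w n hdt hκ hw
  have hsz := (size_pos (M := M)).le
  have hwε : ∀ j, ∀ x ∈ Icc (M.left j) (M.right j), |mode c κ x - val w j x| ≤
      C₁ * (‖c‖ * (|κ| ^ (k + 1) * M.size ^ (k + 1))) := fun j x hx =>
    h₁ (Or.inr rfl) (isGaussRadauMinus_iff.1 hw j) x hx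
  have hCC : 0 ≤ C₃ * (2 * C₁ + C₂) := by positivity
  refine ⟨fun j x hx => (hwε j x hx).trans (by gcongr; linarith), ?_⟩
  by_cases hκ0 : κ = 0
  · -- constants are reproduced exactly
    subst hκ0
    have hD : dgDeriv M k w = 0 := by
      refine ext_inner_right ℝ fun r => ?_
      rw [inner_dgDeriv, formK_radauMinus (hasDerivAt_mode c 0) (continuous_mode _ _)
        (mode_periodic hκ c) hw]
      simp [mode]
    rw [stepOp_pow_apply_of_eq_zero hD]
    simp only [ne_eq, OfNat.ofNat_ne_zero, not_false_eq_true, zero_pow, mul_zero, neg_zero,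
      Real.exp_zero, one_pow, one_smul, sub_self, norm_zero]
    positivity
  have hκ' : 0 < |κ| := abs_pos.2 hκ0
  set ε := C₁ * (‖c‖ * (|κ| ^ (k + 1) * M.size ^ (k + 1))) with hε
  have hε0 : 0 ≤ ε := by positivity
  obtain ⟨C₄, -, h₄⟩ := exists_isRadau k
  have hz : ∀ j, ∃ z : ℝ[X], IsRadau k (M.left j) (M.right j) (M.left j)
      (mode (κ * Complex.I * c) κ) z := fun j => by
    obtain ⟨z, hz, -⟩ := h₄ _ _ _ (left_lt_right j) (Or.inl rfl) _ _
      (continuous_mode (κ * Complex.I * c) κ) fun x _ => abs_mode_le _ _ _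
    exact ⟨z, hz⟩
  choose z hz using hz
  obtain ⟨δ, η, hδ, hη, hlap⟩ := exists_lapOp_radau_eq (M := M) (k := k) (κ := |κ|) hκ'.le hε0
    (hasDerivAt_mode c κ) (fun x => (hasDerivAt_mode _ κ x).congr_deriv (by
      rw [mode_second, sq_abs]))
    (mode_periodic hκ c) (mode_periodic hκ _) hw hwε (z := fun j => ⟨z j, (hz j).mem⟩) hz
    fun j x hx => (h₁ (Or.inl rfl) (hz j) x hx).trans (by
      rw [norm_mul_I_mul, hε]
      exact (by ring : _ = _).le)
  have hn := h₃ (dgDeriv M k) n dt |κ| w δ η hdt hκ' hlap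
  rw [sq_abs] at hn
  refine hn.trans ?_
  have hw0 := (h₂ (continuous_mode c κ) hw fun x _ => abs_mode_le c κ x).2
  have hη' : ‖η‖ / |κ| ≤ ε * √(β - α) := by
    rw [div_le_iff₀ hκ']
    exact hη.trans_eq (by ring)
  set S := √(β - α)
  have hS : 0 ≤ S := Real.sqrt_nonneg _
  have e1 : (dt * κ ^ 2) ^ 2 = κ ^ 4 * dt ^ 2 := by ring
  rw [e1]
  have hA : 0 ≤ ‖c‖ * (|κ| ^ (k + 1) * M.size ^ (k + 1)) * S := by positivity
  have hB : 0 ≤ ‖c‖ * (κ ^ 4 * dt ^ 2) * S := by positivity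
  calc _ ≤ C₃ * (ε * S + ε * S + κ ^ 4 * dt ^ 2 * (C₂ * ‖c‖ * S)) := by
        gcongr
    _ = C₃ * (2 * C₁) * (‖c‖ * (|κ| ^ (k + 1) * M.size ^ (k + 1)) * S)
        + C₃ * C₂ * (‖c‖ * (κ ^ 4 * dt ^ 2) * S) := by rw [hε]; ring
    _ ≤ (C₁ + C₃ * (2 * C₁ + C₂)) * (‖c‖ * (|κ| ^ (k + 1) * M.size ^ (k + 1)) * S)
        + (C₁ + C₃ * (2 * C₁ + C₂)) * (‖c‖ * (κ ^ 4 * dt ^ 2) * S) := by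
        have := mul_nonneg hC₃ hC₂
        have := mul_nonneg hC₃ hC₁
        gcongr <;> nlinarith
    _ = _ := by ring

end

section

/-! ### Superposition of the modes -/

open Mesh

variable {α β : ℝ} {M : Mesh α β} {k : ℕ}

lemma Mesh.IsGaussRadauMinus.add_smul {f g : ℝ → ℝ} {w z : M.DGSpace k} (hf : Continuous f)
    (hg : Continuous g) (hw : IsGaussRadauMinus f w) (hz : IsGaussRadauMinus g z) (c : ℝ) :
    IsGaussRadauMinus (fun x => f x + c * g x) (w + c • z) := by
  refine fun j => ⟨fun v hv => ?_, ?_⟩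
  · have e : ∀ x, (val (w + c • z) j x - (f x + c * g x)) * v.eval x =
        (val w j x - f x) * v.eval x + c * ((val z j x - g x) * v.eval x) := fun x => by
      simp only [val_add, val_smul]; ring
    have hv' := v.continuous
    simp only [e]
    rw [integral_add_of_continuous (by fun_prop) (by fun_prop), intervalIntegral.integral_const_mul,
      (hw j).1 v hv, (hz j).1 v hv]
    simp
  · have h1 := (hw j).2
    have h2 := (hz j).2
    simp only [traceMinus, val_add, val_smul] at h1 h2 ⊢
    rw [h1, h2]

lemma Mesh.IsGaussRadauMinus.sum {ι : Type*} (F : Finset ι) {f : ι → ℝ → ℝ} {w : ι → M.DGSpace k}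
    (hf : ∀ i, Continuous (f i)) (hw : ∀ i, IsGaussRadauMinus (f i) (w i)) (c : ι → ℝ) :
    IsGaussRadauMinus (fun x => ∑ i ∈ F, c i * f i x) (∑ i ∈ F, c i • w i) := by
  classical
  induction F using Finset.induction_on with
  | empty =>
    refine fun j => ⟨fun v _ => ?_, ?_⟩
    · simp [val]
    · simp [traceMinus, val]
  | insert i F hi ih =>
    simp only [Finset.sum_insert hi]
    have := ih.add_smul (by fun_prop) (hf i) (hw i) (c i)
    simpa only [add_comm] using this

lemma Mesh.IsGaussRadauMinus.congr {f g : ℝ → ℝ} {w : M.DGSpace k} (hw : IsGaussRadauMinus f w)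
    (h : ∀ x ∈ Icc α β, f x = g x) : IsGaussRadauMinus g w := by
  refine fun j => ⟨fun v hv => ?_, ?_⟩
  · rw [← (hw j).1 v hv]
    refine intervalIntegral.integral_congr fun x hx => ?_
    rw [uIcc_of_le (left_lt_right j).le] at hx
    simp only [h x (Icc_cell_subset j hx)]
  · rw [(hw j).2, h _ (Icc_cell_subset j (right_mem_Icc.2 (left_lt_right j).le))]

/-- The error in `L²` is controlled by a maximum norm error and an error inside `V_h`. -/
lemma errorNorm_le {f : ℝ → ℝ} (hf : Continuous f) {p u : M.DGSpace k} {A B X : ℝ}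
    (hX : 0 ≤ X) (hA : ∀ j, ∀ x ∈ Icc (M.left j) (M.right j), |f x - val p j x| ≤ A)
    (hB : ‖u - p‖ ≤ B) (hAX : A * √(β - α) ≤ X) (hBX : B ≤ X) (hA0 : 0 ≤ A) :
    errorNorm f u ≤ 2 * X := by
  have hαβ : 0 ≤ β - α := by
    rw [← sum_cell_length (M := M)]
    exact Finset.sum_nonneg fun j _ => (sub_pos.2 (left_lt_right j)).le
  refine Real.sqrt_le_iff.2 ⟨by positivity, ?_⟩
  have h1 : ∑ j, ∫ x in (M.left j)..(M.right j), (f x - val u j x) ^ 2 ≤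
      2 * (∑ j, ∫ x in (M.left j)..(M.right j), (f x - val p j x) ^ 2) + 2 * ‖u - p‖ ^ 2 := by
    rw [norm_sq_eq_sum, Finset.mul_sum, Finset.mul_sum, ← Finset.sum_add_distrib]
    refine Finset.sum_le_sum fun j _ => ?_
    rw [← intervalIntegral.integral_const_mul, ← intervalIntegral.integral_const_mul,
      ← integral_add_of_continuous (by fun_prop) (by fun_prop)]
    refine intervalIntegral.integral_mono_on (left_lt_right j).le
      (Continuous.intervalIntegrable (by fun_prop) _ _)
      (Continuous.intervalIntegrable (by fun_prop) _ _) fun x _ => ?_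
    rw [val_sub]
    nlinarith [sq_nonneg ((f x - val p j x) + (val u j x - val p j x))]
  have h2 := sum_integral_sq_le (M := M) (g := fun j x => f x - val p j x)
    (fun j => by fun_prop) hA
  have h3 : (A * √(β - α)) ^ 2 ≤ X ^ 2 := by gcongr
  rw [mul_pow, Real.sq_sqrt hαβ] at h3
  have h4 : ‖u - p‖ ^ 2 ≤ X ^ 2 := by
    have := hB.trans hBX
    gcongr
  nlinarith

/-- The wave numbers of functions that are periodic on `(α, β)`. -/
def freq (α β : ℝ) (m : ℤ) : ℝ := 2 * Real.pi * m / (β - α)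

lemma exp_freq (hαβ : α < β) (m : ℤ) :
    Complex.exp (freq α β m * (β - α) * Complex.I) = 1 := by
  rw [Complex.exp_eq_one_iff]
  refine ⟨m, ?_⟩
  have : ((β : ℂ) - α) ≠ 0 := by
    rw [← Complex.ofReal_sub, Complex.ofReal_ne_zero]
    linarith
  rw [freq]
  push_cast
  field_simp

/-- The Fourier representation of a periodic solution of `U_t = a U_xx`, with the summability of
the coefficients that carries the error analysis. -/
structure HasFourierSeries (α β T a : ℝ) (k : ℕ) (U : ℝ → ℝ → ℝ) (c : ℤ → ℂ) : Prop where
  summable : Summable fun m => ‖c m‖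
  summable_mul : Summable fun m => ‖c m‖ * (|freq α β m| ^ (k + 1) + freq α β m ^ 4)
  hasSum : ∀ t ∈ Icc 0 T, ∀ x ∈ Icc α β,
    HasSum (fun m => Real.exp (-(a * freq α β m ^ 2 * t)) * mode (c m) (freq α β m) x) (U t x)

/-- A weighted series of modes and the distance to its partial sums. -/
lemma exists_continuous_series {c : ℤ → ℂ} {s : ℤ → ℝ} (hc : Summable fun m => ‖c m‖)
    (hs : ∀ m, |s m| ≤ 1) (κ : ℤ → ℝ) : ∃ V : ℝ → ℝ, Continuous V ∧
    (∀ x, HasSum (fun m => s m * mode (c m) (κ m) x) (V x)) ∧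
    ∀ (F : Finset ℤ) x, |V x - ∑ m ∈ F, s m * mode (c m) (κ m) x| ≤ ∑' m : {m // m ∉ F}, ‖c m‖ := by
  have hb : ∀ m x, ‖s m * mode (c m) (κ m) x‖ ≤ ‖c m‖ := fun m x => by
    rw [norm_mul]
    exact (mul_le_of_le_one_left (norm_nonneg _) (hs m)).trans (abs_mode_le _ _ _)
  have hsum : ∀ x, Summable fun m => s m * mode (c m) (κ m) x := fun x =>
    Summable.of_norm_bounded hc fun m => hb m x
  refine ⟨fun x => ∑' m, s m * mode (c m) (κ m) x,
    continuous_tsum (fun m => by fun_prop) hc hb, fun x => (hsum x).hasSum, fun F x => ?_⟩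
  show |(∑' m, s m * mode (c m) (κ m) x) - _| ≤ _
  rw [← (hsum x).sum_add_tsum_subtype_compl F, add_sub_cancel_left]
  exact tsum_of_norm_bounded (hc.subtype _).hasSum fun m => hb _ x

/-- The error estimate for a solution with a Fourier series. The modes outside a finite set `F` are
controlled by stability alone, the modes in `F` by the error estimate for a single mode. -/
lemma exists_error_le_of_hasFourierSeries {T a a₀ : ℝ} {U : ℝ → ℝ → ℝ} {c : ℤ → ℂ}
    (hαβ : α < β) (ha : 0 < a) (ha₀ : a / 2 < a₀) (hU : HasFourierSeries α β T a k U c) :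
    ∃ C : ℝ, 0 < C ∧ ∀ M : Mesh α β, ∀ dt : ℝ, 0 < dt → ∀ u q u₁ q₁ : ℕ → M.DGSpace k,
      IsSecondOrderEINLDG a a₀ dt u q u₁ q₁ → IsGaussRadauMinus (U 0) (u 0) →
      ∀ n : ℕ, (n : ℝ) * dt ≤ T →
        errorNorm (U ((n : ℝ) * dt)) (u n) ≤ C * (M.size ^ (k + 1) + dt ^ 2) := by
  obtain ⟨C₁, hC₁, h₁⟩ := exists_mode_error_le (a := a) (a₀ := a₀) k ha ha₀
  obtain ⟨C₂, hC₂, h₂⟩ := exists_radauMinus_le k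
  set κ := freq α β with hκ
  set S := ∑' m, ‖c m‖ * (|κ m| ^ (k + 1) + κ m ^ 4) with hS
  have hnn : ∀ m, 0 ≤ ‖c m‖ * (|κ m| ^ (k + 1) + κ m ^ 4) := fun m => by
    have : 0 ≤ κ m ^ 4 := by positivity
    positivity
  have hS0 : 0 ≤ S := tsum_nonneg hnn
  have hL : 0 ≤ √(β - α) := Real.sqrt_nonneg _
  refine ⟨2 * (C₁ * S * √(β - α)) + 1, by positivity, ?_⟩
  intro M dt hdt u q u₁ q₁ hscheme hu0 n hn
  have hsz := size_pos (M := M)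
  set H := M.size ^ (k + 1) + dt ^ 2 with hH
  have hH0 : 0 ≤ H := by positivity
  set s : ℤ → ℝ := fun m => Real.exp (-(a * (dt * κ m ^ 2))) ^ n with hs
  have hs1 : ∀ m, |s m| ≤ 1 := fun m => by
    show |Real.exp (-(a * (dt * κ m ^ 2))) ^ n| ≤ 1
    rw [abs_of_nonneg (by positivity)]
    refine pow_le_one₀ (Real.exp_pos _).le (Real.exp_le_one_iff.2 ?_)
    have : 0 ≤ a * (dt * κ m ^ 2) := by positivity
    linarith
  have hsexp : ∀ m, s m = Real.exp (-(a * κ m ^ 2 * (n * dt))) := fun m => by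
    show Real.exp (-(a * (dt * κ m ^ 2))) ^ n = _
    rw [← Real.exp_nat_mul]
    ring_nf
  obtain ⟨V, hVc, hVs, hVF⟩ := exists_continuous_series hU.summable hs1 κ
  obtain ⟨V₀, hV₀c, hV₀s, hV₀F⟩ := exists_continuous_series hU.summable (s := fun _ => 1)
    (by simp) κ
  have hVU : ∀ x ∈ Icc α β, U (n * dt) x = V x := fun x hx => by
    refine (hU.hasSum (n * dt) ⟨by positivity, hn⟩ x hx).unique ?_
    simpa only [hsexp] using hVs x
  have hV₀U : ∀ x ∈ Icc α β, U 0 x = V₀ x := fun x hx => by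
    have hT : 0 ≤ T := le_trans (by positivity) hn
    refine (hU.hasSum 0 ⟨le_rfl, hT⟩ x hx).unique ?_
    simpa using hV₀s x
  have herr : errorNorm (U (n * dt)) (u n) = errorNorm V (u n) := by
    unfold errorNorm
    congr 1
    refine Finset.sum_congr rfl fun j _ => intervalIntegral.integral_congr fun x hx => ?_
    rw [uIcc_of_le (left_lt_right j).le] at hx
    simp only [hVU x (Icc_cell_subset j hx)]
  have hu0' : IsGaussRadauMinus V₀ (u 0) := hu0.congr hV₀U
  obtain ⟨p, hp⟩ := exists_isGaussRadauMinus (M := M) (k := k) hVc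
  choose w hw using fun m => exists_isGaussRadauMinus (M := M) (k := k)
    (continuous_mode (c m) (κ m))
  have hun : u n = (stepOp (dgDeriv M k) a a₀ dt ^ n) (u 0) := by
    clear hn herr hVU hp p hVF hVs hVc V hsexp hs1 hs s
    induction n with
    | zero => simp
    | succ n ih =>
      rw [hscheme.eq_stepOp (by linarith) hdt.le, ih, pow_succ', Module.End.mul_apply]
  set E := stepOp (dgDeriv M k) a a₀ dt ^ n with hE
  have hmode := fun m => h₁ n hdt (exp_freq hαβ m) (hw m)
  rw [herr]
  -- The estimate with the tail of the series as an additional term.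
  have main : ∀ F : Finset ℤ, errorNorm V (u n) ≤
      2 * (C₁ * S * √(β - α)) * H + 4 * C₂ * √(β - α) * ∑' m : {m // m ∉ F}, ‖c m‖ := by
    intro F
    set ε := ∑' m : {m // m ∉ F}, ‖c m‖ with hε
    have hε0 : 0 ≤ ε := tsum_nonneg fun _ => norm_nonneg _
    have hτ := h₂ (M := M) (B := ε) (w := p + (-1 : ℝ) • ∑ m ∈ F, s m • w m) (by fun_prop)
      (hp.add_smul hVc (by fun_prop)
        (IsGaussRadauMinus.sum F (fun m => continuous_mode (c m) (κ m)) hw s) (-1))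
      fun x _ => by simpa [sub_eq_add_neg] using hVF F x
    have hτ₀ := h₂ (M := M) (B := ε) (w := u 0 + (-1 : ℝ) • ∑ m ∈ F, (1 : ℝ) • w m) (by fun_prop)
      (hu0'.add_smul hV₀c (by fun_prop)
        (IsGaussRadauMinus.sum F (fun m => continuous_mode (c m) (κ m)) hw fun _ => 1) (-1))
      fun x _ => by simpa [sub_eq_add_neg] using hV₀F F x
    have hSF : ∑ m ∈ F, ‖c m‖ * (|κ m| ^ (k + 1) + κ m ^ 4) ≤ S :=
      hU.summable_mul.sum_le_tsum F fun m _ => hnn m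
    have hterm : ∀ m, C₁ * (‖c m‖ * (|κ m| ^ (k + 1) * M.size ^ (k + 1) + κ m ^ 4 * dt ^ 2)) ≤
        C₁ * H * (‖c m‖ * (|κ m| ^ (k + 1) + κ m ^ 4)) := fun m => by
      have e1 : 0 ≤ |κ m| ^ (k + 1) * dt ^ 2 := by positivity
      have e2 : 0 ≤ κ m ^ 4 * M.size ^ (k + 1) := by positivity
      calc _ ≤ C₁ * (‖c m‖ * ((|κ m| ^ (k + 1) + κ m ^ 4) * H)) := by
            gcongr
            rw [hH]
            linarith
        _ = _ := by ring
    have hsumF : ∑ m ∈ F, C₁ * (‖c m‖ * (|κ m| ^ (k + 1) * M.size ^ (k + 1) + κ m ^ 4 * dt ^ 2))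
        ≤ C₁ * S * H :=
      calc _ ≤ ∑ m ∈ F, C₁ * H * (‖c m‖ * (|κ m| ^ (k + 1) + κ m ^ 4)) :=
            Finset.sum_le_sum fun m _ => hterm m
        _ = C₁ * H * ∑ m ∈ F, ‖c m‖ * (|κ m| ^ (k + 1) + κ m ^ 4) := by rw [Finset.mul_sum]
        _ ≤ C₁ * H * S := by gcongr
        _ = _ := by ring
    have hA : ∀ j, ∀ x ∈ Icc (M.left j) (M.right j), |V x - val p j x| ≤ C₁ * S * H + C₂ * ε := by
      intro j x hx
      have e1 := hτ.1 j x hx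
      have e2 : |∑ m ∈ F, s m * (mode (c m) (κ m) x - val (w m) j x)| ≤ C₁ * S * H := by
        refine ((Finset.abs_sum_le_sum_abs _ _).trans (Finset.sum_le_sum fun m _ => ?_)).trans hsumF
        rw [abs_mul]
        refine (mul_le_of_le_one_left (abs_nonneg _) (hs1 m)).trans
          (((hmode m).1 j x hx).trans ?_)
        have : 0 ≤ κ m ^ 4 * dt ^ 2 := by positivity
        gcongr
        linarith
      have e3 : val (∑ m ∈ F, s m • w m) j x = ∑ m ∈ F, s m * val (w m) j x := by
        simp [val, Polynomial.eval_finsetSum]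
      simp only [val_add, val_smul, e3] at e1
      simp only [mul_sub, Finset.sum_sub_distrib] at e2
      have e4 : V x - val p j x =
          (∑ m ∈ F, s m * mode (c m) (κ m) x - ∑ m ∈ F, s m * val (w m) j x) +
          (V x + -1 * ∑ m ∈ F, s m * mode (c m) (κ m) x -
            (val p j x + -1 * ∑ m ∈ F, s m * val (w m) j x)) := by ring
      rw [e4]
      exact (abs_add_le _ _).trans (add_le_add e2 e1)
    have hB : ‖u n - p‖ ≤ C₁ * S * H * √(β - α) + 2 * (C₂ * ε * √(β - α)) := by
      have e1 : u n - p = ∑ m ∈ F, (E (w m) - s m • w m) +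
          E (u 0 + (-1 : ℝ) • ∑ m ∈ F, (1 : ℝ) • w m) - (p + (-1 : ℝ) • ∑ m ∈ F, s m • w m) := by
        simp only [map_add, map_smul, map_sum, one_smul, Finset.sum_sub_distrib, hun]
        module
      rw [e1]
      have e2 : ‖∑ m ∈ F, (E (w m) - s m • w m)‖ ≤ C₁ * S * H * √(β - α) := by
        calc _ ≤ ∑ m ∈ F, C₁ * (‖c m‖ * (|κ m| ^ (k + 1) * M.size ^ (k + 1) + κ m ^ 4 * dt ^ 2))
              * √(β - α) := norm_sum_le_of_le _ fun m _ => (hmode m).2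
          _ ≤ _ := by
            rw [← Finset.sum_mul]
            gcongr
      have e3 : ‖E (u 0 + (-1 : ℝ) • ∑ m ∈ F, (1 : ℝ) • w m)‖ ≤ C₂ * ε * √(β - α) :=
        (norm_stepOp_pow_le ha ha₀ hdt.le n _).trans hτ₀.2
      refine (norm_sub_le _ _).trans ?_
      have e4 := norm_add_le (∑ m ∈ F, (E (w m) - s m • w m))
        (E (u 0 + (-1 : ℝ) • ∑ m ∈ F, (1 : ℝ) • w m))
      linarith [hτ.2]
    have hX0 : 0 ≤ C₂ * ε * √(β - α) := by positivity
    refine (errorNorm_le hVc (X := C₁ * S * H * √(β - α) + 2 * (C₂ * ε * √(β - α)))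
      (by positivity) hA hB (by linarith) le_rfl (by positivity)).trans (le_of_eq ?_)
    ring
  have hlim : Filter.Tendsto (fun F : Finset ℤ => 2 * (C₁ * S * √(β - α)) * H +
      4 * C₂ * √(β - α) * ∑' m : {m // m ∉ F}, ‖c m‖) Filter.atTop
      (nhds (2 * (C₁ * S * √(β - α)) * H + 4 * C₂ * √(β - α) * 0)) :=
    ((tendsto_tsum_compl_atTop_zero fun m => ‖c m‖).const_mul _).const_add _
  have hfin := ge_of_tendsto' hlim main
  rw [mul_zero, add_zero] at hfin
  refine hfin.trans ?_
  gcongr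
  linarith

end

section

/-! ### Test functions and weak derivatives on an interval -/

open Filter Topology

namespace IsTestFunction

lemma continuous {O : Set ℝ} {φ : ℝ → ℝ} (h : IsTestFunction O φ) : Continuous φ :=
  h.1.continuous

lemma eq_zero {O : Set ℝ} {φ : ℝ → ℝ} (h : IsTestFunction O φ) {x : ℝ} (hx : x ∉ O) : φ x = 0 :=
  image_eq_zero_of_notMem_tsupport fun hx' => hx (h.2.2 hx')

lemma deriv {O : Set ℝ} {φ : ℝ → ℝ} (h : IsTestFunction O φ) : IsTestFunction O (deriv φ) :=
  ⟨(contDiff_infty_iff_deriv.1 h.1).2, h.2.1.deriv, tsupport_deriv_subset.trans h.2.2⟩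

lemma mul_left {O : Set ℝ} {φ g : ℝ → ℝ} (hg : ContDiff ℝ ∞ g) (h : IsTestFunction O φ) :
    IsTestFunction O fun x => g x * φ x :=
  ⟨hg.mul h.1, h.2.1.mul_left, tsupport_mul_subset_right.trans h.2.2⟩

lemma sub_const_mul {O : Set ℝ} {φ χ : ℝ → ℝ} (h : IsTestFunction O φ) (h' : IsTestFunction O χ)
    (c : ℝ) : IsTestFunction O fun x => φ x - c * χ x := by
  refine ⟨h.1.sub (contDiff_const.mul h'.1), h.2.1.sub h'.2.1.mul_left, ?_⟩
  exact (tsupport_sub φ fun x => c * χ x).trans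
    (union_subset h.2.2 (tsupport_mul_subset_right.trans h'.2.2))

/-- A test function on an interval is supported in a smaller compact interval. -/
lemma exists_Icc {a b : ℝ} (hab : a < b) {φ : ℝ → ℝ} (h : IsTestFunction (Ioo a b) φ) :
    ∃ l r, a < l ∧ r < b ∧ ∀ x ∉ Icc l r, φ x = 0 := by
  rcases (tsupport φ).eq_empty_or_nonempty with he | hne
  · refine ⟨(a + b) / 2, (a + b) / 2, by linarith, by linarith, fun x _ => ?_⟩
    exact image_eq_zero_of_notMem_tsupport (by simp [he])
  · obtain ⟨l, hl, hl'⟩ := IsCompact.exists_isLeast h.2.1 hne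
    obtain ⟨r, hr, hr'⟩ := IsCompact.exists_isGreatest h.2.1 hne
    refine ⟨l, r, (h.2.2 hl).1, (h.2.2 hr).2, fun x hx => ?_⟩
    exact image_eq_zero_of_notMem_tsupport fun hx' => hx ⟨hl' hx', hr' hx'⟩

end IsTestFunction

lemma setIntegral_Ioo_eq {a b : ℝ} (hab : a ≤ b) (f : ℝ → ℝ) :
    ∫ x in Ioo a b, f x = ∫ x in a..b, f x := by
  rw [intervalIntegral.integral_of_le hab, integral_Ioc_eq_integral_Ioo]

/-- A test function with zero mean is the derivative of a test function. -/
lemma isTestFunction_primitive {a b : ℝ} (hab : a < b) {g : ℝ → ℝ} (hg : IsTestFunction (Ioo a b) g)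
    (h0 : ∫ x in Ioo a b, g x = 0) : IsTestFunction (Ioo a b) (fun x => ∫ y in a..x, g y) ∧
      deriv (fun x => ∫ y in a..x, g y) = g := by
  have hd : ∀ x, HasDerivAt (fun x => ∫ y in a..x, g y) (g x) x := fun x =>
    (hg.continuous.integral_hasStrictDerivAt a x).hasDerivAt
  have hderiv : deriv (fun x => ∫ y in a..x, g y) = g := funext fun x => (hd x).deriv
  obtain ⟨l, r, hl, hr, hlr⟩ := hg.exists_Icc hab
  have hz : ∀ x ∉ Icc l r, ∫ y in a..x, g y = 0 := by
    intro x hx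
    rw [mem_Icc, not_and_or, not_le, not_le] at hx
    rcases hx with hx | hx
    · refine intervalIntegral.integral_zero_ae (ae_of_all _ fun y hy => hlr y fun hy' => ?_)
      rcases mem_uIoc.1 hy with hy | hy <;> linarith [hy'.1, hy.1, hy.2]
    · rw [← intervalIntegral.integral_add_adjacent_intervals
        (hg.continuous.intervalIntegrable a b) (hg.continuous.intervalIntegrable b x),
        ← setIntegral_Ioo_eq hab.le, h0, zero_add]
      refine intervalIntegral.integral_zero_ae (ae_of_all _ fun y hy => hlr y fun hy' => ?_)
      rcases mem_uIoc.1 hy with hy | hy <;> linarith [hy'.2, hy.1, hy.2]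
  have hsupp : Function.support (fun x => ∫ y in a..x, g y) ⊆ Icc l r := fun x hx => by
    by_contra hcon
    exact hx (hz x hcon)
  refine ⟨⟨contDiff_infty_iff_deriv.2 ⟨fun x => (hd x).differentiableAt, ?_⟩,
    HasCompactSupport.of_support_subset_isCompact isCompact_Icc hsupp,
    (closure_minimal hsupp isClosed_Icc).trans (Icc_subset_Ioo hl hr)⟩, hderiv⟩
  rw [hderiv]
  exact hg.1

/-- Smooth cutoff functions that exhaust the interval. -/
lemma exists_cutoff {a b : ℝ} (hab : a < b) : ∃ χ : ℕ → ℝ → ℝ,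
    (∀ j, IsTestFunction (Ioo a b) (χ j)) ∧ (∀ j x, 0 ≤ χ j x ∧ χ j x ≤ 1) ∧
    ∀ x ∈ Ioo a b, ∀ᶠ j in atTop, χ j x = 1 := by
  set R := (b - a) / 2 with hR
  have hR0 : 0 < R := by rw [hR]; linarith
  have hin : ∀ j : ℕ, 0 < R * (1 - 1 / ((j : ℝ) + 2)) := fun j => by
    have : 1 / ((j : ℝ) + 2) < 1 := by
      rw [div_lt_one (by positivity)]
      linarith [Nat.cast_nonneg (α := ℝ) j]
    have := sub_pos.2 this
    positivity
  have hout : ∀ j : ℕ, R * (1 - 1 / ((j : ℝ) + 2)) < R * (1 - 1 / ((j : ℝ) + 3)) := fun j => by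
    gcongr
    norm_num
  let f : ∀ j : ℕ, ContDiffBump ((a + b) / 2) := fun j => ⟨_, _, hin j, hout j⟩
  refine ⟨fun j => f j, fun j => ⟨(f j).contDiff, (f j).hasCompactSupport, ?_⟩,
    fun j x => ⟨(f j).nonneg, (f j).le_one⟩, fun x hx => ?_⟩
  · rw [(f j).tsupport_eq, Real.closedBall_eq_Icc]
    have h1 : R * (1 - 1 / ((j : ℝ) + 3)) < R := by
      have : 0 < 1 / ((j : ℝ) + 3) := by positivity
      nlinarith
    refine Icc_subset_Ioo ?_ ?_
    · show a < (a + b) / 2 - R * (1 - 1 / ((j : ℝ) + 3))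
      linarith
    · show (a + b) / 2 + R * (1 - 1 / ((j : ℝ) + 3)) < b
      linarith
  · have hlim : Tendsto (fun j : ℕ => R * (1 - 1 / ((j : ℝ) + 2))) atTop (𝓝 (R * (1 - 0))) := by
      refine (tendsto_const_nhds.sub ?_).const_mul R
      exact tendsto_const_nhds.div_atTop
        (tendsto_atTop_add_const_right _ _ tendsto_natCast_atTop_atTop)
    have hd : |x - (a + b) / 2| < R * (1 - 0) := by
      rw [abs_lt]
      constructor <;> linarith [hx.1, hx.2]
    filter_upwards [hlim.eventually (lt_mem_nhds hd)] with j hj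
    exact (f j).one_of_mem_closedBall (by rw [Metric.mem_closedBall, Real.dist_eq]; exact hj.le)

lemma exists_isTestFunction_integral_eq_one {a b : ℝ} (hab : a < b) :
    ∃ χ, IsTestFunction (Ioo a b) χ ∧ ∫ x in Ioo a b, χ x = 1 := by
  have hR0 : 0 < (b - a) / 2 := by linarith
  let f : ContDiffBump ((a + b) / 2) := ⟨(b - a) / 8, (b - a) / 4, by linarith, by linarith⟩
  have hf : IsTestFunction (Ioo a b) f := by
    refine ⟨f.contDiff, f.hasCompactSupport, ?_⟩
    rw [f.tsupport_eq, Real.closedBall_eq_Icc]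
    refine Icc_subset_Ioo ?_ ?_
    · show a < (a + b) / 2 - (b - a) / 4
      linarith
    · show (a + b) / 2 + (b - a) / 4 < b
      linarith
  have hpos : 0 < ∫ x in Ioo a b, f x := by
    rw [setIntegral_Ioo_eq hab.le]
    refine intervalIntegral.integral_pos hab f.continuous.continuousOn (fun x _ => f.nonneg)
      ⟨(a + b) / 2, ⟨by linarith, by linarith⟩, ?_⟩
    rw [f.one_of_mem_closedBall (by simpa using f.rIn_pos.le)]
    exact one_pos
  refine ⟨fun x => (∫ x in Ioo a b, f x)⁻¹ * f x, hf.mul_left contDiff_const, ?_⟩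
  rw [integral_const_mul, inv_mul_cancel₀ hpos.ne']

lemma IsTestFunction.integrableOn_mul {a b : ℝ} {f φ : ℝ → ℝ} (hf : IntegrableOn f (Ioo a b))
    (hφ : IsTestFunction (Ioo a b) φ) : IntegrableOn (fun x => f x * φ x) (Ioo a b) := by
  obtain ⟨C, hC⟩ := hφ.2.1.exists_bound_of_continuous hφ.continuous
  exact hf.mul_bdd hφ.continuous.aestronglyMeasurable.restrict (ae_of_all _ hC)

/-- Integrable functions with the same integrals against all test functions agree. -/
lemma ae_eq_of_integral_mul_eq {α β : ℝ} {g f : ℝ → ℝ} (hg : IntegrableOn g (Ioo α β))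
    (hf : IntegrableOn f (Ioo α β)) (h : ∀ φ, IsTestFunction (Ioo α β) φ →
      ∫ x in Ioo α β, g x * φ x = ∫ x in Ioo α β, f x * φ x) :
    ∀ᵐ x ∂(volume.restrict (Ioo α β)), g x = f x := by
  have hgf : IntegrableOn (fun x => g x - f x) (Ioo α β) := hg.sub hf
  have key := isOpen_Ioo.ae_eq_zero_of_integral_contDiff_smul_eq_zero (μ := volume)
    hgf.locallyIntegrableOn fun φ h1 h2 h3 => by
      have hφ : IsTestFunction (Ioo α β) φ := ⟨h1, h2, h3⟩
      have e : ∀ x, φ x • (g x - f x) = g x * φ x - f x * φ x := fun x => by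
        rw [smul_eq_mul]
        ring
      rw [← setIntegral_eq_integral_of_forall_compl_eq_zero (s := Ioo α β) fun x hx => by
        rw [hφ.eq_zero hx, zero_smul]]
      simp only [e]
      rw [integral_sub (hφ.integrableOn_mul hg) (hφ.integrableOn_mul hf), h φ hφ, sub_self]
  rw [ae_restrict_iff' measurableSet_Ioo]
  filter_upwards [key] with x hx hx'
  linarith [hx hx']

/-- The lemma of du Bois-Reymond: a function with vanishing weak derivative is constant. -/
lemma exists_ae_eq_const {a b : ℝ} (hab : a < b) {f : ℝ → ℝ} (hf : IntegrableOn f (Ioo a b))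
    (h : ∀ ψ, IsTestFunction (Ioo a b) ψ → ∫ x in Ioo a b, f x * deriv ψ x = 0) :
    ∃ C, ∀ᵐ x ∂(volume.restrict (Ioo a b)), f x = C := by
  obtain ⟨χ, hχ, hχ1⟩ := exists_isTestFunction_integral_eq_one hab
  set C := ∫ x in Ioo a b, f x * χ x with hC
  refine ⟨C, ?_⟩
  have hone : IntegrableOn (fun _ : ℝ => (1 : ℝ)) (Ioo a b) := by simp
  refine ae_eq_of_integral_mul_eq hf (by simp) fun φ hφ => ?_
  set m := ∫ x in Ioo a b, φ x with hm
  have iφ : IntegrableOn φ (Ioo a b) := by simpa using hφ.integrableOn_mul hone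
  have iχ : IntegrableOn χ (Ioo a b) := by simpa using hχ.integrableOn_mul hone
  -- `φ - m χ` has zero mean, so it is the derivative of a test function.
  have hg := hφ.sub_const_mul hχ m
  obtain ⟨hψ, hψ'⟩ := isTestFunction_primitive hab hg (by
    rw [integral_sub iφ (iχ.const_mul m), integral_const_mul, hχ1, ← hm]; ring)
  have h4 := h _ hψ
  rw [hψ'] at h4
  have e1 : ∫ x in Ioo a b, f x * (φ x - m * χ x) = (∫ x in Ioo a b, f x * φ x) - m * C := by
    rw [hC, ← integral_const_mul, ← integral_sub (hφ.integrableOn_mul hf)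
      ((hχ.integrableOn_mul hf).const_mul m)]
    congr 1
    funext x
    ring
  rw [integral_const_mul, ← hm]
  linarith

/-- Integration by parts for the primitive of an integrable function. -/
lemma integral_primitive_mul_deriv {α β : ℝ} {g : ℝ → ℝ} (hg : IntervalIntegrable g volume α β)
    (C : ℝ) {e : ℝ → ℝ} (he : ContDiff ℝ ∞ e) :
    ∫ x in α..β, (C + ∫ y in α..x, g y) * deriv e x =
      (C + ∫ y in α..β, g y) * e β - C * e α - ∫ x in α..β, g x * e x := by
  have hac := hg.absolutelyContinuousOnInterval_intervalIntegral (c := α) (by simp)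
  have heac : AbsolutelyContinuousOnInterval e α β :=
    ContDiffOn.absolutelyContinuousOnInterval (he.of_le (by exact_mod_cast le_top)).contDiffOn
  have h1 := hac.integral_mul_deriv_eq_deriv_mul heac
  have h2 : ∫ x in α..β, deriv (fun x => ∫ y in α..x, g y) x * e x = ∫ x in α..β, g x * e x := by
    refine intervalIntegral.integral_congr_ae ?_
    filter_upwards [hg.ae_hasDerivAt_integral] with x hx hx'
    rw [(hx (uIoc_subset_uIcc hx') α (by simp)).deriv]
  have h3 := heac.integral_deriv_eq_sub
  have hde : Continuous (deriv e) := (contDiff_infty_iff_deriv.1 he).2.continuous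
  have hcont : ContinuousOn (fun x => ∫ y in α..x, g y) (uIcc α β) := hac.continuousOn
  have e1 : ∀ x, (C + ∫ y in α..x, g y) * deriv e x =
      C * deriv e x + (∫ y in α..x, g y) * deriv e x := fun x => by ring
  simp only [e1]
  rw [intervalIntegral.integral_add, intervalIntegral.integral_const_mul, h1, h2, h3]
  · simp
    ring
  · exact (continuous_const.mul hde).intervalIntegrable _ _
  · exact (hcont.mul hde.continuousOn).intervalIntegrable

/-- The second weak derivative of a function with periodic boundary values and periodic boundary
slopes can be moved to any smooth periodic function, not only to test functions. -/
lemma integral_weakDeriv_two_mul {α β d : ℝ} (hαβ : α < β) {u g₁ g₂ : ℝ → ℝ}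
    (hu : ContinuousOn u (Icc α β)) (hg₁ : IntegrableOn g₁ (Ioo α β))
    (hg₂ : IntegrableOn g₂ (Ioo α β)) (h₁ : IsWeakDeriv α β 1 u g₁) (h₂ : IsWeakDeriv α β 2 u g₂)
    (hper : u α = u β) (hdα : HasDerivWithinAt u d (Icc α β) α)
    (hdβ : HasDerivWithinAt u d (Icc α β) β) {e : ℝ → ℝ} (he : ContDiff ℝ ∞ e) (heper : e α = e β)
    (heper' : deriv e α = deriv e β) :
    ∫ x in Ioo α β, g₂ x * e x = ∫ x in Ioo α β, u x * iteratedDeriv 2 e x := by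
  set g : ℝ → ℝ := (Ioo α β).indicator g₂ with hgdef
  have hgi : Integrable g := (integrable_indicator_iff measurableSet_Ioo).2 hg₂
  have hgg : ∀ f : ℝ → ℝ, ∫ x in Ioo α β, g₂ x * f x = ∫ x in α..β, g x * f x := fun f => by
    rw [← setIntegral_Ioo_eq hαβ.le]
    refine setIntegral_congr_fun measurableSet_Ioo fun x hx => ?_
    simp [hgdef, hx]
  have hH₂ : Continuous fun x => ∫ y in α..x, g y :=
    intervalIntegral.continuous_primitive (fun a b => hgi.intervalIntegrable) α
  have hcInt : ∀ {f : ℝ → ℝ}, Continuous f → IntegrableOn f (Ioo α β) := fun hf =>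
    (hf.integrableOn_Icc).mono_set Ioo_subset_Icc_self
  have hd2 : ∀ ψ : ℝ → ℝ, iteratedDeriv 2 ψ = deriv (deriv ψ) := fun ψ => by
    rw [iteratedDeriv_succ, iteratedDeriv_one]
  -- The first weak derivative is a primitive of the second one.
  obtain ⟨C, hC⟩ := exists_ae_eq_const hαβ (f := fun x => g₁ x - ∫ y in α..x, g y)
    (hg₁.sub (hcInt hH₂)) fun ψ hψ => by
      have e1 := h₁ _ hψ.deriv
      have e2 := h₂ _ hψ
      have e3 := integral_primitive_mul_deriv (hgi.intervalIntegrable (a := α) (b := β)) 0 hψ.1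
      rw [iteratedDeriv_one] at e1
      rw [hd2] at e2
      rw [hψ.eq_zero (by simp), ← hgg ψ, ← setIntegral_Ioo_eq hαβ.le] at e3
      simp only [sub_mul, zero_add, mul_zero, zero_mul, sub_zero] at e3 ⊢
      rw [integral_sub (hψ.deriv.integrableOn_mul hg₁) (hψ.deriv.integrableOn_mul (hcInt hH₂)), e3]
      norm_num at e1 e2
      linarith
  set p : ℝ → ℝ := fun x => C + ∫ y in α..x, g y with hp
  have hpc : Continuous p := continuous_const.add hH₂
  have hP : ∀ x, HasDerivAt (fun x => ∫ y in α..x, p y) (p x) x := fun x =>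
    (hpc.integral_hasStrictDerivAt α x).hasDerivAt
  have hPc : Continuous fun x => ∫ y in α..x, p y :=
    continuous_iff_continuousAt.2 fun x => (hP x).continuousAt
  have huI : IntegrableOn u (Ioo α β) :=
    (hu.integrableOn_compact isCompact_Icc).mono_set Ioo_subset_Icc_self
  have hpp : ∀ f : ℝ → ℝ, ∫ x in Ioo α β, g₁ x * f x = ∫ x in α..β, p x * f x := fun f => by
    rw [← setIntegral_Ioo_eq hαβ.le]
    refine integral_congr_ae ?_
    filter_upwards [hC] with x hx
    rw [show g₁ x = p x by rw [hp]; linarith]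
  -- The function itself is a primitive of this continuous function.
  obtain ⟨C', hC'⟩ := exists_ae_eq_const hαβ (f := fun x => u x - ∫ y in α..x, p y)
    (huI.sub (hcInt hPc)) fun ψ hψ => by
      have e1 := h₁ _ hψ
      have e3 := integral_primitive_mul_deriv (hpc.intervalIntegrable α β) 0 hψ.1
      rw [iteratedDeriv_one] at e1
      rw [hψ.eq_zero (by simp), ← hpp ψ, ← setIntegral_Ioo_eq hαβ.le] at e3
      simp only [sub_mul, zero_add, mul_zero, zero_mul, sub_zero] at e3 ⊢
      rw [integral_sub (hψ.deriv.integrableOn_mul huI) (hψ.deriv.integrableOn_mul (hcInt hPc)), e3]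
      norm_num at e1
      linarith
  have huP : EqOn u (fun x => C' + ∫ y in α..x, p y) (Icc α β) := by
    refine Measure.eqOn_Icc_of_ae_eq volume hαβ.ne ?_ hu (continuous_const.add hPc).continuousOn
    rw [Filter.EventuallyEq, ← restrict_Ioo_eq_restrict_Icc]
    filter_upwards [hC'] with x hx
    linarith
  have hud : ∀ x ∈ Icc α β, HasDerivWithinAt u (p x) (Icc α β) x := fun x hx =>
    ((hP x).const_add C').hasDerivWithinAt.congr huP (huP hx)
  have hα : α ∈ Icc α β := left_mem_Icc.2 hαβ.le
  have hβ : β ∈ Icc α β := right_mem_Icc.2 hαβ.le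
  have hpα : p α = d := (uniqueDiffOn_Icc hαβ α hα).eq_deriv _ (hud α hα) hdα
  have hpβ : p β = d := (uniqueDiffOn_Icc hαβ β hβ).eq_deriv _ (hud β hβ) hdβ
  have he' : ContDiff ℝ ∞ (deriv e) := (contDiff_infty_iff_deriv.1 he).2
  have i1 := integral_primitive_mul_deriv (hgi.intervalIntegrable (a := α) (b := β)) C he
  have i2 := integral_primitive_mul_deriv (hpc.intervalIntegrable α β) C' he'
  have hCα : C = d := by simpa [hp] using hpα
  have hCβ : C + ∫ y in α..β, g y = d := hpβ
  have huα : C' = u α := by simpa using (huP hα).symm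
  have huβ : C' + ∫ y in α..β, p y = u β := (huP hβ).symm
  rw [hCβ, hCα, heper] at i1
  rw [huβ, huα, heper', hper] at i2
  rw [hgg, hd2, setIntegral_Ioo_eq hαβ.le]
  have i3 : ∫ x in α..β, u x * deriv (deriv e) x =
      ∫ x in α..β, (u β + ∫ y in α..x, p y) * deriv (deriv e) x := by
    refine intervalIntegral.integral_congr fun x hx => ?_
    rw [uIcc_of_le hαβ.le] at hx
    simp only [huP hx, ← hper, ← huα]
  rw [i3, i2]
  have i4 : ∫ x in α..β, p x * deriv e x = ∫ x in α..β, (d + ∫ y in α..x, g y) * deriv e x := by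
    simp only [hp, hCα]
  rw [i4, i1]
  ring

lemma tendsto_integral_cutoff {a b : ℝ} {χ : ℕ → ℝ → ℝ}
    (hχ : ∀ j, IsTestFunction (Ioo a b) (χ j)) (hχ01 : ∀ j x, 0 ≤ χ j x ∧ χ j x ≤ 1)
    (hχ1 : ∀ x ∈ Ioo a b, ∀ᶠ j in atTop, χ j x = 1) {F : ℝ → ℝ} (hF : IntegrableOn F (Ioo a b)) :
    Tendsto (fun j => ∫ x in Ioo a b, F x * χ j x) atTop (𝓝 (∫ x in Ioo a b, F x)) := by
  refine tendsto_integral_of_dominated_convergence (fun x => ‖F x‖)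
    (fun j => hF.aestronglyMeasurable.mul (hχ j).continuous.aestronglyMeasurable) hF.norm
    (fun j => ae_of_all _ fun x => ?_) ?_
  · rw [norm_mul, Real.norm_of_nonneg (hχ01 j x).1]
    exact mul_le_of_le_one_right (norm_nonneg _) (hχ01 j x).2
  · rw [ae_restrict_iff' measurableSet_Ioo]
    refine ae_of_all _ fun x hx => tendsto_nhds_of_eventually_eq ?_
    filter_upwards [hχ1 x hx] with j hj
    rw [hj, mul_one]

end

section

/-! ### Moments of the exact solution -/

open Filter Topology

variable {α β T : ℝ}

/-- `F` is integrable on the space-time cylinder and bounded in time with values in `L¹(α, β)`. -/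
structure IsLinftyL1 (α β T : ℝ) (F : ℝ → ℝ → ℝ) : Prop where
  integrableOn : IntegrableOn (fun z : ℝ × ℝ => F z.1 z.2) (Ioo 0 T ×ˢ Ioo α β)
  bound : ∃ K : ℝ, ∀ᵐ t ∂(volume.restrict (Ioo 0 T)), IntegrableOn (F t) (Ioo α β) ∧
    ∫ x in Ioo α β, ‖F t x‖ ≤ K

lemma isLinftyL1_of_bound_L2 {F : ℝ → ℝ → ℝ} (hF : AEStronglyMeasurable (fun z : ℝ × ℝ => F z.1 z.2)
      (volume.restrict (Ioo 0 T ×ˢ Ioo α β)))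
    (hM : ∃ M : ℝ≥0, ∀ᵐ t ∂(volume.restrict (Ioo 0 T)),
      MemLp (F t) 2 (volume.restrict (Ioo α β)) ∧
      eLpNorm (F t) 2 (volume.restrict (Ioo α β)) ≤ M) : IsLinftyL1 α β T F := by
  obtain ⟨M, hM⟩ := hM
  set m := (volume.restrict (Ioo α β)) univ ^ (1 / (1 : ENNReal).toReal - 1 / (2 : ENNReal).toReal)
    with hm
  have hmtop : m ≠ ⊤ := by
    refine ENNReal.rpow_ne_top_of_nonneg (by norm_num) ?_
    simp
  have hb : ∀ᵐ t ∂(volume.restrict (Ioo 0 T)), IntegrableOn (F t) (Ioo α β) ∧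
      ∫ x in Ioo α β, ‖F t x‖ ≤ (M * m).toReal := by
    filter_upwards [hM] with t ht
    have h1 : MemLp (F t) 1 (volume.restrict (Ioo α β)) := ht.1.mono_exponent (by norm_num)
    refine ⟨memLp_one_iff_integrable.1 h1, ?_⟩
    rw [integral_norm_eq_lintegral_enorm h1.1, ← eLpNorm_one_eq_lintegral_enorm]
    refine ENNReal.toReal_mono (ENNReal.mul_ne_top ENNReal.coe_ne_top hmtop) ?_
    refine (eLpNorm_le_eLpNorm_mul_rpow_measure_univ (q := 2) (by norm_num) h1.1).trans ?_
    gcongr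
    exact ht.2
  refine ⟨?_, _, hb⟩
  rw [IntegrableOn, Measure.volume_eq_prod, ← Measure.prod_restrict] at *
  rw [integrable_prod_iff hF]
  refine ⟨hb.mono fun t ht => ht.1, ?_⟩
  refine Integrable.of_bound hF.norm.integral_prod_right' (M * m).toReal (hb.mono fun t ht => ?_)
  rw [Real.norm_of_nonneg (integral_nonneg fun _ => norm_nonneg _)]
  exact ht.2

lemma isLinftyL1_of_continuousOn {U : ℝ → ℝ → ℝ}
    (hU : ContinuousOn (fun z : ℝ × ℝ => U z.1 z.2) (Icc 0 T ×ˢ Icc α β)) :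
    IsLinftyL1 α β T U := by
  have hc : IsCompact (Icc 0 T ×ˢ Icc α β) := isCompact_Icc.prod isCompact_Icc
  refine ⟨(hU.integrableOn_compact hc).mono_set
    (prod_mono Ioo_subset_Icc_self Ioo_subset_Icc_self), ?_⟩
  obtain ⟨B, hB⟩ := hc.exists_bound_of_continuousOn hU
  refine ⟨∫ _ in Ioo α β, B, ?_⟩
  rw [ae_restrict_iff' measurableSet_Ioo]
  refine ae_of_all _ fun t ht => ?_
  have ht' := Ioo_subset_Icc_self ht
  have h1 : ContinuousOn (U t) (Icc α β) :=
    hU.comp (by fun_prop : ContinuousOn (fun x : ℝ => (t, x)) (Icc α β)) fun x hx => ⟨ht', hx⟩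
  have h2 : IntegrableOn (U t) (Ioo α β) :=
    (h1.integrableOn_compact isCompact_Icc).mono_set Ioo_subset_Icc_self
  refine ⟨h2, setIntegral_mono_on h2.norm (by simp) measurableSet_Ioo fun x hx => ?_⟩
  exact hB (t, x) ⟨ht', Ioo_subset_Icc_self hx⟩

lemma isTestFunction_prod {φ ψ : ℝ → ℝ} (hφ : IsTestFunction (Ioo 0 T) φ)
    (hψ : IsTestFunction (Ioo α β) ψ) :
    IsTestFunction (Ioo 0 T ×ˢ Ioo α β) fun z : ℝ × ℝ => φ z.1 * ψ z.2 := by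
  have hsupp : Function.support (fun z : ℝ × ℝ => φ z.1 * ψ z.2) ⊆ tsupport φ ×ˢ tsupport ψ := by
    intro z hz
    rw [Function.mem_support] at hz
    exact ⟨subset_tsupport _ (left_ne_zero_of_mul hz), subset_tsupport _ (right_ne_zero_of_mul hz)⟩
  refine ⟨(hφ.1.comp contDiff_fst).mul (hψ.1.comp contDiff_snd),
    HasCompactSupport.of_support_subset_isCompact (IsCompact.prod hφ.2.1 hψ.2.1) hsupp, ?_⟩
  exact (closure_minimal hsupp ((isClosed_tsupport φ).prod (isClosed_tsupport ψ))).trans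
    (prod_mono hφ.2.2 hψ.2.2)

/-- Fubini's theorem for products. -/
lemma IsLinftyL1.integral_prod_mul {F : ℝ → ℝ → ℝ} (hF : IsLinftyL1 α β T F) {φ ψ : ℝ → ℝ}
    (hφ : Continuous φ) (hψ : Continuous ψ) {A B : ℝ} (hA : ∀ t, |φ t| ≤ A) (hB : ∀ x, |ψ x| ≤ B) :
    IntegrableOn (fun t => φ t * ∫ x in Ioo α β, F t x * ψ x) (Ioo 0 T) ∧
    ∫ z in Ioo 0 T ×ˢ Ioo α β, F z.1 z.2 * (φ z.1 * ψ z.2) =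
      ∫ t in Ioo 0 T, φ t * ∫ x in Ioo α β, F t x * ψ x := by
  have hi : IntegrableOn (fun z : ℝ × ℝ => F z.1 z.2 * (φ z.1 * ψ z.2))
      (Ioo 0 T ×ˢ Ioo α β) (volume.prod volume) := by
    refine Integrable.mul_bdd (c := A * B) hF.integrableOn
      (by fun_prop : Continuous fun z : ℝ × ℝ => φ z.1 * ψ z.2).aestronglyMeasurable
      (ae_of_all _ fun z => ?_)
    rw [norm_mul]
    exact mul_le_mul (hA _) (hB _) (norm_nonneg _) ((abs_nonneg _).trans (hA 0))
  have e : ∀ t, ∫ x in Ioo α β, F t x * (φ t * ψ x) = φ t * ∫ x in Ioo α β, F t x * ψ x :=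
    fun t => by
      rw [← integral_const_mul]
      congr 1
      funext x
      ring
  constructor
  · rw [IntegrableOn, ← Measure.prod_restrict] at hi
    have := hi.integral_prod_left
    simpa only [e, IntegrableOn] using this
  · rw [Measure.volume_eq_prod, setIntegral_prod _ hi]
    simp only [e]

/-- Removal of the cutoff in a space-time integral. -/
lemma IsLinftyL1.tendsto_cutoff {F : ℝ → ℝ → ℝ} (hF : IsLinftyL1 α β T F) {χ : ℕ → ℝ → ℝ}
    (hχ : ∀ j, IsTestFunction (Ioo α β) (χ j)) (hχ01 : ∀ j x, 0 ≤ χ j x ∧ χ j x ≤ 1)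
    (hχ1 : ∀ x ∈ Ioo α β, ∀ᶠ j in atTop, χ j x = 1) {φ e : ℝ → ℝ}
    (hφ : Continuous φ) (he : Continuous e) {A B : ℝ} (hA : ∀ t, |φ t| ≤ A) (hB : ∀ x, |e x| ≤ B) :
    Tendsto (fun j => ∫ t in Ioo 0 T, φ t * ∫ x in Ioo α β, F t x * (e x * χ j x)) atTop
      (𝓝 (∫ t in Ioo 0 T, φ t * ∫ x in Ioo α β, F t x * e x)) := by
  obtain ⟨K, hK⟩ := hF.bound
  have hA0 : 0 ≤ A := (abs_nonneg _).trans (hA 0)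
  have hB0 : 0 ≤ B := (abs_nonneg _).trans (hB 0)
  have hχb : ∀ j x, |e x * χ j x| ≤ B := fun j x => by
    rw [abs_mul, abs_of_nonneg (hχ01 j x).1]
    exact (mul_le_of_le_one_right (abs_nonneg _) (hχ01 j x).2).trans (hB x)
  refine tendsto_integral_of_dominated_convergence (fun _ => A * (B * K)) (fun j => ?_)
    (integrable_const _) (fun j => ?_) ?_
  · exact (hF.integral_prod_mul hφ (he.mul (hχ j).continuous) hA (hχb j)).1.aestronglyMeasurable
  · filter_upwards [hK] with t ht
    rw [norm_mul]
    refine mul_le_mul (hA t) ?_ (norm_nonneg _) hA0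
    calc _ ≤ ∫ x in Ioo α β, B * ‖F t x‖ := by
          refine norm_integral_le_of_norm_le (ht.1.norm.const_mul B) (ae_of_all _ fun x => ?_)
          rw [norm_mul, mul_comm]
          exact mul_le_mul_of_nonneg_right (hχb j x) (norm_nonneg _)
      _ = B * ∫ x in Ioo α β, ‖F t x‖ := integral_const_mul _ _
      _ ≤ B * K := mul_le_mul_of_nonneg_left ht.2 hB0
  · filter_upwards [hK] with t ht
    refine Tendsto.const_mul _ ?_
    have := tendsto_integral_cutoff hχ hχ01 hχ1 (F := fun x => F t x * e x)
      (Integrable.mul_bdd (c := B) ht.1 he.aestronglyMeasurable (ae_of_all _ hB))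
    simpa only [mul_assoc] using this

lemma IsTestFunction.exists_bound {O : Set ℝ} {φ : ℝ → ℝ} (hφ : IsTestFunction O φ) :
    ∃ A, ∀ x, |φ x| ≤ A := hφ.2.1.exists_bound_of_continuous hφ.continuous

lemma IsTestFunction.iteratedDeriv {O : Set ℝ} {φ : ℝ → ℝ} (h : IsTestFunction O φ) (m : ℕ) :
    IsTestFunction O (iteratedDeriv m φ) := by
  induction m with
  | zero => simpa using h
  | succ m ih => rw [iteratedDeriv_succ]; exact ih.deriv

/-- The equation tested with products and separated by Fubini's theorem. -/
lemma IsPeriodicSolution.separated {a a₀ : ℝ} {U : ℝ → ℝ → ℝ}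
    (hU : IsPeriodicSolution α β T a a₀ U) {φ ψ : ℝ → ℝ} (hφ : IsTestFunction (Ioo 0 T) φ)
    (hψ : IsTestFunction (Ioo α β) ψ) :
    -(∫ t in Ioo 0 T, deriv φ t * ∫ x in Ioo α β, U t x * ψ x) =
      a * ∫ t in Ioo 0 T, φ t * ∫ x in Ioo α β, U t x * iteratedDeriv 2 ψ x := by
  have hL := isLinftyL1_of_continuousOn hU.continuousOn
  have h := hU.equation _ (isTestFunction_prod hφ hψ)
  have e1 : ∀ z : ℝ × ℝ, deriv (fun s => φ s * ψ z.2) z.1 = deriv φ z.1 * ψ z.2 := fun z =>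
    deriv_mul_const_field _
  have e2 : ∀ z : ℝ × ℝ, iteratedDeriv 2 (fun y => φ z.1 * ψ y) z.2 =
      φ z.1 * iteratedDeriv 2 ψ z.2 := fun z => iteratedDeriv_const_mul_field _ _
  simp only [e1, e2] at h
  obtain ⟨A, hA⟩ := hφ.exists_bound
  obtain ⟨A', hA'⟩ := hφ.deriv.exists_bound
  obtain ⟨B, hB⟩ := hψ.exists_bound
  obtain ⟨B', hB'⟩ := (hψ.iteratedDeriv 2).exists_bound
  rw [(hL.integral_prod_mul hφ.deriv.continuous hψ.continuous hA' hB).2,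
    (hL.integral_prod_mul hφ.continuous (hψ.iteratedDeriv 2).continuous hA hB').2] at h
  rw [h]
  ring

lemma IsWeakTimeDeriv.separated {l : ℕ} {U V : ℝ → ℝ → ℝ} (h : IsWeakTimeDeriv α β T l U V)
    (hU : IsLinftyL1 α β T U) (hV : IsLinftyL1 α β T V) {φ ψ : ℝ → ℝ}
    (hφ : IsTestFunction (Ioo 0 T) φ) (hψ : IsTestFunction (Ioo α β) ψ) :
    ∫ t in Ioo 0 T, iteratedDeriv l φ t * ∫ x in Ioo α β, U t x * ψ x =
      (-1) ^ l * ∫ t in Ioo 0 T, φ t * ∫ x in Ioo α β, V t x * ψ x := by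
  have h := h _ (isTestFunction_prod hφ hψ)
  have e1 : ∀ z : ℝ × ℝ, iteratedDeriv l (fun s => φ s * ψ z.2) z.1 =
      iteratedDeriv l φ z.1 * ψ z.2 := fun z => by
    have := iteratedDeriv_const_mul_field (n := l) (x := z.1) (ψ z.2) φ
    simpa only [mul_comm] using this
  simp only [e1] at h
  obtain ⟨A, hA⟩ := hφ.exists_bound
  obtain ⟨A', hA'⟩ := (hφ.iteratedDeriv l).exists_bound
  obtain ⟨B, hB⟩ := hψ.exists_bound
  rwa [(hU.integral_prod_mul (hφ.iteratedDeriv l).continuous hψ.continuous hA' hB).2,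
    (hV.integral_prod_mul hφ.continuous hψ.continuous hA hB).2] at h

lemma continuousOn_moment {U : ℝ → ℝ → ℝ} (hαβ : α ≤ β) (hT : 0 ≤ T)
    (hU : ContinuousOn (fun z : ℝ × ℝ => U z.1 z.2) (Icc 0 T ×ˢ Icc α β)) {e : ℝ → ℝ}
    (he : Continuous e) : ContinuousOn (fun t => ∫ x in Ioo α β, U t x * e x) (Icc 0 T) := by
  have hc : Continuous fun z : ℝ × ℝ => U (projIcc 0 T hT z.1) (projIcc α β hαβ z.2) * e z.2 := by
    refine Continuous.mul ?_ (by fun_prop)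
    exact hU.comp_continuous (f := fun z : ℝ × ℝ =>
      ((projIcc 0 T hT z.1 : ℝ), (projIcc α β hαβ z.2 : ℝ)))
      ((continuous_subtype_val.comp (continuous_projIcc.comp continuous_fst)).prodMk
        (continuous_subtype_val.comp (continuous_projIcc.comp continuous_snd)))
      fun z => ⟨(projIcc 0 T hT z.1).2, (projIcc α β hαβ z.2).2⟩
  have h := continuous_parametric_integral_of_continuous (μ := volume)
    (f := fun t x => U (projIcc 0 T hT t) (projIcc α β hαβ x) * e x) hc
    (isCompact_Icc (a := α) (b := β))
  refine h.continuousOn.congr fun t ht => ?_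
  simp only
  rw [integral_Icc_eq_integral_Ioo]
  refine setIntegral_congr_fun measurableSet_Ioo fun x hx => ?_
  simp only [projIcc_of_mem hT ht, projIcc_of_mem hαβ (Ioo_subset_Icc_self hx)]

lemma iteratedDeriv_two_mode (c : ℂ) (κ : ℝ) :
    iteratedDeriv 2 (mode c κ) = fun x => -κ ^ 2 * mode c κ x := by
  rw [iteratedDeriv_mode]
  funext x
  rw [pow_two, mul_assoc, mode_second]

lemma deriv_mode (c : ℂ) (κ : ℝ) : deriv (mode c κ) = mode (κ * Complex.I * c) κ :=
  funext fun x => (hasDerivAt_mode c κ x).deriv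

/-- Each Fourier moment of the exact solution decays exponentially: it solves the differential
equation `y' = -a κ² y`, first in the sense of distributions. -/
lemma IsPeriodicSolution.moment_eq {a a₀ : ℝ} {U : ℝ → ℝ → ℝ} {m : ℕ} (hαβ : α < β) (hT : 0 < T)
    (hU : IsPeriodicSolution α β T a a₀ U) (hspace : MemLinftySobolev α β T m U) (hm : 2 ≤ m)
    {κ : ℝ} (hκ : Complex.exp (κ * (β - α) * Complex.I) = 1) (c : ℂ) {t : ℝ} (ht : t ∈ Icc 0 T) :
    ∫ x in Ioo α β, U t x * mode c κ x =
      Real.exp (-(a * κ ^ 2 * t)) * ∫ x in Ioo α β, U 0 x * mode c κ x := by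
  obtain ⟨G, hG0, hG⟩ := hspace
  have hG1 := isLinftyL1_of_bound_L2 (hG 1 (by omega)).1 (hG 1 (by omega)).2.1
  have hG2 := isLinftyL1_of_bound_L2 (hG 2 hm).1 (hG 2 hm).2.1
  have hUL := isLinftyL1_of_continuousOn hU.continuousOn
  obtain ⟨K₁, hK₁⟩ := hG1.bound
  obtain ⟨K₂, hK₂⟩ := hG2.bound
  set e := mode c κ with he
  set y : ℝ → ℝ := fun t => ∫ x in Ioo α β, U t x * e x with hy
  have hec : ContDiff ℝ ∞ e := contDiff_mode c κ
  have hyc : ContinuousOn y (Icc 0 T) :=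
    continuousOn_moment hαβ.le hT.le hU.continuousOn hec.continuous
  have hyi : ∀ f : ℝ → ℝ, Continuous f → IntegrableOn (fun t => f t * y t) (Ioo 0 T) := fun f hf =>
    ((hf.continuousOn.mul hyc).integrableOn_compact isCompact_Icc).mono_set Ioo_subset_Icc_self
  -- The moments of the second weak derivative.
  have hae : ∀ᵐ t ∂(volume.restrict (Ioo 0 T)),
      ∫ x in Ioo α β, G 2 t x * e x = -κ ^ 2 * y t := by
    filter_upwards [hK₁, hK₂, (hG 1 (by omega)).2.2, (hG 2 hm).2.2,
      ae_restrict_mem measurableSet_Ioo] with t h1 h2 h3 h4 ht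
    obtain ⟨d, hdα, hdβ⟩ := hU.periodic_deriv t (Ioo_subset_Ioc_self ht)
    have hut : ContinuousOn (U t) (Icc α β) :=
      hU.continuousOn.comp (by fun_prop : ContinuousOn (fun x : ℝ => (t, x)) (Icc α β))
        fun x hx => ⟨Ioo_subset_Icc_self ht, hx⟩
    rw [integral_weakDeriv_two_mul hαβ hut h1.1 h2.1 h3 h4
      (hU.periodic t (Ioo_subset_Ioc_self ht)) hdα hdβ hec (mode_periodic hκ c)
      (by rw [he, deriv_mode]; exact mode_periodic hκ _), he, iteratedDeriv_two_mode, ← he, hy,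
      ← integral_const_mul]
    congr 1
    funext x
    ring
  -- The differential equation in the sense of distributions.
  have hode : ∀ φ, IsTestFunction (Ioo 0 T) φ →
      ∫ t in Ioo 0 T, deriv φ t * y t = a * κ ^ 2 * ∫ t in Ioo 0 T, φ t * y t := by
    intro φ hφ
    obtain ⟨χ, hχ, hχ01, hχ1⟩ := exists_cutoff hαβ
    obtain ⟨A, hA⟩ := hφ.exists_bound
    obtain ⟨A', hA'⟩ := hφ.deriv.exists_bound
    have l1 := (hUL.tendsto_cutoff hχ hχ01 hχ1 hφ.deriv.continuous hec.continuous hA'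
      (abs_mode_le c κ)).neg
    have l2 := (hG2.tendsto_cutoff hχ hχ01 hχ1 hφ.continuous hec.continuous hA
      (abs_mode_le c κ)).const_mul a
    have e1 : ∀ j, -(∫ t in Ioo 0 T, deriv φ t * ∫ x in Ioo α β, U t x * (e x * χ j x)) =
        a * ∫ t in Ioo 0 T, φ t * ∫ x in Ioo α β, G 2 t x * (e x * χ j x) := fun j => by
      have hψ := (hχ j).mul_left hec
      rw [hU.separated hφ hψ]
      congr 1
      refine integral_congr_ae ?_
      filter_upwards [(hG 2 hm).2.2] with t ht
      rw [ht _ hψ]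
      norm_num
    have e2 := tendsto_nhds_unique l1 (l2.congr fun j => (e1 j).symm)
    have e3 : ∫ t in Ioo 0 T, φ t * ∫ x in Ioo α β, G 2 t x * e x =
        -κ ^ 2 * ∫ t in Ioo 0 T, φ t * y t := by
      rw [← integral_const_mul]
      refine integral_congr_ae ?_
      filter_upwards [hae] with t ht
      rw [ht]
      ring
    rw [e3] at e2
    linarith
  -- `exp (a κ² t) y t` has zero derivative.
  have hexp : ContDiff ℝ ∞ fun t : ℝ => Real.exp (a * κ ^ 2 * t) := by fun_prop
  obtain ⟨C, hC⟩ := exists_ae_eq_const hT (hyi _ hexp.continuous) fun ψ hψ => by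
    have h1 := hode _ (hψ.mul_left hexp)
    have h2 : ∀ t, deriv (fun t => Real.exp (a * κ ^ 2 * t) * ψ t) t =
        a * κ ^ 2 * (Real.exp (a * κ ^ 2 * t) * ψ t) + Real.exp (a * κ ^ 2 * t) * deriv ψ t := by
      intro t
      have d1 : HasDerivAt (fun t : ℝ => Real.exp (a * κ ^ 2 * t))
          (Real.exp (a * κ ^ 2 * t) * (a * κ ^ 2 * 1)) t :=
        ((hasDerivAt_id t).const_mul _).exp
      have d2 : HasDerivAt ψ (deriv ψ t) t :=
        ((contDiff_infty_iff_deriv.1 hψ.1).1 t).hasDerivAt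
      refine (d1.mul d2).deriv.trans ?_
      ring
    have hψc := hψ.continuous
    have hψc' := hψ.deriv.continuous
    simp only [h2, add_mul] at h1
    rw [integral_add] at h1
    · have h3 : ∫ t in Ioo 0 T, a * κ ^ 2 * (Real.exp (a * κ ^ 2 * t) * ψ t) * y t =
          a * κ ^ 2 * ∫ t in Ioo 0 T, Real.exp (a * κ ^ 2 * t) * ψ t * y t := by
        rw [← integral_const_mul]
        simp only [mul_assoc]
      rw [h3] at h1
      have h4 : ∫ t in Ioo 0 T, Real.exp (a * κ ^ 2 * t) * y t * deriv ψ t =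
          ∫ t in Ioo 0 T, Real.exp (a * κ ^ 2 * t) * deriv ψ t * y t := by
        congr 1
        funext t
        ring
      rw [h4]
      linarith
    · exact hyi (fun t => a * κ ^ 2 * (Real.exp (a * κ ^ 2 * t) * ψ t)) (by fun_prop)
    · exact hyi (fun t => Real.exp (a * κ ^ 2 * t) * deriv ψ t) (by fun_prop)
  have heq : EqOn (fun t => Real.exp (a * κ ^ 2 * t) * y t) (fun _ => C) (Icc 0 T) := by
    refine Measure.eqOn_Icc_of_ae_eq volume hT.ne ?_ (hexp.continuous.continuousOn.mul hyc)
      continuousOn_const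
    rw [Filter.EventuallyEq, ← restrict_Ioo_eq_restrict_Icc]
    exact hC
  have h0 : y 0 = C := by simpa using heq (left_mem_Icc.2 hT.le)
  have h1 : Real.exp (a * κ ^ 2 * t) * y t = C := heq ht
  show y t = Real.exp (-(a * κ ^ 2 * t)) * y 0
  rw [h0, ← h1, ← mul_assoc, ← Real.exp_add]
  simp

lemma integral_deriv_mul_exp {φ : ℝ → ℝ} (hT : 0 < T) (hφ : IsTestFunction (Ioo 0 T) φ) (r : ℝ) :
    ∫ t in Ioo 0 T, deriv φ t * Real.exp (-(r * t)) =
      r * ∫ t in Ioo 0 T, φ t * Real.exp (-(r * t)) := by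
  have h1 : ∀ t, HasDerivAt (fun t : ℝ => Real.exp (-(r * t))) (Real.exp (-(r * t)) * -(r * 1)) t :=
    fun t => (((hasDerivAt_id t).const_mul r).neg).exp
  have h2 : ∀ t, HasDerivAt φ (deriv φ t) t := fun t =>
    ((contDiff_infty_iff_deriv.1 hφ.1).1 t).hasDerivAt
  have hφ' := hφ.deriv.continuous
  have h3 := intervalIntegral.integral_mul_deriv_eq_deriv_mul (a := 0) (b := T)
    (fun t _ => h2 t) (fun t _ => h1 t) (hφ'.intervalIntegrable _ _)
    (Continuous.intervalIntegrable (by fun_prop) _ _)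
  rw [hφ.eq_zero (x := 0) (by simp), hφ.eq_zero (x := T) (by simp), zero_mul, zero_mul, sub_zero,
    zero_sub] at h3
  rw [setIntegral_Ioo_eq hT.le, setIntegral_Ioo_eq hT.le, ← neg_eq_iff_eq_neg.2 h3,
    ← intervalIntegral.integral_const_mul, ← intervalIntegral.integral_neg]
  congr 1
  funext t
  ring

end

section

/-! ### Fourier coefficients of real functions -/

open Filter Topology

variable {α β T : ℝ}

lemma freq_neg (α β : ℝ) (m : ℤ) : freq α β (-m) = -freq α β m := by
  simp [freq, neg_div]

lemma freq_eq_mul (α β : ℝ) (m : ℤ) : freq α β m = freq α β 1 * m := by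
  simp only [freq, Int.cast_one]
  ring

lemma freq_one_pos (hαβ : α < β) : 0 < freq α β 1 := by
  have : 0 < β - α := sub_pos.2 hαβ
  have := Real.pi_pos
  simp only [freq, Int.cast_one]
  positivity

/-- The Fourier coefficients on `(α, β)` of a real function. -/
def realCoeff (hαβ : α < β) (g : ℝ → ℝ) (m : ℤ) : ℂ := fourierCoeffOn hαβ (fun x => (g x : ℂ)) m

lemma realCoeff_eq (hαβ : α < β) (g : ℝ → ℝ) (m : ℤ) :
    ((β - α : ℝ) : ℂ) * realCoeff hαβ g m =
      ∫ x in Ioo α β, (g x : ℂ) * Complex.exp (freq α β (-m) * x * Complex.I) := by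
  have hL : ((β - α : ℝ) : ℂ) ≠ 0 := Complex.ofReal_ne_zero.2 (sub_pos.2 hαβ).ne'
  rw [realCoeff, fourierCoeffOn_eq_integral, intervalIntegral.integral_of_le hαβ.le,
    integral_Ioc_eq_integral_Ioo, Complex.real_smul, ← mul_assoc, ← Complex.ofReal_mul,
    mul_one_div_cancel (sub_pos.2 hαβ).ne', Complex.ofReal_one, one_mul]
  congr 1
  funext x
  rw [fourier_coe_apply, smul_eq_mul, mul_comm, freq]
  congr 2
  push_cast
  ring

/-- Moments against real modes are real parts of multiples of a Fourier coefficient. -/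
lemma integral_mul_mode_eq (hαβ : α < β) {g : ℝ → ℝ} (hg : IntegrableOn g (Ioo α β)) (m : ℤ)
    (c : ℂ) : ∫ x in Ioo α β, g x * mode c (freq α β (-m)) x =
      (c * (((β - α : ℝ) : ℂ) * realCoeff hαβ g m)).re := by
  have hi : IntegrableOn (fun x => (g x : ℂ) * Complex.exp (freq α β (-m) * x * Complex.I))
      (Ioo α β) := by
    refine Integrable.mul_bdd (c := 1) hg.ofReal
      (Continuous.aestronglyMeasurable (by fun_prop)) (ae_of_all _ fun x => ?_)
    rw [← Complex.ofReal_mul, Complex.norm_exp_ofReal_mul_I]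
  rw [realCoeff_eq, ← integral_const_mul]
  have := integral_re (hi.const_mul c)
  simp only [RCLike.re_eq_complex_re] at this
  rw [← this]
  congr 1
  funext x
  rw [mode, ← Complex.re_ofReal_mul]
  congr 1
  ring

/-- Comparison of Fourier coefficients through the two families of real modes. -/
lemma realCoeff_eq_mul (hαβ : α < β) {g f : ℝ → ℝ} (hg : IntegrableOn g (Ioo α β))
    (hf : IntegrableOn f (Ioo α β)) (m : ℤ) (z : ℂ)
    (h : ∀ c : ℂ, c = 1 ∨ c = Complex.I → ∫ x in Ioo α β, g x * mode c (freq α β (-m)) x =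
      ∫ x in Ioo α β, f x * mode (z * c) (freq α β (-m)) x) :
    realCoeff hαβ g m = z * realCoeff hαβ f m := by
  have hL : ((β - α : ℝ) : ℂ) ≠ 0 := Complex.ofReal_ne_zero.2 (sub_pos.2 hαβ).ne'
  have h1 := h 1 (Or.inl rfl)
  have h2 := h Complex.I (Or.inr rfl)
  rw [integral_mul_mode_eq hαβ hg, integral_mul_mode_eq hαβ hf] at h1 h2
  refine mul_left_cancel₀ hL ?_
  rw [← mul_assoc, mul_comm _ z, mul_assoc]
  apply Complex.ext
  · simpa using h1
  · rw [mul_comm z, mul_assoc, Complex.I_mul_re, Complex.I_mul_re, neg_inj] at h2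
    exact h2

/-- A continuous periodic function with absolutely summable Fourier coefficients is the sum of its
Fourier series. -/
lemma hasSum_mode (hαβ : α < β) {g : ℝ → ℝ} (hg : ContinuousOn g (Icc α β)) (hper : g α = g β)
    (hs : Summable fun m => ‖realCoeff hαβ g m‖) {x : ℝ} (hx : x ∈ Icc α β) :
    HasSum (fun m => mode (realCoeff hαβ g m) (freq α β m) x) (g x) := by
  have key : ∀ x ∈ Ico α β,
      HasSum (fun m => mode (realCoeff hαβ g m) (freq α β m) x) (g x) := by
    intro x hx
    have : Fact (0 < β - α) := ⟨sub_pos.2 hαβ⟩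
    have hsub : α + (β - α) = β := by ring
    set G : C(AddCircle (β - α), ℂ) := ⟨AddCircle.liftIco (β - α) α fun x => (g x : ℂ),
      AddCircle.liftIco_continuous (by rw [hsub, hper])
        (by rw [hsub]; exact Complex.continuous_ofReal.comp_continuousOn hg)⟩ with hG
    have hc : ∀ m, fourierCoeff G m = realCoeff hαβ g m := fun m => by
      rw [hG]
      refine (fourierCoeff_liftIco_eq _ m).trans ?_
      rw [realCoeff, fourierCoeffOn_eq_integral, fourierCoeffOn_eq_integral]
      simp only [fourier_coe_apply, hsub]
    have h1 := has_pointwise_sum_fourier_series_of_summable (f := G)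
      (by rw [funext hc]; exact hs.of_norm) (x : AddCircle (β - α))
    have h2 : G x = (g x : ℂ) :=
      AddCircle.liftIco_coe_apply (f := fun x => (g x : ℂ)) (by rwa [hsub])
    rw [h2] at h1
    have h3 := Complex.hasSum_re h1
    rw [Complex.ofReal_re] at h3
    convert h3 using 2 with m
    rw [hc, smul_eq_mul, fourier_coe_apply, mode, freq]
    congr 3
    push_cast
    ring
  rcases hx.2.lt_or_eq with h | rfl
  · exact key x ⟨hx.1, h⟩
  · have := key α ⟨le_rfl, hαβ⟩
    rw [hper] at this
    simpa only [mode_periodic (exp_freq hαβ _)] using this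

/-- Bessel's inequality. -/
lemma sum_norm_realCoeff_sq_le (hαβ : α < β) {g : ℝ → ℝ}
    (hg : MemLp g 2 (volume.restrict (Ioo α β))) {K : ℝ≥0}
    (hK : eLpNorm g 2 (volume.restrict (Ioo α β)) ≤ K) (F : Finset ℤ) :
    ∑ m ∈ F, ‖realCoeff hαβ g m‖ ^ 2 ≤ (β - α)⁻¹ * K ^ 2 := by
  have h1 : MemLp (fun x => (g x : ℂ)) 2 (volume.restrict (Ioc α β)) := by
    rw [← restrict_Ioo_eq_restrict_Ioc]
    exact hg.ofReal
  have h2 := hasSum_sq_fourierCoeffOn hαβ h1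
  refine (sum_le_hasSum F (fun _ _ => by positivity) h2).trans ?_
  rw [smul_eq_mul]
  refine mul_le_mul_of_nonneg_left ?_ (inv_nonneg.2 (sub_pos.2 hαβ).le)
  simp only [Complex.norm_real]
  rw [← setIntegral_Ioo_eq hαβ.le]
  rw [hg.eLpNorm_eq_integral_rpow_norm (by norm_num) (by norm_num)] at hK
  have h3 : 0 ≤ ∫ x in Ioo α β, ‖g x‖ ^ 2 := integral_nonneg fun _ => by positivity
  simp only [ENNReal.toReal_ofNat, Real.rpow_ofNat] at hK
  rw [ENNReal.ofReal_le_coe] at hK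
  have h4 := Real.rpow_nonneg h3 (2 : ℝ)⁻¹
  have h5 : ∫ x in Ioo α β, ‖g x‖ ^ 2 = ((∫ x in Ioo α β, ‖g x‖ ^ 2) ^ (2 : ℝ)⁻¹) ^ 2 := by
    rw [← Real.rpow_natCast, ← Real.rpow_mul h3]
    norm_num
  rw [h5]
  gcongr

/-! ### Summability of weighted coefficients -/

lemma summable_of_abs_mul_sq_le {f : ℤ → ℝ} {B : ℝ} (h : ∀ m, |f m| * m ^ 2 ≤ B) :
    Summable f := by
  refine Summable.of_norm_bounded_eventually
    ((Real.summable_one_div_int_pow (p := 2).2 (by norm_num)).mul_left B) ?_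
  filter_upwards [(finite_singleton (0 : ℤ)).compl_mem_cofinite] with m hm
  have hm' : (0 : ℝ) < (m : ℝ) ^ 2 := by
    have : (m : ℝ) ≠ 0 := Int.cast_ne_zero.2 hm
    positivity
  rw [Real.norm_eq_abs, mul_one_div, le_div_iff₀ hm']
  exact h m

/-- One power of the frequency is the price for passing from square summability to absolute
summability. -/
lemma summable_of_summable_sq (hαβ : α < β) {c : ℤ → ℂ} {p q : ℕ} (hpq : p ≤ q)
    (h : Summable fun m => (freq α β m ^ (q + 1) * ‖c m‖) ^ 2) :
    Summable fun m => ‖c m‖ * |freq α β m| ^ p := by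
  have hκ := freq_one_pos hαβ
  set κ := freq α β 1 with hκdef
  refine Summable.of_norm_bounded_eventually (((h.mul_left ((κ ^ (q + 1))⁻¹ ^ 2)).add
    (Real.summable_one_div_int_pow (p := 2).2 (by norm_num))).mul_left (κ ^ p)) ?_
  filter_upwards [(finite_singleton (0 : ℤ)).compl_mem_cofinite] with m hm
  have hm1 : (1 : ℝ) ≤ |(m : ℝ)| := by
    rw [← Int.cast_abs]
    exact_mod_cast Int.one_le_abs hm
  have hm0 : (m : ℝ) ≠ 0 := Int.cast_ne_zero.2 hm
  have e1 : ((κ ^ (q + 1))⁻¹) ^ 2 * (freq α β m ^ (q + 1) * ‖c m‖) ^ 2 =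
      (|(m : ℝ)| ^ (q + 1) * ‖c m‖) ^ 2 := by
    rw [freq_eq_mul, ← hκdef, ← mul_pow, mul_pow κ, ← mul_assoc, ← mul_assoc,
      inv_mul_cancel₀ (by positivity), one_mul, mul_pow, mul_pow (_ ^ _), ← abs_pow, sq_abs]
  rw [e1, Real.norm_of_nonneg (by positivity), freq_eq_mul, ← hκdef, abs_mul, abs_of_pos hκ,
    mul_pow, mul_left_comm]
  refine mul_le_mul_of_nonneg_left ?_ (by positivity)
  set X := |(m : ℝ)| ^ (q + 1) * ‖c m‖ with hX
  set Y := 1 / |(m : ℝ)| with hY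
  have hY2 : 1 / (m : ℝ) ^ 2 = Y ^ 2 := by rw [hY, div_pow, sq_abs, one_pow]
  have hXY : |(m : ℝ)| ^ q * ‖c m‖ = X * Y := by
    have := abs_pos.2 hm0
    rw [hX, hY, pow_succ]
    field_simp
  calc ‖c m‖ * |(m : ℝ)| ^ p ≤ ‖c m‖ * |(m : ℝ)| ^ q :=
        mul_le_mul_of_nonneg_left (pow_le_pow_right₀ hm1 hpq) (norm_nonneg _)
    _ = X * Y := by rw [mul_comm, hXY]
    _ ≤ _ := by
        rw [hY2]
        nlinarith [sq_nonneg (X - Y), sq_nonneg (X + Y)]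

/-- A bound for exponentially damped coefficients, for almost every small time, passes to the
coefficients at time zero. -/
lemma summable_sq_of_ae_sum_le (hT : 0 < T) {w : ℤ → ℝ} {r : ℤ → ℝ} {K : ℝ}
    (h : ∀ᵐ t ∂(volume.restrict (Ioo 0 T)), ∀ F : Finset ℤ,
      ∑ m ∈ F, (w m * Real.exp (-(r m * t))) ^ 2 ≤ K) : Summable fun m => w m ^ 2 := by
  refine summable_of_sum_le (c := K) (fun m => sq_nonneg _) fun F => ?_
  have hlim : Tendsto (fun t : ℝ => ∑ m ∈ F, (w m * Real.exp (-(r m * t))) ^ 2) (𝓝[>] 0)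
      (𝓝 (∑ m ∈ F, w m ^ 2)) := by
    have : Continuous fun t : ℝ => ∑ m ∈ F, (w m * Real.exp (-(r m * t))) ^ 2 := by fun_prop
    simpa using (this.tendsto 0).mono_left nhdsWithin_le_nhds
  refine le_of_tendsto_of_frequently hlim ?_
  rw [Filter.Frequently]
  intro hev
  obtain ⟨ε, hε, hsub⟩ := mem_nhdsGT_iff_exists_Ioo_subset.1 hev
  rw [ae_restrict_iff' measurableSet_Ioo, ae_iff] at h
  have hpos : 0 < volume (Ioo 0 (min ε T)) := by
    rw [Real.volume_Ioo, ENNReal.ofReal_pos, sub_zero]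
    exact lt_min hε hT
  refine hpos.ne' (measure_mono_null (fun t ht => ?_) h)
  have h1 : ¬ _ := hsub ⟨ht.1, ht.2.trans_le (min_le_left _ _)⟩
  simp only [mem_ofPred_eq, Classical.not_imp]
  exact ⟨⟨ht.1, ht.2.trans_le (min_le_right _ _)⟩, fun hcon => h1 (hcon F)⟩

end

section

/-! ### The Fourier series of the exact solution -/

open Filter Topology

variable {α β T : ℝ}

/-- Repeated integration by parts without boundary terms. -/
lemma integral_iteratedDeriv_mul {f e : ℝ → ℝ} (hf : ContDiff ℝ ∞ f) (he : ContDiff ℝ ∞ e)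
    (h : ∀ i j, iteratedDeriv i f α * iteratedDeriv j e α =
      iteratedDeriv i f β * iteratedDeriv j e β) (n : ℕ) :
    ∫ x in α..β, iteratedDeriv n f x * e x =
      (-1) ^ n * ∫ x in α..β, f x * iteratedDeriv n e x := by
  induction n generalizing f with
  | zero => simp
  | succ n ih =>
    have hf' : ContDiff ℝ ∞ (deriv f) := (contDiff_infty_iff_deriv.1 hf).2
    have hen : ContDiff ℝ ∞ (iteratedDeriv n e) := by
      rw [iteratedDeriv_eq_iterate]
      exact he.iterate_deriv n
    have h1 : ∀ i, iteratedDeriv i (deriv f) = iteratedDeriv (i + 1) f := fun i =>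
      iteratedDeriv_succ'.symm
    have h2 := ih hf' fun i j => by rw [h1]; exact h _ _
    rw [← h1, h2, iteratedDeriv_succ]
    have h3 := intervalIntegral.integral_mul_deriv_eq_deriv_mul (a := α) (b := β)
      (fun x _ => ((contDiff_infty_iff_deriv.1 hf).1 x).hasDerivAt)
      (fun x _ => ((contDiff_infty_iff_deriv.1 hen).1 x).hasDerivAt)
      (hf'.continuous.intervalIntegrable _ _)
      ((contDiff_infty_iff_deriv.1 hen).2.continuous.intervalIntegrable _ _)
    have h4 := h 0 n
    simp only [iteratedDeriv_zero] at h4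
    rw [h3, h4]
    ring

lemma mode_add_period {κ : ℝ} (hκ : Complex.exp (κ * (β - α) * Complex.I) = 1) (c : ℂ) (x : ℝ) :
    mode c κ (x + (β - α)) = mode c κ x := by
  have : Complex.exp (κ * (x + (β - α) : ℝ) * Complex.I) = Complex.exp (κ * x * Complex.I) := by
    rw [← mul_one (Complex.exp (κ * x * Complex.I)), ← hκ, ← Complex.exp_add]
    push_cast
    ring_nf
  rw [mode, mode, this]

/-- A Fourier series with rapidly decreasing coefficients is smooth and periodic. -/
lemma exists_smooth_series (hαβ : α < β) {c : ℤ → ℂ}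
    (hc : ∀ p : ℕ, Summable fun m => ‖c m‖ * |freq α β m| ^ p) :
    ∃ f : ℝ → ℝ, ContDiff ℝ ∞ f ∧ (∀ n, iteratedDeriv n f α = iteratedDeriv n f β) ∧
      ∀ x, f x = ∑' m, mode (c m) (freq α β m) x := by
  refine ⟨fun x => ∑' m, mode (c m) (freq α β m) x, ?_, fun n => ?_, fun x => rfl⟩
  · refine contDiff_tsum (fun m => contDiff_mode _ _) (fun p _ => hc p) fun p m x _ => ?_
    rw [norm_iteratedFDeriv_eq_norm_iteratedDeriv, iteratedDeriv_mode]
    refine (abs_mode_le _ _ _).trans ?_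
    rw [norm_mul_I_pow_mul, mul_comm]
  · have h := congrFun (iteratedDeriv_comp_add_const n
      (fun x => ∑' m, mode (c m) (freq α β m) x) (β - α)) α
    simp only [mode_add_period (exp_freq hαβ _)] at h
    rw [h]
    congr 1
    ring

/-- Weak derivatives act on the Fourier coefficients of a function with rapidly decreasing
coefficients as multiplication operators. -/
lemma realCoeff_weakDeriv (hαβ : α < β) {u g : ℝ → ℝ} {n : ℕ} (hu : ContinuousOn u (Icc α β))
    (hper : u α = u β) (hc : ∀ p : ℕ, Summable fun m => ‖realCoeff hαβ u m‖ * |freq α β m| ^ p)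
    (hg : IntegrableOn g (Ioo α β)) (h : IsWeakDeriv α β n u g) (m : ℤ) :
    realCoeff hαβ g m = (freq α β m * Complex.I) ^ n * realCoeff hαβ u m := by
  obtain ⟨f, hf, hfper, hfs⟩ := exists_smooth_series hαβ hc
  have hfn : Continuous (iteratedDeriv n f) :=
    hf.continuous_iteratedDeriv n (by exact_mod_cast le_top)
  have huf : ∀ x ∈ Icc α β, u x = f x := fun x hx => by
    rw [hfs, (hasSum_mode hαβ hu hper (by simpa using hc 0) hx).tsum_eq]
  have huI : IntegrableOn u (Ioo α β) :=
    (hu.integrableOn_compact isCompact_Icc).mono_set Ioo_subset_Icc_self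
  have hmove : ∀ e : ℝ → ℝ, ∫ x in Ioo α β, u x * e x = ∫ x in α..β, f x * e x := fun e => by
    rw [← setIntegral_Ioo_eq hαβ.le]
    refine setIntegral_congr_fun measurableSet_Ioo fun x hx => ?_
    simp only [huf x (Ioo_subset_Icc_self hx)]
  have hae : ∀ᵐ x ∂(volume.restrict (Ioo α β)), g x = iteratedDeriv n f x := by
    refine ae_eq_of_integral_mul_eq hg (hfn.integrableOn_Icc.mono_set Ioo_subset_Icc_self)
      fun φ hφ => ?_
    have h1 := h φ hφ
    have h2 := integral_iteratedDeriv_mul (α := α) (β := β) hf hφ.1 (fun i j => by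
      rw [(hφ.iteratedDeriv j).eq_zero (x := α) (by simp),
        (hφ.iteratedDeriv j).eq_zero (x := β) (by simp), mul_zero, mul_zero]) n
    rw [setIntegral_Ioo_eq hαβ.le (fun x => iteratedDeriv n f x * φ x), h2, ← hmove, h1,
      ← mul_assoc, ← mul_pow]
    norm_num
  refine realCoeff_eq_mul hαβ hg huI m _ fun c _ => ?_
  have hκ := exp_freq hαβ (-m)
  have h2 := integral_iteratedDeriv_mul (α := α) (β := β) hf (contDiff_mode c (freq α β (-m)))
    (fun i j => by rw [hfper, iteratedDeriv_mode, mode_periodic hκ]) n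
  have h3 : ∫ x in Ioo α β, g x * mode c (freq α β (-m)) x =
      ∫ x in Ioo α β, iteratedDeriv n f x * mode c (freq α β (-m)) x := by
    refine integral_congr_ae ?_
    filter_upwards [hae] with x hx
    rw [hx]
  rw [h3, setIntegral_Ioo_eq hαβ.le, h2, hmove, ← intervalIntegral.integral_const_mul]
  congr 1
  funext x
  rw [iteratedDeriv_mode, freq_neg, mul_left_comm]
  congr 1
  rw [mode, mode, ← Complex.re_ofReal_mul]
  congr 1
  have : ((freq α β m : ℂ) * Complex.I) ^ n =
      (-1) ^ n * (((-freq α β m : ℝ) : ℂ) * Complex.I) ^ n := by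
    rw [← mul_pow]
    push_cast
    ring
  rw [this]
  push_cast
  ring

/-- The moments of the third weak time derivative of a function with exponentially decaying
moments. -/
lemma IsWeakTimeDeriv.moment_three (hαβ : α < β) (hT : 0 < T) {U V : ℝ → ℝ → ℝ}
    (h : IsWeakTimeDeriv α β T 3 U V) (hU : IsLinftyL1 α β T U) (hV : IsLinftyL1 α β T V)
    {c : ℂ} {κ r Y : ℝ} (hy : ∀ t ∈ Ioo 0 T, ∫ x in Ioo α β, U t x * mode c κ x =
      Real.exp (-(r * t)) * Y) :
    ∀ᵐ t ∂(volume.restrict (Ioo 0 T)), ∫ x in Ioo α β, V t x * mode c κ x =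
      -(r ^ 3) * ∫ x in Ioo α β, U t x * mode c κ x := by
  have hec : ContDiff ℝ ∞ (mode c κ) := contDiff_mode c κ
  have hi : ∀ {F : ℝ → ℝ → ℝ}, IsLinftyL1 α β T F →
      IntegrableOn (fun t => ∫ x in Ioo α β, F t x * mode c κ x) (Ioo 0 T) := fun hF => by
    simpa using (hF.integral_prod_mul (φ := fun _ => 1) continuous_const hec.continuous
      (A := 1) (by simp) (abs_mode_le c κ)).1
  refine ae_eq_of_integral_mul_eq (hi hV) ((hi hU).const_mul _) fun φ hφ => ?_
  obtain ⟨χ, hχ, hχ01, hχ1⟩ := exists_cutoff hαβ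
  obtain ⟨A, hA⟩ := hφ.exists_bound
  obtain ⟨A', hA'⟩ := (hφ.iteratedDeriv 3).exists_bound
  have l1 := hU.tendsto_cutoff hχ hχ01 hχ1 (hφ.iteratedDeriv 3).continuous hec.continuous hA'
    (abs_mode_le c κ)
  have l2 := (hV.tendsto_cutoff hχ hχ01 hχ1 hφ.continuous hec.continuous hA
    (abs_mode_le c κ)).const_mul ((-1) ^ 3)
  have e1 := tendsto_nhds_unique l1
    (l2.congr fun j => (h.separated hU hV hφ ((hχ j).mul_left hec)).symm)
  have e2 : ∀ f : ℝ → ℝ, ∫ t in Ioo 0 T, f t * ∫ x in Ioo α β, U t x * mode c κ x =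
      Y * ∫ t in Ioo 0 T, f t * Real.exp (-(r * t)) := fun f => by
    rw [← integral_const_mul]
    refine setIntegral_congr_fun measurableSet_Ioo fun t ht => ?_
    simp only [hy t ht]
    ring
  have e3 : iteratedDeriv 3 φ = deriv (deriv (deriv φ)) := by
    simp [iteratedDeriv_succ, iteratedDeriv_zero]
  rw [e2, e3, integral_deriv_mul_exp hT hφ.deriv.deriv, integral_deriv_mul_exp hT hφ.deriv,
    integral_deriv_mul_exp hT hφ] at e1
  have e4 : ∫ t in Ioo 0 T, -(r ^ 3) * (∫ x in Ioo α β, U t x * mode c κ x) * φ t =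
      -(r ^ 3) * ∫ t in Ioo 0 T, φ t * ∫ x in Ioo α β, U t x * mode c κ x := by
    rw [← integral_const_mul]
    congr 1
    funext t
    ring
  have e5 : ∫ t in Ioo 0 T, (∫ x in Ioo α β, V t x * mode c κ x) * φ t =
      ∫ t in Ioo 0 T, φ t * ∫ x in Ioo α β, V t x * mode c κ x := by
    congr 1
    funext t
    ring
  rw [e4, e5, e2]
  linear_combination e1

lemma exists_pow_mul_exp_le {r : ℝ} (hr : 0 < r) (n : ℕ) :
    ∃ B, ∀ x : ℝ, |x| ^ n * Real.exp (-(r * x ^ 2)) ≤ B := by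
  refine ⟨1 + n.factorial / r ^ n, fun x => ?_⟩
  have h1 : |x| ^ n ≤ 1 + (x ^ 2) ^ n := by
    rcases le_total |x| 1 with h | h
    · have := pow_le_one₀ (n := n) (abs_nonneg x) h
      have : 0 ≤ (x ^ 2) ^ n := by positivity
      linarith
    · have : |x| ^ n ≤ (|x| ^ 2) ^ n := by
        rw [← pow_mul]
        exact pow_le_pow_right₀ h (by omega)
      rw [sq_abs] at this
      linarith
  have h2 := Real.pow_div_factorial_le_exp (r * x ^ 2) (by positivity) n
  have h3 : (0 : ℝ) < n.factorial := by exact_mod_cast n.factorial_pos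
  rw [div_le_iff₀ h3, mul_pow] at h2
  have h4 : (x ^ 2) ^ n * Real.exp (-(r * x ^ 2)) ≤ n.factorial / r ^ n := by
    rw [Real.exp_neg, ← div_eq_mul_inv, div_le_div_iff₀ (Real.exp_pos _) (by positivity)]
    linarith
  have h5 : Real.exp (-(r * x ^ 2)) ≤ 1 := Real.exp_le_one_iff.2 (by nlinarith [sq_nonneg x])
  calc _ ≤ (1 + (x ^ 2) ^ n) * Real.exp (-(r * x ^ 2)) :=
        mul_le_mul_of_nonneg_right h1 (Real.exp_pos _).le
    _ ≤ _ := by rw [add_mul, one_mul]; exact add_le_add h5 h4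

/-- Damping by the heat flow makes bounded coefficients rapidly decreasing. -/
lemma summable_damped (hαβ : α < β) {c : ℤ → ℂ} {B r : ℝ} (hc : ∀ m, ‖c m‖ ≤ B) (hr : 0 < r)
    (p : ℕ) : Summable fun m =>
      ‖(Real.exp (-(r * freq α β m ^ 2)) : ℂ) * c m‖ * |freq α β m| ^ p := by
  obtain ⟨D, hD⟩ := exists_pow_mul_exp_le hr (p + 2)
  have hκ := freq_one_pos hαβ
  have hB : 0 ≤ B := (norm_nonneg _).trans (hc 0)
  refine summable_of_abs_mul_sq_le (B := B * D / freq α β 1 ^ 2) fun m => ?_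
  rw [le_div_iff₀ (by positivity), norm_mul, Complex.norm_real, Real.norm_of_nonneg
    (Real.exp_pos _).le, abs_of_nonneg (by positivity), mul_assoc, ← mul_pow, mul_comm (m : ℝ),
    ← freq_eq_mul]
  have h1 := hD (freq α β m)
  rw [pow_add, sq_abs] at h1
  calc _ = ‖c m‖ * (|freq α β m| ^ p * freq α β m ^ 2 * Real.exp (-(r * freq α β m ^ 2))) := by
        ring
    _ ≤ B * D := mul_le_mul (hc m) h1 (by positivity) hB

lemma mode_ofReal_mul (s : ℝ) (c : ℂ) (κ x : ℝ) : mode (s * c) κ x = s * mode c κ x := by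
  rw [mode, mul_assoc, Complex.re_ofReal_mul, mode]

/-- A smooth periodic solution is the sum of its Fourier series. The spatial regularity gives the
weight `|κ| ^ (k + 1)`. The third time derivative multiplies the coefficient of wave number `κ` by
`-(a κ²)³` and gives the weight `κ ^ 4`. -/
lemma exists_hasFourierSeries {a a₀ : ℝ} {k : ℕ} {U : ℝ → ℝ → ℝ} (hαβ : α < β) (hT : 0 < T)
    (ha : 0 < a) (hU : IsPeriodicSolution α β T a a₀ U) (hs : SmoothnessAssumption α β T k U) :
    ∃ c, HasFourierSeries α β T a k U c := by
  have hUL := isLinftyL1_of_continuousOn hU.continuousOn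
  have hUt : ∀ t ∈ Icc 0 T, ContinuousOn (U t) (Icc α β) := fun t ht =>
    hU.continuousOn.comp (by fun_prop : ContinuousOn (fun x : ℝ => (t, x)) (Icc α β))
      fun x hx => ⟨ht, hx⟩
  have hUi : ∀ t ∈ Icc 0 T, IntegrableOn (U t) (Ioo α β) := fun t ht =>
    ((hUt t ht).integrableOn_compact isCompact_Icc).mono_set Ioo_subset_Icc_self
  have h0 : (0 : ℝ) ∈ Icc 0 T := left_mem_Icc.2 hT.le
  set c := realCoeff hαβ (U 0) with hc
  have hmom : ∀ m d, ∀ t ∈ Icc 0 T, ∫ x in Ioo α β, U t x * mode d (freq α β (-m)) x =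
      Real.exp (-(a * freq α β m ^ 2 * t)) *
        ∫ x in Ioo α β, U 0 x * mode d (freq α β (-m)) x := fun m d t ht => by
    have := hU.moment_eq hαβ hT hs.space (by omega) (exp_freq hαβ (-m)) d ht
    rwa [freq_neg, neg_sq, ← freq_neg] at this
  have hcoeff : ∀ t ∈ Icc 0 T, ∀ m, realCoeff hαβ (U t) m =
      (Real.exp (-(a * freq α β m ^ 2 * t)) : ℂ) * c m := fun t ht m => by
    refine realCoeff_eq_mul hαβ (hUi t ht) (hUi 0 h0) m _ fun d _ => ?_
    rw [hmom m d t ht, ← integral_const_mul]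
    congr 1
    funext x
    rw [mode_ofReal_mul]
    ring
  have hper : ∀ t ∈ Icc 0 T, U t α = U t β := by
    have hcont : ∀ x ∈ Icc α β, ContinuousOn (fun t => U t x) (Icc 0 T) := fun x hx =>
      hU.continuousOn.comp (by fun_prop : ContinuousOn (fun t : ℝ => (t, x)) (Icc 0 T))
        fun t ht => ⟨ht, hx⟩
    exact EqOn.of_subset_closure (s := Ioc 0 T) hU.periodic
      (hcont α (left_mem_Icc.2 hαβ.le)) (hcont β (right_mem_Icc.2 hαβ.le)) Ioc_subset_Icc_self
      (closure_Ioc hT.ne).ge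
  have hB : ∀ m, ‖c m‖ ≤ (∫ x in Ioo α β, ‖U 0 x‖) / (β - α) := fun m => by
    rw [le_div_iff₀ (sub_pos.2 hαβ), mul_comm, ← Real.norm_of_nonneg (sub_pos.2 hαβ).le,
      ← Complex.norm_real, ← norm_mul, hc, realCoeff_eq]
    refine norm_integral_le_of_norm_le (hUi 0 h0).norm (ae_of_all _ fun x => ?_)
    rw [norm_mul, ← Complex.ofReal_mul, Complex.norm_exp_ofReal_mul_I, mul_one, Complex.norm_real]
  have hdamp : ∀ t ∈ Ioo 0 T, ∀ p : ℕ,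
      Summable fun m => ‖realCoeff hαβ (U t) m‖ * |freq α β m| ^ p := fun t ht p => by
    have := summable_damped hαβ hB (mul_pos ha ht.1) p
    simpa only [hcoeff t (Ioo_subset_Icc_self ht), mul_right_comm a t] using this
  have hspace : Summable fun m => (freq α β m ^ (k + 1 + 1) * ‖c m‖) ^ 2 := by
    obtain ⟨G, rfl, hG⟩ := hs.space
    obtain ⟨hGm, ⟨K, hK⟩, hw⟩ := hG (k + 2) le_rfl
    refine summable_sq_of_ae_sum_le hT (r := fun m => a * freq α β m ^ 2)
      (K := (β - α)⁻¹ * K ^ 2) ?_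
    filter_upwards [hK, hw, ae_restrict_mem measurableSet_Ioo] with t h1 h2 ht F
    have ht' := Ioo_subset_Icc_self ht
    refine le_trans (le_of_eq (Finset.sum_congr rfl fun m _ => ?_))
      (sum_norm_realCoeff_sq_le hαβ h1.1 h1.2 F)
    rw [realCoeff_weakDeriv hαβ (hUt t ht') (hper t ht') (hdamp t ht)
      (h1.1.integrable (by norm_num)) h2, hcoeff t ht', norm_mul_I_pow_mul, norm_mul,
      Complex.norm_real, Real.norm_of_nonneg (Real.exp_pos _).le]
    rw [mul_pow, mul_pow, mul_pow, mul_pow, ← abs_pow, sq_abs]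
    ring
  have htime : Summable fun m => (freq α β m ^ (5 + 1) * ‖c m‖) ^ 2 := by
    obtain ⟨V, hV, G, rfl, hG⟩ := hs.time_three
    obtain ⟨hGm, ⟨K, hK⟩, -⟩ := hG 0 le_rfl
    have hVL := isLinftyL1_of_bound_L2 hGm ⟨K, hK⟩
    have h3 : Summable fun m => (a ^ 3 * (freq α β m ^ (5 + 1) * ‖c m‖)) ^ 2 := by
      refine summable_sq_of_ae_sum_le hT (r := fun m => a * freq α β m ^ 2)
        (K := (β - α)⁻¹ * K ^ 2) ?_
      have hmom3 := ae_all_iff.2 fun m : ℤ => (hV.moment_three hαβ hT hUL hVL (c := 1)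
        (r := a * freq α β m ^ 2) fun t ht => hmom m 1 t (Ioo_subset_Icc_self ht)).and
        (hV.moment_three hαβ hT hUL hVL (c := Complex.I)
        (r := a * freq α β m ^ 2) fun t ht => hmom m Complex.I t (Ioo_subset_Icc_self ht))
      filter_upwards [hK, hmom3, ae_restrict_mem measurableSet_Ioo] with t h1 h2 ht F
      have ht' := Ioo_subset_Icc_self ht
      refine le_trans (le_of_eq (Finset.sum_congr rfl fun m _ => ?_))
        (sum_norm_realCoeff_sq_le hαβ h1.1 h1.2 F)
      rw [realCoeff_eq_mul hαβ (h1.1.integrable (by norm_num)) (hUi t ht') m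
        ((-(a * freq α β m ^ 2) ^ 3 : ℝ) : ℂ) ?_, hcoeff t ht', norm_mul, norm_mul,
        Complex.norm_real, Complex.norm_real, Real.norm_of_nonneg (Real.exp_pos _).le,
        Real.norm_eq_abs, mul_pow, mul_pow |_|, sq_abs]
      · ring
      · rintro d (rfl | rfl)
        · rw [(h2 m).1, ← integral_const_mul]
          congr 1
          funext x
          rw [mode_ofReal_mul]
          ring
        · rw [(h2 m).2, ← integral_const_mul]
          congr 1
          funext x
          rw [mode_ofReal_mul]
          ring
    have h4 := h3.mul_left ((a ^ 3)⁻¹ ^ 2)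
    refine h4.congr fun m => ?_
    rw [← mul_pow, ← mul_assoc, inv_mul_cancel₀ (by positivity), one_mul]
  have hsum : Summable fun m => ‖c m‖ := by
    simpa using summable_of_summable_sq hαβ (Nat.zero_le _) hspace
  refine ⟨c, hsum, ?_, fun t ht x hx => ?_⟩
  · have h1 := (summable_of_summable_sq hαβ le_rfl hspace).add
      (summable_of_summable_sq hαβ (show 4 ≤ 5 by norm_num) htime)
    refine h1.congr fun m => ?_
    have : |freq α β m| ^ 4 = freq α β m ^ 4 := by rw [← abs_pow, abs_of_nonneg (by positivity)]
    rw [this]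
    ring
  · have h1 := hasSum_mode hαβ (hUt t ht) (hper t ht) (by
      refine Summable.of_norm_bounded hsum fun m => ?_
      rw [norm_norm, hcoeff t ht, norm_mul, Complex.norm_real,
        Real.norm_of_nonneg (Real.exp_pos _).le]
      refine mul_le_of_le_one_left (norm_nonneg _) (Real.exp_le_one_iff.2 ?_)
      have := ht.1
      have : 0 ≤ a * freq α β m ^ 2 * t := by positivity
      linarith) hx
    simpa only [hcoeff t ht, mode_ofReal_mul] using h1

end

end EINLDG

end

theorem mainTheorem3 (α β T a a₀ ρ : ℝ) (k : ℕ) (U : ℝ → ℝ → ℝ)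
    (hαβ : α < β) (hT : 0 < T) (ha : 0 < a) (ha₀ : a / 2 < a₀) (hρ : 0 < ρ)
    (hU : EINLDG.IsPeriodicSolution α β T a a₀ U)
    (hsmooth : EINLDG.SmoothnessAssumption α β T k U) :
    ∃ C : ℝ, 0 < C ∧
      ∀ M : EINLDG.Mesh α β, M.QuasiUniform ρ →
      ∀ dt : ℝ, 0 < dt →
      ∀ u q u₁ q₁ : ℕ → M.DGSpace k,
        EINLDG.IsSecondOrderEINLDG a a₀ dt u q u₁ q₁ →
        EINLDG.Mesh.IsGaussRadauMinus (U 0) (u 0) →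
        ∀ n : ℕ, (n : ℝ) * dt ≤ T →
          EINLDG.Mesh.errorNorm (U ((n : ℝ) * dt)) (u n) ≤ C * (M.size ^ (k + 1) + dt ^ 2) := by
  obtain ⟨c, hc⟩ := EINLDG.exists_hasFourierSeries hαβ hT ha hU hsmooth
  obtain ⟨C, hC, h⟩ := EINLDG.exists_error_le_of_hasFourierSeries hαβ ha ha₀ hc
  exact ⟨C, hC, fun M _ dt hdt u q u₁ q₁ hs h0 n hn => h M dt hdt u q u₁ q₁ hs h0 n hn⟩
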